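/- Let $M=\mathbb Z^3$, $N=\mathrm{Hom}(M,\mathbb Z)$, let $\nabla=\mathrm{Conv}\{(1,0,0),(0,1,0),(0,0,1),(-1,-1,-1)\}\subset N_{\mathbb R}$ and let $\Delta=\{u\in M_{\mathbb R} : \langle x,u\rangle\ge -1\ \forall x\in\nabla\} =\mathrm{Conv}\{(3,-1,-1),(-1,3,-1),(-1,-1,3),(-1,-1,-1)\}$ be its dual polytope (the anticanonical polytope of $\mathbf P^3$). Let $X^\vee\to\mathbf P_\nabla$ be a smooth maximal projective crepant partial (MPCP) desingularization, i.e. $X^\vee$ is the complex toric variety, with respect to the lattice $M$, of a complete, smooth, projective fan $\Sigma$ in $M_{\mathbb R}$ which refines the normal fan of $\nabla$ and whose rays are generated by exactly the non-zero points of $\Delta\cap M$. Let $s_0\in \mathrm H^0(X^\vee,-K_{X^\vee})$ be the section whose divisor is the union of all toric divisors, and let $s\in \mathrm H^0(X^\vee,-K_{X^\vee})$ be a smooth section such that $\mathrm{div}(s_0s)$ is a simple normal crossing divisor. Let $Y^\vee\to X^\vee$ be the double cover constructed from the section $s_0s$ of $\mathcal O(-2K_{X^\vee})$, i.e. the relative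 spectrum of $\mathcal O\oplus\mathcal O(K_{X^\vee})$ with multiplication $\mathcal O(K_{X^\vee})^{\otimes 2}\to\mathcal O$ given by $s_0s$. Let $\Theta$ be the fan in $(M\times\mathbb Z)_{\mathbb R}$ consisting of the cones $\mathrm{Cone}\{(\eta_1,-1),(\eta_2,-1),(\eta_3,-1),(0,0,0,\pm1)\}$, where $\mathrm{Cone}\{\eta_1,\eta_2,\eta_3\}$ runs through the maximal cones of $\Sigma$ with primitive generators $\eta_j\in\Delta\cap M$, together with all their faces (this is the fan of the projective bundle $\mathbf P_{X^\vee}(\mathbb L\oplus\mathbb C)$, $\mathbb L$ being the total space of the anticanonical bundle of $X^\vee$), and let $X_{\Theta,\overline M_2}$ be the complex toric variety of $\Theta$ with respect to the sublattice $\overline M_2=M\times 2\mathbb Z$ of $M\times\mathbb Z$. Then $Y^\vee$ can be realized as a Calabi–Yau hypersurface in $X_{\Theta,\overline M_2}$: there is a closed immersion $Y^\vee\hookrightarrow X_{\Theta,\overline M_2}$ over $\mathbb C$ whose image is an effective Cartier divisor in the anticanonical class $-K_{X_{\Theta,\overline M_2}}$, and $Y^\vee$ is a normal variety with $\omega_{Y^\vee}\cong\mathcal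 O_{Y^\vee}$. -/

import Mathlib

open CategoryTheory CategoryTheory.Limits AlgebraicGeometry

noncomputable section

namespace ToricDoubleCover

/-! ### Gluing the spectra of a system of subalgebras -/

/-- A family of subalgebras `A j` of a `ℂ`-algebra `R`, indexed by a partially ordered set, such
that for `i ≤ k` the algebra `A i` is the localization of `A k` at one element, and such that for
`i, j ≤ k` the open sets `Spec (A i)` and `Spec (A j)` of `Spec (A k)` meet in some `Spec (A l)`. -/
structure ChartSystem (J : Type) [PartialOrder J] (R : Type) [CommRing R] [Algebra ℂ R] where
  A : J → Subalgebra ℂ R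
  anti : ∀ {i k : J}, i ≤ k → A k ≤ A i
  loc : ∀ {i k : J}, i ≤ k → ∃ u ∈ A k, (∃ v ∈ A i, u * v = 1) ∧
    ∀ a ∈ A i, ∃ N : ℕ, a * u ^ N ∈ A k
  meet : ∀ {i j k : J}, i ≤ k → j ≤ k → ∃ l, l ≤ i ∧ l ≤ j ∧ ∃ u₁ ∈ A k, ∃ u₂ ∈ A k,
    (∃ v₁ ∈ A i, u₁ * v₁ = 1) ∧ (∃ v₂ ∈ A j, u₂ * v₂ = 1) ∧
    ∀ a ∈ A l, ∃ N : ℕ, a * (u₁ * u₂) ^ N ∈ A k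

namespace ChartSystem

variable {J : Type} [PartialOrder J] {R : Type} [CommRing R] [Algebra ℂ R] (C : ChartSystem J R)

/-- The diagram `j ↦ Spec (A j)`. -/
def diagram : J ⥤ Scheme.{0} where
  obj j := Spec (.of (C.A j))
  map f := Spec.map (CommRingCat.ofHom (Subalgebra.inclusion (C.anti f.le)).toRingHom)
  map_id _ := Spec.map_id _
  map_comp _ _ := (Spec.map_comp _ _).symm ▸ rfl

theorem isLocalization_away {i k : J} (h : i ≤ k) (u : C.A k)
    (hu : ∃ v ∈ C.A i, (u : R) * v = 1) (hs : ∀ a ∈ C.A i, ∃ N : ℕ, a * (u : R) ^ N ∈ C.A k) :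
    letI := (Subalgebra.inclusion (C.anti h)).toRingHom.toAlgebra
    IsLocalization.Away u (C.A i) := by
  let := (Subalgebra.inclusion (C.anti h)).toRingHom.toAlgebra
  refine IsLocalization.Away.mk u ?_ ?_ ?_
  · obtain ⟨v, hv, huv⟩ := hu
    exact IsUnit.of_mul_eq_one ⟨v, hv⟩ (Subtype.ext huv)
  · intro a
    obtain ⟨N, hN⟩ := hs a a.2
    exact ⟨N, ⟨_, hN⟩, Subtype.ext rfl⟩
  · intro a b hab
    refine ⟨0, ?_⟩
    have : a = b := Subtype.ext (congrArg (fun x : C.A i => (x : R)) hab)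
    rw [this]

instance isOpenImmersion_map {i k : J} (f : i ⟶ k) : IsOpenImmersion (C.diagram.map f) := by
  obtain ⟨u, hu, hv, hs⟩ := C.loc f.le
  let := (Subalgebra.inclusion (C.anti f.le)).toRingHom.toAlgebra
  have := C.isLocalization_away f.le ⟨u, hu⟩ hv hs
  exact IsOpenImmersion.of_isLocalization (S := C.A i) (⟨u, hu⟩ : C.A k)

instance isLocallyDirected : (C.diagram ⋙ Scheme.forget).IsLocallyDirected where
  cond := by
    intro i j k fi fj xi xj h
    obtain ⟨l, hli, hlj, u₁, hu₁, u₂, hu₂, hv₁, hv₂, hs⟩ := C.meet fi.le fj.le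
    have hu : ∃ v ∈ C.A l, u₁ * u₂ * v = 1 := by
      obtain ⟨v₁, h₁, e₁⟩ := hv₁
      obtain ⟨v₂, h₂, e₂⟩ := hv₂
      refine ⟨v₁ * v₂, (C.A l).mul_mem (C.anti hli h₁) (C.anti hlj h₂), ?_⟩
      rw [mul_mul_mul_comm, e₁, e₂, one_mul]
    let u₁' : C.A k := ⟨u₁, hu₁⟩
    let u₂' : C.A k := ⟨u₂, hu₂⟩
    let := (Subalgebra.inclusion (C.anti (hli.trans fi.le))).toRingHom.toAlgebra
    have hl := C.isLocalization_away (hli.trans fi.le) (u₁' * u₂') hu hs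
    let p : PrimeSpectrum (C.A k) := C.diagram.map fi xi
    have hp₁ : u₁' ∉ p.asIdeal := by
      intro hmem
      have h1 : (Subalgebra.inclusion (C.anti fi.le)) u₁' ∈
        PrimeSpectrum.asIdeal (R := C.A i) xi := hmem
      obtain ⟨v₁, h₁, e₁⟩ := hv₁
      refine (PrimeSpectrum.isPrime (R := C.A i) xi).ne_top ((Ideal.eq_top_iff_one _).mpr ?_)
      have := Ideal.mul_mem_right (⟨v₁, h₁⟩ : C.A i) _ h1
      rwa [show Subalgebra.inclusion (C.anti fi.le) u₁' * ⟨v₁, h₁⟩ = 1 from Subtype.ext e₁] at this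
    have hpj : p = C.diagram.map fj xj := h
    have hp₂ : u₂' ∉ p.asIdeal := by
      rw [hpj]
      intro hmem
      have h1 : (Subalgebra.inclusion (C.anti fj.le)) u₂' ∈
        PrimeSpectrum.asIdeal (R := C.A j) xj := hmem
      obtain ⟨v₁, h₁, e₁⟩ := hv₂
      refine (PrimeSpectrum.isPrime (R := C.A j) xj).ne_top ((Ideal.eq_top_iff_one _).mpr ?_)
      have := Ideal.mul_mem_right (⟨v₁, h₁⟩ : C.A j) _ h1
      rwa [show Subalgebra.inclusion (C.anti fj.le) u₂' * ⟨v₁, h₁⟩ = 1 from Subtype.ext e₁] at this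
    have hp : p ∈ Set.range (PrimeSpectrum.comap (algebraMap (C.A k) (C.A l))) := by
      rw [PrimeSpectrum.localization_away_comap_range (C.A l) (u₁' * u₂')]
      exact fun hm => (p.isPrime.mem_or_mem hm).elim hp₁ hp₂
    obtain ⟨q, hq⟩ := hp
    have hq' : C.diagram.map (homOfLE (hli.trans fi.le)) q = p := hq
    refine ⟨l, homOfLE hli, homOfLE hlj, q, ?_, ?_⟩
    · apply (C.diagram.map fi).isOpenEmbedding.injective
      refine Eq.trans ?_ hq'
      change (C.diagram.map (homOfLE hli) ≫ C.diagram.map fi) q = _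
      rw [← C.diagram.map_comp]
      rfl
    · apply (C.diagram.map fj).isOpenEmbedding.injective
      refine Eq.trans ?_ (hq'.trans hpj)
      change (C.diagram.map (homOfLE hlj) ≫ C.diagram.map fj) q = _
      rw [← C.diagram.map_comp]
      rfl

/-- The scheme glued from the affine schemes `Spec (A j)`. -/
def scheme : Scheme.{0} := colimit C.diagram

/-- The structure morphism of the glued scheme. -/
def structureMap : C.scheme ⟶ Spec (.of ℂ) :=
  colimit.desc C.diagram
    { pt := Spec (.of ℂ)
      ι :=
        { app := fun j => Spec.map (CommRingCat.ofHom (algebraMap ℂ (C.A j)))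
          naturality := fun _ _ _ => (Spec.map_comp _ _).symm.trans (Category.comp_id _).symm } }

end ChartSystem

/-! ### Simplicial cones and toric varieties -/

/-- The vector of `ℤⁿ` as a rational vector. -/
def ratVec {n : ℕ} (v : Fin n → ℤ) : Fin n → ℚ := fun i => (v i : ℚ)

/-- The vector of `ℤⁿ` as a real vector. -/
def realVec {n : ℕ} (v : Fin n → ℤ) : Fin n → ℝ := fun i => (v i : ℝ)

/-- The pairing of a rational covector with an integral vector. -/
def pairing {n : ℕ} (m : Fin n → ℚ) (v : Fin n → ℤ) : ℚ := ∑ i, m i * v i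

theorem pairing_add {n : ℕ} (m m' : Fin n → ℚ) (v : Fin n → ℤ) :
    pairing (m + m') v = pairing m v + pairing m' v := by
  simp [pairing, add_mul, Finset.sum_add_distrib]

theorem pairing_nsmul {n : ℕ} (k : ℕ) (m : Fin n → ℚ) (v : Fin n → ℤ) :
    pairing (k • m) v = k * pairing m v := by
  simp [pairing, Finset.mul_sum, mul_assoc]

/-- The lattice dual to a lattice `Λ ⊆ ℤⁿ` of full rank, inside `ℚⁿ`. It is the character lattice of
the torus with lattice of one-parameter subgroups `Λ`. -/
def dualLattice {n : ℕ} (Λ : AddSubgroup (Fin n → ℤ)) : AddSubgroup (Fin n → ℚ) where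
  carrier := {m | ∀ u ∈ Λ, ∃ k : ℤ, pairing m u = k}
  zero_mem' := fun _ _ => ⟨0, by simp [pairing]⟩
  add_mem' := by
    intro a b ha hb u hu
    obtain ⟨k, hk⟩ := ha u hu
    obtain ⟨l, hl⟩ := hb u hu
    exact ⟨k + l, by rw [pairing_add, hk, hl]; push_cast; rfl⟩
  neg_mem' := by
    intro a ha u hu
    obtain ⟨k, hk⟩ := ha u hu
    refine ⟨-k, ?_⟩
    rw [Int.cast_neg, ← hk]
    simp [pairing]

/-- The coordinate ring of the torus with lattice of one-parameter subgroups `Λ`. -/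
abbrev Laurent {n : ℕ} (Λ : AddSubgroup (Fin n → ℤ)) : Type := AddMonoidAlgebra ℂ (dualLattice Λ)

/-- The Laurent polynomials all of whose exponents `m` satisfy `⟨m, v⟩ ≥ k` for all `v ∈ V`. -/
def cutoff {n : ℕ} (Λ : AddSubgroup (Fin n → ℤ)) (V : Set (Fin n → ℤ)) (k : ℤ) :
    Submodule ℂ (Laurent Λ) where
  carrier := {f | ∀ m ∈ f.coeff.support, ∀ v ∈ V, (k : ℚ) ≤ pairing m.1 v}
  zero_mem' := by simp
  add_mem' := by
    classical
    intro f g hf hg m hm v hv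
    rcases Finset.mem_union.mp (Finsupp.support_add hm) with h | h
    · exact hf m h v hv
    · exact hg m h v hv
  smul_mem' := fun _ _ hf m hm v hv => hf m (Finsupp.support_smul hm) v hv

theorem cutoff_mul {n : ℕ} {Λ : AddSubgroup (Fin n → ℤ)} {V : Set (Fin n → ℤ)} {k l : ℤ}
    {f g : Laurent Λ} (hf : f ∈ cutoff Λ V k) (hg : g ∈ cutoff Λ V l) :
    f * g ∈ cutoff Λ V (k + l) := by
  classical
  intro m hm v hv
  obtain ⟨a, ha, b, hb, rfl⟩ :=
    Finset.mem_add.mp (AddMonoidAlgebra.support_coeff_mul_subset f g hm)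
  rw [Int.cast_add, AddSubgroup.coe_add, pairing_add]
  exact add_le_add (hf a ha v hv) (hg b hb v hv)

theorem cutoff_anti {n : ℕ} {Λ : AddSubgroup (Fin n → ℤ)} {V W : Set (Fin n → ℤ)} (h : V ⊆ W)
    (k : ℤ) : cutoff Λ W k ≤ cutoff Λ V k :=
  fun _ hf m hm v hv => hf m hm v (h hv)

theorem cutoff_mono {n : ℕ} {Λ : AddSubgroup (Fin n → ℤ)} {V : Set (Fin n → ℤ)} {k l : ℤ}
    (h : k ≤ l) : cutoff Λ V l ≤ cutoff Λ V k :=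
  fun _ hf m hm v hv => (Int.cast_le.mpr h).trans (hf m hm v hv)

theorem single_mem_cutoff {n : ℕ} {Λ : AddSubgroup (Fin n → ℤ)} {V : Set (Fin n → ℤ)} {k : ℤ}
    (m : dualLattice Λ) (c : ℂ) (h : ∀ v ∈ V, (k : ℚ) ≤ pairing m.1 v) :
    (AddMonoidAlgebra.single m c : Laurent Λ) ∈ cutoff Λ V k := by
  intro m' hm'
  have : m' = m := by
    have := Finsupp.support_single_subset hm'
    simpa using this
  rw [this]
  exact h

/-- The semigroup algebra `ℂ[σ^∨ ∩ Λ^∨]` of the cone generated by `V`. -/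
def coneAlgebra {n : ℕ} (Λ : AddSubgroup (Fin n → ℤ)) (V : Set (Fin n → ℤ)) :
    Subalgebra ℂ (Laurent Λ) where
  carrier := cutoff Λ V 0
  zero_mem' := (cutoff Λ V 0).zero_mem
  add_mem' := (cutoff Λ V 0).add_mem
  mul_mem' := fun hf hg => by simpa using cutoff_mul hf hg
  algebraMap_mem' := fun c => single_mem_cutoff 0 c (by simp [pairing])

/-- A collection of simplicial rational cones in `ℝⁿ`, closed under taking faces: each cone is given
by the set of its chosen integral generators, one on each ray. -/
structure ConeComplex (n : ℕ) where
  cones : Set (Finset (Fin n → ℤ))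
  down_closed : ∀ {σ τ : Finset (Fin n → ℤ)}, σ ∈ cones → τ ⊆ σ → τ ∈ cones
  linearIndependent : ∀ {σ : Finset (Fin n → ℤ)}, σ ∈ cones →
    LinearIndependent ℚ (fun v : σ => ratVec v.1)

/-- The generators of the rays. -/
def ConeComplex.rays {n : ℕ} (S : ConeComplex n) : Set (Fin n → ℤ) := {v | {v} ∈ S.cones}

theorem ConeComplex.subset_rays {n : ℕ} (S : ConeComplex n) {σ : Finset (Fin n → ℤ)}
    (h : σ ∈ S.cones) : (σ : Set (Fin n → ℤ)) ⊆ S.rays :=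
  fun _ hv => S.down_closed h (Finset.singleton_subset_iff.mpr hv)

/-- A character vanishing on a face and positive on the other generators of a simplicial cone. -/
theorem exists_face_character {n : ℕ} (Λ : AddSubgroup (Fin n → ℤ)) {σ : Finset (Fin n → ℤ)}
    (hσ : LinearIndependent ℚ (fun v : σ => ratVec v.1)) (τ : Finset (Fin n → ℤ)) :
    ∃ m : dualLattice Λ, (∀ v ∈ σ, v ∈ τ → pairing m.1 v = 0) ∧
      ∀ v ∈ σ, v ∉ τ → 0 < pairing m.1 v := by
  classical
  let c : σ → ℚ := fun v => if v.1 ∈ τ then 0 else 1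
  obtain ⟨φ, hφ⟩ := LinearMap.exists_extend ((Module.Basis.span hσ).constr ℚ c)
  have hφv : ∀ v : σ, φ (ratVec v.1) = c v := by
    intro v
    have h1 := (Module.Basis.span hσ).constr_basis ℚ c v
    rw [← hφ] at h1
    simpa [Module.Basis.span_apply] using h1
  let m₀ : Fin n → ℚ := fun i => φ (Pi.single i 1)
  have hm₀ : ∀ v : Fin n → ℤ, pairing m₀ v = φ (ratVec v) := by
    intro v
    rw [LinearMap.pi_apply_eq_sum_univ φ (ratVec v)]
    refine Finset.sum_congr rfl fun i _ => ?_
    simp only [m₀, ratVec, smul_eq_mul]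
    rw [mul_comm]
    congr 2
    ext j
    simp [Pi.single_apply, eq_comm]
  let D : ℕ := ∏ i, (m₀ i).den
  have hD : 0 < D := Finset.prod_pos fun i _ => (m₀ i).den_pos
  have hint : ∀ i, ∃ k : ℤ, (D : ℚ) * m₀ i = k := by
    intro i
    obtain ⟨e, he⟩ : (m₀ i).den ∣ D := Finset.dvd_prod_of_mem _ (Finset.mem_univ i)
    refine ⟨e * (m₀ i).num, ?_⟩
    rw [he]
    push_cast
    rw [mul_comm ((m₀ i).den : ℚ), mul_assoc, Rat.den_mul_eq_num]
  choose k hk using hint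
  have hmem : D • m₀ ∈ dualLattice Λ := by
    intro u _
    refine ⟨∑ i, k i * u i, ?_⟩
    push_cast
    refine Finset.sum_congr rfl fun i _ => ?_
    rw [← hk i]
    simp
  refine ⟨⟨D • m₀, hmem⟩, fun v hv hvτ => ?_, fun v hv hvτ => ?_⟩
  · change pairing (D • m₀) v = 0
    rw [pairing_nsmul, hm₀, hφv ⟨v, hv⟩]
    simp [c, hvτ]
  · change 0 < pairing (D • m₀) v
    rw [pairing_nsmul, hm₀, hφv ⟨v, hv⟩]
    simpa [c, hvτ] using hD

/-- The monomial with exponent `m`. -/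
def monomial {n : ℕ} {Λ : AddSubgroup (Fin n → ℤ)} (m : dualLattice Λ) : Laurent Λ :=
  AddMonoidAlgebra.single m 1

theorem monomial_mul {n : ℕ} {Λ : AddSubgroup (Fin n → ℤ)} (m m' : dualLattice Λ) :
    monomial m * monomial m' = monomial (m + m') := by
  simp [monomial, AddMonoidAlgebra.single_mul_single]

theorem monomial_zero {n : ℕ} {Λ : AddSubgroup (Fin n → ℤ)} :
    monomial (0 : dualLattice Λ) = 1 := rfl

theorem monomial_pow {n : ℕ} {Λ : AddSubgroup (Fin n → ℤ)} (m : dualLattice Λ) (N : ℕ) :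
    monomial m ^ N = monomial (N • m) := by
  simp [monomial, AddMonoidAlgebra.single_pow]

theorem exists_mul_monomial_mem {n : ℕ} {Λ : AddSubgroup (Fin n → ℤ)}
    {σ τ : Finset (Fin n → ℤ)} (m : dualLattice Λ)
    (h0 : ∀ v ∈ σ, v ∈ τ → pairing m.1 v = 0) (h1 : ∀ v ∈ σ, v ∉ τ → 0 < pairing m.1 v)
    {k : ℤ} {f : Laurent Λ} (hf : f ∈ cutoff Λ τ k) :
    ∃ N₀ : ℕ, ∀ N ≥ N₀, f * monomial m ^ N ∈ cutoff Λ σ k := by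
  classical
  have key : ∀ a : dualLattice Λ, ∀ v : Fin n → ℤ, ∃ N₀ : ℕ, v ∈ σ → v ∉ τ →
      ∀ N ≥ N₀, (k : ℚ) ≤ pairing a.1 v + N * pairing m.1 v := by
    intro a v
    by_cases hv : v ∈ σ ∧ v ∉ τ
    · have hpos := h1 v hv.1 hv.2
      obtain ⟨N₀, hN₀⟩ := exists_nat_ge (((k : ℚ) - pairing a.1 v) / pairing m.1 v)
      refine ⟨N₀, fun _ _ N hN => ?_⟩
      rw [div_le_iff₀ hpos] at hN₀
      have : (N₀ : ℚ) * pairing m.1 v ≤ N * pairing m.1 v :=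
        mul_le_mul_of_nonneg_right (by exact_mod_cast hN) hpos.le
      linarith
    · exact ⟨0, fun h h' => absurd ⟨h, h'⟩ hv⟩
  choose M hM using key
  refine ⟨∑ a ∈ f.coeff.support, ∑ v ∈ σ, M a v, fun N hN b hb v hv => ?_⟩
  rw [monomial_pow] at hb
  obtain ⟨a, ha, c, hc, rfl⟩ :=
    Finset.mem_add.mp (AddMonoidAlgebra.support_coeff_mul_subset _ _ hb)
  have hc' : c = N • m := by
    have := Finsupp.support_single_subset hc
    simpa using this
  subst hc'
  rw [AddSubgroup.coe_add, pairing_add, AddSubgroup.coe_nsmul, pairing_nsmul]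
  by_cases hvτ : v ∈ τ
  · rw [h0 v hv hvτ, mul_zero, add_zero]
    exact hf a ha v hvτ
  · refine hM a v hv hvτ N (le_trans ?_ hN)
    exact (Finset.single_le_sum (f := fun v => M a v) (fun _ _ => Nat.zero_le _) hv).trans
      (Finset.single_le_sum (f := fun a => ∑ v ∈ σ, M a v) (fun _ _ => Nat.zero_le _) ha)

theorem pairing_neg {n : ℕ} (m : Fin n → ℚ) (v : Fin n → ℤ) :
    pairing (-m) v = -pairing m v := by
  simp [pairing]

theorem monomial_mem {n : ℕ} {Λ : AddSubgroup (Fin n → ℤ)} {σ τ : Finset (Fin n → ℤ)}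
    {m : dualLattice Λ} (h0 : ∀ v ∈ σ, v ∈ τ → pairing m.1 v = 0)
    (h1 : ∀ v ∈ σ, v ∉ τ → 0 < pairing m.1 v) : monomial m ∈ coneAlgebra Λ (σ : Set _) := by
  refine single_mem_cutoff m 1 fun v hv => ?_
  rw [Int.cast_zero]
  by_cases hvτ : v ∈ τ
  · exact (h0 v hv hvτ).ge
  · exact (h1 v hv hvτ).le

theorem monomial_neg_mem {n : ℕ} {Λ : AddSubgroup (Fin n → ℤ)} {σ τ : Finset (Fin n → ℤ)}
    {m : dualLattice Λ} (h0 : ∀ v ∈ σ, v ∈ τ → pairing m.1 v = 0) (hτ : τ ⊆ σ) :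
    monomial (-m) ∈ coneAlgebra Λ (τ : Set _) := by
  refine single_mem_cutoff (-m) 1 fun v hv => ?_
  rw [AddSubgroup.coe_neg, pairing_neg, h0 v (hτ hv) hv]
  simp

theorem monomial_mul_neg {n : ℕ} {Λ : AddSubgroup (Fin n → ℤ)} (m : dualLattice Λ) :
    monomial m * monomial (-m) = 1 := by
  rw [monomial_mul, add_neg_cancel, monomial_zero]

theorem face_character_inter {n : ℕ} {Λ : AddSubgroup (Fin n → ℤ)}
    {σ τ₁ τ₂ : Finset (Fin n → ℤ)} {m₁ m₂ : dualLattice Λ}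
    (h0 : ∀ v ∈ σ, v ∈ τ₁ → pairing m₁.1 v = 0) (h1 : ∀ v ∈ σ, v ∉ τ₁ → 0 < pairing m₁.1 v)
    (h0' : ∀ v ∈ σ, v ∈ τ₂ → pairing m₂.1 v = 0) (h1' : ∀ v ∈ σ, v ∉ τ₂ → 0 < pairing m₂.1 v) :
    (∀ v ∈ σ, v ∈ τ₁ ∩ τ₂ → pairing (m₁ + m₂).1 v = 0) ∧
      ∀ v ∈ σ, v ∉ τ₁ ∩ τ₂ → 0 < pairing (m₁ + m₂).1 v := by
  refine ⟨fun v hv hvτ => ?_, fun v hv hvτ => ?_⟩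
  · rw [Finset.mem_inter] at hvτ
    rw [AddSubgroup.coe_add, pairing_add, h0 v hv hvτ.1, h0' v hv hvτ.2, add_zero]
  · rw [AddSubgroup.coe_add, pairing_add]
    by_cases h : v ∈ τ₁
    · have h' : v ∉ τ₂ := fun h' => hvτ (Finset.mem_inter.mpr ⟨h, h'⟩)
      rw [h0 v hv h, zero_add]
      exact h1' v hv h'
    · refine add_pos_of_pos_of_nonneg (h1 v hv h) ?_
      by_cases h' : v ∈ τ₂
      · exact (h0' v hv h').ge
      · exact (h1' v hv h').le

/-- The affine charts of the toric variety of a cone complex with respect to the lattice `Λ`. -/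
def toricCharts {n : ℕ} (S : ConeComplex n) (Λ : AddSubgroup (Fin n → ℤ)) :
    ChartSystem S.cones (Laurent Λ) where
  A σ := coneAlgebra Λ (σ.1 : Set _)
  anti h := cutoff_anti (Finset.coe_subset.mpr h) 0
  loc {τ σ} h := by
    obtain ⟨m, h0, h1⟩ := exists_face_character Λ (S.linearIndependent σ.2) τ.1
    refine ⟨monomial m, monomial_mem h0 h1, ⟨_, monomial_neg_mem h0 h, monomial_mul_neg m⟩,
      fun a ha => ?_⟩
    obtain ⟨N, hN⟩ := exists_mul_monomial_mem m h0 h1 ha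
    exact ⟨N, hN N le_rfl⟩
  meet {τ₁ τ₂ σ} h h' := by
    obtain ⟨m₁, h0, h1⟩ := exists_face_character Λ (S.linearIndependent σ.2) τ₁.1
    obtain ⟨m₂, h0', h1'⟩ := exists_face_character Λ (S.linearIndependent σ.2) τ₂.1
    obtain ⟨g0, g1⟩ := face_character_inter h0 h1 h0' h1'
    refine ⟨⟨τ₁.1 ∩ τ₂.1, S.down_closed τ₁.2 Finset.inter_subset_left⟩,
      Finset.inter_subset_left, Finset.inter_subset_right, _, monomial_mem h0 h1, _,
      monomial_mem h0' h1', ⟨_, monomial_neg_mem h0 h, monomial_mul_neg m₁⟩,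
      ⟨_, monomial_neg_mem h0' h', monomial_mul_neg m₂⟩, fun a ha => ?_⟩
    obtain ⟨N, hN⟩ := exists_mul_monomial_mem _ g0 g1 ha
    exact ⟨N, by rw [monomial_mul]; exact hN N le_rfl⟩

/-- The toric variety over `ℂ` of the fan `S` with respect to the lattice `Λ`. -/
def toricVariety {n : ℕ} (S : ConeComplex n) (Λ : AddSubgroup (Fin n → ℤ)) : Scheme.{0} :=
  (toricCharts S Λ).scheme

/-- Its structure morphism. -/
def toricVariety.toSpec {n : ℕ} (S : ConeComplex n) (Λ : AddSubgroup (Fin n → ℤ)) :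
    toricVariety S Λ ⟶ Spec (.of ℂ) :=
  (toricCharts S Λ).structureMap

/-! ### The double cover -/

/-- The global sections of the anticanonical sheaf `𝒪(∑ D_ρ)` of the toric variety of `S` with
respect to `ℤⁿ` (for `S` whose chosen generators are primitive): the span of the monomials with
exponents in the polytope of `∑ D_ρ`. The constant `1` is the section with divisor `∑ D_ρ`. -/
def anticanonicalSections {n : ℕ} (S : ConeComplex n) :
    Submodule ℂ (Laurent (⊤ : AddSubgroup (Fin n → ℤ))) :=
  cutoff ⊤ S.rays (-1)

/-- Over the chart of the cone generated by `V`, the algebra `𝒪 ⊕ L⁻¹` with `L = 𝒪(∑ D_ρ)`, inside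
the quadratic algebra over the ring of Laurent polynomials with `y² = f`. -/
def coverAlgebra {n : ℕ} {V : Set (Fin n → ℤ)}
    {f : Laurent (⊤ : AddSubgroup (Fin n → ℤ))} (hf : f ∈ cutoff ⊤ V (-1)) :
    Subalgebra ℂ (QuadraticAlgebra (Laurent (⊤ : AddSubgroup (Fin n → ℤ))) f 0) where
  carrier := {z | z.re ∈ cutoff ⊤ V 0 ∧ z.im ∈ cutoff ⊤ V 1}
  zero_mem' := ⟨Submodule.zero_mem _, Submodule.zero_mem _⟩
  add_mem' := fun hz hw => ⟨Submodule.add_mem _ hz.1 hw.1, Submodule.add_mem _ hz.2 hw.2⟩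
  mul_mem' := by
    intro z w hz hw
    refine ⟨?_, ?_⟩
    · rw [QuadraticAlgebra.re_mul]
      refine Submodule.add_mem _ ?_ ?_
      · simpa using cutoff_mul hz.1 hw.1
      · exact cutoff_mono (by norm_num) (cutoff_mul (cutoff_mul hf hz.2) hw.2)
    · rw [QuadraticAlgebra.im_mul, zero_mul, zero_mul, add_zero]
      refine Submodule.add_mem _ ?_ ?_
      · simpa using cutoff_mul hz.1 hw.2
      · simpa using cutoff_mul hz.2 hw.1
  algebraMap_mem' := fun c =>
    ⟨(coneAlgebra ⊤ V).algebraMap_mem c, Submodule.zero_mem _⟩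

/-- The affine charts of the double cover. -/
def coverCharts {n : ℕ} (S : ConeComplex n) (s : anticanonicalSections S) :
    ChartSystem S.cones (QuadraticAlgebra (Laurent (⊤ : AddSubgroup (Fin n → ℤ))) s.1 0) where
  A σ := coverAlgebra (cutoff_anti (S.subset_rays σ.2) (-1) s.2)
  anti h := fun _ hz => ⟨cutoff_anti (Finset.coe_subset.mpr h) 0 hz.1,
    cutoff_anti (Finset.coe_subset.mpr h) 1 hz.2⟩
  loc {τ σ} h := by
    obtain ⟨m, h0, h1⟩ := exists_face_character ⊤ (S.linearIndependent σ.2) τ.1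
    refine ⟨algebraMap _ _ (monomial m), ⟨monomial_mem h0 h1, Submodule.zero_mem _⟩,
      ⟨algebraMap _ _ (monomial (-m)), ⟨monomial_neg_mem h0 h, Submodule.zero_mem _⟩, ?_⟩,
      fun z hz => ?_⟩
    · rw [← map_mul, monomial_mul_neg, map_one]
    · obtain ⟨N, hN⟩ := exists_mul_monomial_mem m h0 h1 hz.1
      obtain ⟨N', hN'⟩ := exists_mul_monomial_mem m h0 h1 hz.2
      refine ⟨max N N', ?_, ?_⟩
      · rw [← map_pow]
        simpa [-map_pow] using hN _ (le_max_left N N')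
      · rw [← map_pow]
        simpa [-map_pow] using hN' _ (le_max_right N N')
  meet {τ₁ τ₂ σ} h h' := by
    obtain ⟨m₁, h0, h1⟩ := exists_face_character ⊤ (S.linearIndependent σ.2) τ₁.1
    obtain ⟨m₂, h0', h1'⟩ := exists_face_character ⊤ (S.linearIndependent σ.2) τ₂.1
    obtain ⟨g0, g1⟩ := face_character_inter h0 h1 h0' h1'
    refine ⟨⟨τ₁.1 ∩ τ₂.1, S.down_closed τ₁.2 Finset.inter_subset_left⟩,
      Finset.inter_subset_left, Finset.inter_subset_right,
      algebraMap _ _ (monomial m₁), ⟨monomial_mem h0 h1, Submodule.zero_mem _⟩,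
      algebraMap _ _ (monomial m₂), ⟨monomial_mem h0' h1', Submodule.zero_mem _⟩,
      ⟨algebraMap _ _ (monomial (-m₁)), ⟨monomial_neg_mem h0 h, Submodule.zero_mem _⟩, ?_⟩,
      ⟨algebraMap _ _ (monomial (-m₂)), ⟨monomial_neg_mem h0' h', Submodule.zero_mem _⟩, ?_⟩,
      fun z hz => ?_⟩
    · rw [← map_mul, monomial_mul_neg, map_one]
    · rw [← map_mul, monomial_mul_neg, map_one]
    · obtain ⟨N, hN⟩ := exists_mul_monomial_mem _ g0 g1 hz.1
      obtain ⟨N', hN'⟩ := exists_mul_monomial_mem _ g0 g1 hz.2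
      refine ⟨max N N', ?_, ?_⟩
      · rw [← map_mul, monomial_mul, ← map_pow]
        simpa [-map_pow] using hN _ (le_max_left N N')
      · rw [← map_mul, monomial_mul, ← map_pow]
        simpa [-map_pow] using hN' _ (le_max_right N N')

/-- The double cover of the toric variety of `S` (with respect to `ℤⁿ`) constructed from the section
`s₀ · s` of `L²`, where `L = 𝒪(∑ D_ρ)` is the anticanonical sheaf, `s₀` is the section `1` of `L`
and `s` is the given section of `L`: the relative spectrum of `𝒪 ⊕ L⁻¹` with the multiplication
`L⁻¹ ⊗ L⁻¹ → 𝒪` given by `s₀ · s`. -/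
def doubleCover {n : ℕ} (S : ConeComplex n) (s : anticanonicalSections S) : Scheme.{0} :=
  (coverCharts S s).scheme

/-- The covering map. -/
def doubleCover.map {n : ℕ} (S : ConeComplex n) (s : anticanonicalSections S) :
    doubleCover S s ⟶ toricVariety S ⊤ :=
  colimMap
    { app := fun σ => Spec.map (CommRingCat.ofHom
        (((algebraMap _ (QuadraticAlgebra (Laurent ⊤) s.1 0)).comp
          ((toricCharts S ⊤).A σ).val.toRingHom).codRestrict ((coverCharts S s).A σ)
          fun a => ⟨a.2, Submodule.zero_mem _⟩))
      naturality := fun σ τ h => by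
        change Spec.map _ ≫ Spec.map _ = Spec.map _ ≫ Spec.map _
        rw [← Spec.map_comp, ← Spec.map_comp]
        rfl }

/-- The structure morphism of the double cover. -/
def doubleCover.toSpec {n : ℕ} (S : ConeComplex n) (s : anticanonicalSections S) :
    doubleCover S s ⟶ Spec (.of ℂ) :=
  doubleCover.map S s ≫ toricVariety.toSpec S ⊤

/-! ### Simple normal crossings -/

/-- In the chart of the cone generated by `V`, the ideal of the zero scheme of `f`, viewed as a section of
`𝒪(k ∑ D_ρ)`: the image of `𝒪(-k ∑ D_ρ)` under multiplication by `f`. -/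
def zeroIdeal {n : ℕ} (V : Set (Fin n → ℤ)) (k : ℤ) (f : Laurent (⊤ : AddSubgroup (Fin n → ℤ))) :
    Ideal (coneAlgebra ⊤ V) :=
  Ideal.span {a | ∃ b ∈ cutoff ⊤ V k, (a : Laurent ⊤) = b * f}

/-- `x` is a regular system of parameters of the local ring `R`. -/
def IsRegularSystem {R : Type} [CommRing R] [IsLocalRing R] {d : ℕ} (x : Fin d → R) : Prop :=
  IsNoetherianRing R ∧ ringKrullDim R = d ∧
    Ideal.span (Set.range x) = IsLocalRing.maximalIdeal R

/-- The closed subscheme of `Spec A` with ideal `I` is a simple normal crossing divisor: at every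
point it is defined by the product of a subset of a regular system of parameters. -/
def IsSNC {A : Type} [CommRing A] (I : Ideal A) : Prop :=
  ∀ (p : Ideal A) [p.IsPrime], ∃ (d : ℕ) (x : Fin d → Localization.AtPrime p) (T : Finset (Fin d)),
    IsRegularSystem x ∧
      I.map (algebraMap A (Localization.AtPrime p)) = Ideal.span {∏ j ∈ T, x j}

/-- The closed subscheme of `Spec A` with ideal `I` is a regular divisor: at every point of it, it
is defined by a member of a regular system of parameters. -/
def IsRegularDivisor {A : Type} [CommRing A] (I : Ideal A) : Prop :=
  ∀ (p : Ideal A) [p.IsPrime], I ≤ p →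
    ∃ (d : ℕ) (x : Fin d → Localization.AtPrime p) (j : Fin d), IsRegularSystem x ∧
      I.map (algebraMap A (Localization.AtPrime p)) = Ideal.span {x j}

/-- The section `s` of the anticanonical sheaf is smooth, and the divisor of `s₀ · s` (the union of
the toric divisors and the divisor of `s`) is a simple normal crossing divisor. -/
def IsAdmissible {n : ℕ} (S : ConeComplex n) (s : anticanonicalSections S) : Prop :=
  ∀ σ ∈ S.cones, IsRegularDivisor (zeroIdeal (σ : Set (Fin n → ℤ)) 1 s.1) ∧
    IsSNC (zeroIdeal (σ : Set (Fin n → ℤ)) 2 s.1)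

/-! ### The base of the mirror of the double cover of `ℙ³` -/

/-- The cone in `ℝⁿ` generated by `σ`. -/
def realCone {n : ℕ} (σ : Finset (Fin n → ℤ)) : Set (Fin n → ℝ) :=
  {x | ∃ c : (Fin n → ℤ) → ℝ, (∀ v, 0 ≤ c v) ∧ x = ∑ v ∈ σ, c v • realVec v}

/-- The polytope `∇ = Conv {e₁, e₂, e₃, -e₁ - e₂ - e₃}`. -/
def nabla : Set (Fin 3 → ℝ) :=
  convexHull ℝ {![1, 0, 0], ![0, 1, 0], ![0, 0, 1], ![-1, -1, -1]}

/-- The dual polytope `Δ = ∇^∨`, the anticanonical polytope of `ℙ³`. -/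
def delta : Set (Fin 3 → ℝ) := {u | ∀ x ∈ nabla, -1 ≤ ∑ i, x i * u i}

/-- `S` is the fan of a smooth maximal projective crepant partial desingularization of the toric
variety `ℙ_∇`, whose fan is the normal fan of `∇`. -/
structure IsSmoothMPCPFan (S : ConeComplex 3) : Prop where
  finite : S.cones.Finite
  /-- the cones meet in common faces -/
  inter : ∀ σ ∈ S.cones, ∀ τ ∈ S.cones, realCone σ ∩ realCone τ = realCone (σ ∩ τ)
  complete : ∀ x : Fin 3 → ℝ, ∃ σ ∈ S.cones, x ∈ realCone σ
  /-- every cone lies in a cone of the normal fan of `∇`, that is, in the set of the vectors which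
  attain their minimum on `∇` at a given point `w` of `∇` -/
  refines : ∀ σ ∈ S.cones, ∃ w ∈ nabla, ∀ u ∈ realCone σ, ∀ x ∈ nabla,
    ∑ i, w i * u i ≤ ∑ i, x i * u i
  /-- the rays are generated by all the non-zero lattice points of `Δ` -/
  rays : ∀ v, v ∈ S.rays ↔ v ≠ 0 ∧ realVec v ∈ delta
  smooth : ∀ σ ∈ S.cones, ∃ b : Module.Basis (Fin 3) ℤ (Fin 3 → ℤ), ∀ v ∈ σ, v ∈ Set.range b
  /-- there is a strictly convex function which is linear on the cones -/
  projective : ∃ h : (Fin 3 → ℤ) → ℝ, ∀ σ ∈ S.cones, σ.card = 3 → ∃ l : Fin 3 → ℝ,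
    (∀ v ∈ σ, ∑ i, l i * v i = h v) ∧ ∀ v ∈ S.rays, v ∉ σ → ∑ i, l i * v i < h v

/-! ### The fan `Θ` and the sublattice `M × 2ℤ` -/

/-- The generators of the cones `τ₀` (for `ε = 1`) and `τ_∞` (for `ε = -1`). -/
def liftCone (τ : Finset (Fin 3 → ℤ)) (ε : ℤ) : Finset (Fin 4 → ℤ) :=
  insert ![0, 0, 0, ε] (τ.image fun η => ![η 0, η 1, η 2, -1])

theorem linearIndependent_of_dual {n : ℕ} {σ : Finset (Fin n → ℤ)}
    (h : ∀ v ∈ σ, ∃ m : Fin n → ℚ, pairing m v ≠ 0 ∧ ∀ w ∈ σ, w ≠ v → pairing m w = 0) :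
    LinearIndependent ℚ (fun v : σ => ratVec v.1) := by
  classical
  rw [Fintype.linearIndependent_iff]
  intro g hg v
  obtain ⟨m, hm, hm'⟩ := h v.1 v.2
  have h1 : ∑ w : σ, g w * pairing m w.1 = 0 := by
    have := congrArg (fun x : Fin n → ℚ => ∑ i, m i * x i) hg
    simp only [Finset.sum_apply, Pi.smul_apply, smul_eq_mul, Pi.zero_apply, mul_zero,
      Finset.sum_const_zero, Finset.mul_sum] at this
    rw [Finset.sum_comm] at this
    rw [← this]
    refine Finset.sum_congr rfl fun w _ => ?_
    rw [pairing, Finset.mul_sum]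
    refine Finset.sum_congr rfl fun i _ => ?_
    simp only [ratVec]
    ring
  rw [Finset.sum_eq_single v (fun w _ hw => by
    rw [hm' w.1 w.2 (fun h => hw (Subtype.ext h)), mul_zero]) (by simp)] at h1
  exact (mul_eq_zero.mp h1).resolve_right hm

theorem linearIndependent_liftCone {τ : Finset (Fin 3 → ℤ)} {ε : ℤ} (hε : ε ≠ 0)
    (hτ : LinearIndependent ℚ (fun v : τ => ratVec v.1)) :
    LinearIndependent ℚ (fun v : liftCone τ ε => ratVec v.1) := by
  classical
  have dual : ∀ c : τ → ℚ, ∃ m : Fin 3 → ℚ, ∀ v : τ, pairing m v.1 = c v := by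
    intro c
    obtain ⟨φ, hφ⟩ := LinearMap.exists_extend ((Module.Basis.span hτ).constr ℚ c)
    refine ⟨fun i => φ (Pi.single i 1), fun v => ?_⟩
    have h1 := (Module.Basis.span hτ).constr_basis ℚ c v
    rw [← hφ] at h1
    have h2 : φ (ratVec v.1) = c v := by simpa [Module.Basis.span_apply] using h1
    rw [← h2, LinearMap.pi_apply_eq_sum_univ φ (ratVec v.1)]
    refine Finset.sum_congr rfl fun i _ => ?_
    simp only [ratVec, smul_eq_mul]
    rw [mul_comm]
    congr 2
    ext j
    simp [Pi.single_apply, eq_comm]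
  have pair4 : ∀ (m : Fin 3 → ℚ) (a : ℚ) (v : Fin 3 → ℤ) (b : ℤ),
      pairing ![m 0, m 1, m 2, a] ![v 0, v 1, v 2, b] = pairing m v + a * b := by
    intro m a v b
    simp [pairing, Fin.sum_univ_four, Fin.sum_univ_three]
  have pair0 : ∀ (m : Fin 3 → ℚ) (a : ℚ) (b : ℤ),
      pairing ![m 0, m 1, m 2, a] ![0, 0, 0, b] = a * b := by
    intro m a b
    simp [pairing, Fin.sum_univ_four]
  apply linearIndependent_of_dual
  intro v hv
  rcases Finset.mem_insert.mp hv with rfl | hv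
  · obtain ⟨m, hm⟩ := dual fun _ => 1
    refine ⟨![m 0, m 1, m 2, 1], ?_, fun w hw hne => ?_⟩
    · rw [pair0]
      simpa using hε
    · rcases Finset.mem_insert.mp hw with rfl | hw
      · exact absurd rfl hne
      · obtain ⟨η, hη, rfl⟩ := Finset.mem_image.mp hw
        rw [pair4, hm ⟨η, hη⟩]
        norm_num
  · obtain ⟨η, hη, rfl⟩ := Finset.mem_image.mp hv
    obtain ⟨m, hm⟩ := dual fun w => if w.1 = η then 1 else 0
    refine ⟨![m 0, m 1, m 2, 0], ?_, fun w hw hne => ?_⟩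
    · rw [pair4, hm ⟨η, hη⟩]
      simp
    · rcases Finset.mem_insert.mp hw with rfl | hw
      · rw [pair0, zero_mul]
      · obtain ⟨η', hη', rfl⟩ := Finset.mem_image.mp hw
        have : η' ≠ η := fun h => hne (by rw [h])
        rw [pair4, hm ⟨η', hη'⟩]
        simp [this]

/-- The fan `Θ` of the projective bundle `ℙ(𝕃 ⊕ ℂ)` over the toric variety of `S`, with `𝕃` the total
space of the anticanonical bundle: the cones `τ₀` and `τ_∞`, for `τ` in `S`, and all their faces. -/
def bundleFan (S : ConeComplex 3) : ConeComplex 4 where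
  cones := {w | ∃ τ ∈ S.cones, ∃ ε : ℤ, (ε = 1 ∨ ε = -1) ∧ w ⊆ liftCone τ ε}
  down_closed := fun ⟨τ, hτ, ε, hε, h⟩ h' => ⟨τ, hτ, ε, hε, h'.trans h⟩
  linearIndependent := by
    rintro σ ⟨τ, hτ, ε, hε, h⟩
    have hε' : ε ≠ 0 := by rcases hε with rfl | rfl <;> decide
    exact (linearIndependent_liftCone hε' (S.linearIndependent hτ)).comp
      (fun v : σ => (⟨v.1, h v.2⟩ : liftCone τ ε))
      (fun a b hab => Subtype.ext (congrArg (fun x : liftCone τ ε => x.1) hab))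

/-- The sublattice `M̄₂ = M × 2ℤ` of `M̄ = M × ℤ`, where `M = ℤ³`. -/
def evenLattice : AddSubgroup (Fin 4 → ℤ) where
  carrier := {u | Even (u 3)}
  zero_mem' := ⟨0, rfl⟩
  add_mem' := fun ha hb => Even.add ha hb
  neg_mem' := fun ha => Even.neg ha

/-! ### Canonical divisors and Calabi–Yau hypersurfaces -/

open scoped KaehlerDifferential

/-- For a subring `O` of a field `K ⊇ ℂ`, the `O`-module generated by the forms
`dg₁ ∧ ⋯ ∧ dgₙ` with `gⱼ ∈ O`, inside the space of `n`-forms of `K` over `ℂ`. -/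
def formLattice (K : Type) [Field K] [Algebra ℂ K] (n : ℕ) (O : Subring K) :
    Submodule O (⋀[K]^n Ω[K⁄ℂ]) :=
  Submodule.span O {w | ∃ g : Fin n → K, (∀ j, g j ∈ O) ∧
    w = exteriorPower.ιMulti K n fun j => KaehlerDifferential.D ℂ K (g j)}

section

variable {X Y : Scheme.{0}}

/-- The inclusion of the constants into the function field. -/
def constants [IsIntegral X] (f : X ⟶ Spec (.of ℂ)) : ℂ →+* X.functionField :=
  (X.presheaf.germ ⊤ (genericPoint X) trivial).hom.comp (f.appTop.hom.comp (Scheme.ΓSpecIso (.of ℂ)).inv.hom)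

/-- The local ring at `x`, as a subring of the function field. -/
def localRing [IsIntegral X] (x : X) : Subring X.functionField :=
  (algebraMap (X.presheaf.stalk x) X.functionField).range

/-- The stalk at `x` of the ideal sheaf of a closed subscheme `i : Y ⟶ X`. -/
def idealStalk (i : Y ⟶ X) (x : X) : Ideal (X.presheaf.stalk x) :=
  Ideal.span {a | ∃ (U : X.Opens) (hx : x ∈ U) (t : Γ(X, U)),
    i.app U t = 0 ∧ a = X.presheaf.germ U x hx t}

/-- The canonical divisor of the `n`-dimensional normal variety `X` is trivial (`ω_X ≅ 𝒪_X`): there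
is a rational `n`-form without zeros or poles in codimension one. -/
def HasTrivialCanonical [IsIntegral X] (n : ℕ) (f : X ⟶ Spec (.of ℂ)) : Prop :=
  letI : Algebra ℂ X.functionField := (constants f).toAlgebra
  ∃ ω : ⋀[X.functionField]^n Ω[X.functionField⁄ℂ], ω ≠ 0 ∧ ∀ x : X, Order.coheight x = 1 →
    formLattice X.functionField n (localRing x) = Submodule.span (localRing x) {ω}

/-- The closed subscheme `i : Y ⟶ X` of the `n`-dimensional normal variety `X` is an anticanonical
divisor: there is a rational `n`-form with divisor `-Y`. -/
def IsAnticanonical [IsIntegral X] (n : ℕ) (f : X ⟶ Spec (.of ℂ)) (i : Y ⟶ X) : Prop :=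
  letI : Algebra ℂ X.functionField := (constants f).toAlgebra
  ∃ ω : ⋀[X.functionField]^n Ω[X.functionField⁄ℂ], ω ≠ 0 ∧ ∀ x : X, Order.coheight x = 1 →
    formLattice X.functionField n (localRing x) =
      Submodule.span (localRing x)
        {w | ∃ a ∈ idealStalk i x, w = algebraMap _ X.functionField a • ω}

/-- `i : Y ⟶ X` embeds `Y` as a Calabi–Yau hypersurface in the variety `X` of dimension `n + 1`:
`i` is a closed immersion, `Y` is locally defined by one non-zero equation in `X` and is an
anticanonical divisor of `X`, and `Y` is a normal variety with trivial canonical sheaf. -/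
def IsCalabiYauHypersurface (n : ℕ) (f : X ⟶ Spec (.of ℂ)) (i : Y ⟶ X) : Prop :=
  IsClosedImmersion i ∧ ∃ (_ : IsIntegral X) (_ : IsIntegral Y),
    (∀ x : X, ∃ g : X.presheaf.stalk x, g ≠ 0 ∧ idealStalk i x = Ideal.span {g}) ∧
    IsAnticanonical (n + 1) f i ∧
    (∀ y : Y, IsIntegrallyClosed (Y.presheaf.stalk y)) ∧
    HasTrivialCanonical n (i ≫ f)

end

end ToricDoubleCover

end

open CategoryTheory CategoryTheory.Limits AlgebraicGeometry

noncomputable section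

namespace ToricDoubleCover

/-! ### Quadratic extensions of factorial domains by a square-free element -/

section QuadraticExtension

variable {P : Type} [CommRing P] [IsDomain P] [UniqueFactorizationMonoid P] {h : P}

/-! Over the torus `s₀` is the constant 1, so the cover is `y² = s`. With respect to `M × 2ℤ` the
torus of the bundle has a character `t` with exponent `½` in the last coordinate, so that `t²` is
the usual fibre coordinate. The hypersurface is `t² = s`, and the embedding is `t ↦ y`.

It suffices to work on the charts of three-dimensional cones: every cone lies in one
(`exists_maximal_cone`), and its generators form a lattice basis (`exists_basis`). Let `x₁, x₂, x₃`
be the dual coordinates, `π = x₁x₂x₃`, and `g = πs`, which is a polynomial. The chart of the cover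
is `ℂ[x₁,x₂,x₃][w]` with `w = πy`, `w² = πg`. A chart of the bundle is `ℂ[x₁,…,x₄][w]` with `w² =
x₁x₂x₃x₄`, where `x₄ = πt²`, `w = πt` near zero and `x₄ = π⁻¹t⁻²`, `w = t⁻¹` near infinity. All of
them are instances of `DoubleChart`: double covers of affine space branched along a squarefree
polynomial. For the cover, squarefreeness of `πg` comes from normal crossings (`IsSNC.squarefree`).

Embedding. Near zero, `t ↦ y` sends `x₄` to `g` and `w` to `w`; it is surjective with kernel
generated by `x₄ - g = π(t² - s)` (`chartHom_surjective`, `ker_chartHom`). Near infinity the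
equation is `1 - st⁻² = 1 - gx₄`, which has no zeros on `x₄ = 0`. So the bundle is covered by the
charts near zero and by open sets that miss the cover (`exists_chart_eq`), and the image is closed
and locally principal.

Normality. An integral fraction over `P[√h]`, with `P` factorial and `h` squarefree, is treated
through its trace and the square of its trace-free part (`isIntegrallyClosed_quadraticAlgebra`).

Canonical classes. On a double chart the top forms are generated in codimension one by `dx₁ ∧ ⋯ ∧
dxₙ / w` (`DoubleChart.formLattice_eq`). Logarithmic forms `dlog x₁ ∧ ⋯ ∧ dlog xₙ` of different
charts agree up to units (`span_dlogForm_eq`), so a single logarithmic form serves all charts. On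
the cover `π / w = y⁻¹`, so `y⁻¹` times the logarithmic form is a global generator. On the bundle
`x₁x₂x₃x₄ / w = w`, and `w` is the local equation of the hypersurface times `t / (t² - s)`; hence `t
/ (t² - s)` times the logarithmic form has divisor minus the hypersurface. -/

theorem eq_zero_of_mul_self_eq_mul (hs : Squarefree h) (hu : ¬ IsUnit h) {a b : P}
    (e : a * a = h * (b * b)) : a = 0 ∧ b = 0 := by
  have hb : b = 0 := by
    by_contra hb
    have hd : b ^ 2 ∣ a ^ 2 := ⟨h, by rw [sq, sq, e]; ring⟩
    -- In a factorial domain `b² ∣ a²` gives `b ∣ a`, so `h` would be a square; being squarefree it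
    -- would then be a unit.
    obtain ⟨c, rfl⟩ := (UniqueFactorizationMonoid.pow_dvd_pow_iff_dvd two_ne_zero).mp hd
    have hc : c * c = h := by
      apply mul_left_cancel₀ (mul_ne_zero hb hb)
      linear_combination e
    have := hs c (Dvd.intro _ (by rw [hc, mul_one]))
    exact hu (hc ▸ this.mul this)
  refine ⟨?_, hb⟩
  rw [hb, mul_zero, mul_zero] at e
  exact mul_self_eq_zero.mp e

/-- This is the absence of zero divisors in `P[√h]`, in coordinates: multiplication by the conjugate
of `a + b√h` leaves the norm `a² - hb²`, which vanishes only if `a = b = 0`. -/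
theorem eq_zero_or_eq_zero_of_quadratic (hs : Squarefree h) (hu : ¬ IsUnit h) {a b a' b' : P}
    (h1 : a * a' + h * b * b' = 0) (h2 : a * b' + b * a' = 0) :
    (a = 0 ∧ b = 0) ∨ (a' = 0 ∧ b' = 0) := by
  by_cases hN : a * a = h * (b * b)
  · exact Or.inl (eq_zero_of_mul_self_eq_mul hs hu hN)
  · right
    have hN' : a * a - h * (b * b) ≠ 0 := sub_ne_zero.mpr hN
    refine ⟨(mul_eq_zero.mp (?_ : (a * a - h * (b * b)) * a' = 0)).resolve_left hN',
      (mul_eq_zero.mp (?_ : (a * a - h * (b * b)) * b' = 0)).resolve_left hN'⟩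
    · linear_combination a * h1 - h * b * h2
    · linear_combination a * h2 - b * h1

/-- Once the common factor of `b` and `c` is removed, the square of what remains of `c` is prime to
`b'²`, so it divides `h` and its root is a unit. -/
theorem dvd_of_mul_self_dvd_mul (hs : Squarefree h) {b c : P} (hc : c ≠ 0)
    (e : c * c ∣ h * (b * b)) : c ∣ b := by
  obtain ⟨c', b', d, hrel, rfl, rfl⟩ := UniqueFactorizationMonoid.exists_reduced_factors c hc b
  have hd : d ≠ 0 := left_ne_zero_of_mul hc
  have e' : c' * c' ∣ h * (b' * b') := by
    obtain ⟨k, hk⟩ := e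
    refine ⟨k, mul_left_cancel₀ (mul_ne_zero hd hd) ?_⟩
    linear_combination hk
  have hr : IsRelPrime (c' * c') (b' * b') :=
    (hrel.mul_right hrel).mul_left (hrel.mul_right hrel)
  have hc' : IsUnit c' := hs c' (hr.dvd_of_dvd_mul_right e')
  exact mul_dvd_mul_left d hc'.dvd

/-- A factorial domain is integrally closed, so an integral fraction `a / c` lies in `P`. The field
`F` may exceed the fraction field of `P`; it will be the fraction field of a quadratic extension. -/
theorem dvd_of_isIntegral_mul_eq {F : Type} [Field F] [Algebra P F]
    (hinj : Function.Injective (algebraMap P F)) {a c : P} (hc : c ≠ 0) {z : F}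
    (hz : IsIntegral P z) (e : z * algebraMap P F c = algebraMap P F a) : c ∣ a := by
  have : FaithfulSMul P F := (faithfulSMul_iff_algebraMap_injective P F).mpr hinj
  let := FractionRing.liftAlgebra P F
  have hc' : algebraMap P F c ≠ 0 := fun h0 => hc (hinj (h0.trans (map_zero _).symm))
  have hc'' : algebraMap P (FractionRing P) c ≠ 0 := fun h0 =>
    hc ((IsFractionRing.injective P (FractionRing P)) (h0.trans (map_zero _).symm))
  let z' : FractionRing P := algebraMap P _ a / algebraMap P _ c
  have hzz : algebraMap (FractionRing P) F z' = z := by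
    rw [map_div₀, ← IsScalarTower.algebraMap_apply, ← IsScalarTower.algebraMap_apply,
      div_eq_iff hc', e]
  have hintegral : IsIntegral P z' := by
    rw [← hzz] at hz
    exact (isIntegral_algebraMap_iff (algebraMap (FractionRing P) F).injective).mp hz
  obtain ⟨y, hy⟩ := IsIntegrallyClosed.isIntegral_iff.mp hintegral
  refine ⟨y, IsFractionRing.injective P (FractionRing P) ?_⟩
  rw [map_mul, hy, mul_div_cancel₀ _ hc'']

end QuadraticExtension

/-- A subalgebra `A` of `R` which is free with basis `1, w` over a polynomial ring
`ℂ[x₁, …, xₙ]`, with `w² = h` for a square-free polynomial `h` of positive degree. -/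
structure DoubleChart {R : Type} [CommRing R] [Algebra ℂ R] (A : Subalgebra ℂ R) (n : ℕ) where
  x : Fin n → R
  w : R
  h : MvPolynomial (Fin n) ℂ
  mul_self : w * w = MvPolynomial.aeval x h
  inj : ∀ a b : MvPolynomial (Fin n) ℂ,
    MvPolynomial.aeval x a + MvPolynomial.aeval x b * w = 0 → a = 0 ∧ b = 0
  mem_iff : ∀ r, r ∈ A ↔
    ∃ a b : MvPolynomial (Fin n) ℂ, r = MvPolynomial.aeval x a + MvPolynomial.aeval x b * w
  squarefree : Squarefree h
  not_isUnit : ¬ IsUnit h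

/-! ### Elementary properties of double charts -/

namespace DoubleChart

variable {R : Type} [CommRing R] [Algebra ℂ R] {A : Subalgebra ℂ R} {n : ℕ} (E : DoubleChart A n)

theorem aeval_mem (a : MvPolynomial (Fin n) ℂ) : MvPolynomial.aeval E.x a ∈ A :=
  (E.mem_iff _).mpr ⟨a, 0, by simp⟩

theorem x_mem (j : Fin n) : E.x j ∈ A := by simpa using E.aeval_mem (MvPolynomial.X j)

theorem w_mem : E.w ∈ A := (E.mem_iff _).mpr ⟨0, 1, by simp⟩

theorem aeval_injective : Function.Injective (MvPolynomial.aeval E.x : _ →ₐ[ℂ] R) :=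
  (injective_iff_map_eq_zero _).mpr fun a ha => (E.inj a 0 (by simpa using ha)).1

/-- The coordinate functions, as a homomorphism of rings to the chart. -/
def poly : MvPolynomial (Fin n) ℂ →ₐ[ℂ] A :=
  (MvPolynomial.aeval E.x).codRestrict A E.aeval_mem

theorem coe_poly (a : MvPolynomial (Fin n) ℂ) : (E.poly a : R) = MvPolynomial.aeval E.x a := rfl

theorem poly_injective : Function.Injective E.poly := fun _ _ hab =>
  E.aeval_injective (congrArg Subtype.val hab)

/-- The square root of `h`, as an element of the chart. -/
def root : A := ⟨E.w, E.w_mem⟩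

theorem root_mul_root : E.root * E.root = E.poly E.h := Subtype.ext E.mul_self

theorem exists_eq (z : A) : ∃ a b, z = E.poly a + E.poly b * E.root := by
  obtain ⟨a, b, hab⟩ := (E.mem_iff _).mp z.2
  exact ⟨a, b, Subtype.ext hab⟩

theorem eq_zero {a b : MvPolynomial (Fin n) ℂ} (e : E.poly a + E.poly b * E.root = 0) :
    a = 0 ∧ b = 0 :=
  E.inj a b (congrArg Subtype.val e)

include E in
theorem isDomain : IsDomain A := by
  have : Nontrivial A := by
    refine ⟨1, 0, fun h10 => one_ne_zero (E.eq_zero (a := 1) (b := 0) ?_).1⟩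
    rw [map_one, map_zero, zero_mul, add_zero, h10]
  have : NoZeroDivisors A := by
    refine ⟨fun {z z'} hz => ?_⟩
    obtain ⟨a, b, rfl⟩ := E.exists_eq z
    obtain ⟨a', b', rfl⟩ := E.exists_eq z'
    obtain ⟨h1, h2⟩ := E.eq_zero (a := a * a' + E.h * b * b') (b := a * b' + b * a') (by
      simp only [map_add, map_mul, ← E.root_mul_root]
      linear_combination hz)
    rcases eq_zero_or_eq_zero_of_quadratic E.squarefree E.not_isUnit h1 h2 with ⟨rfl, rfl⟩ | ⟨rfl, rfl⟩
    · left; simp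
    · right; simp
  exact NoZeroDivisors.to_isDomain A

include E in
-- Every element of `R` falls into the domain `A` after multiplication by a power of the unit `u`.
-- This passes from the ring of one chart to the ring of functions over the torus.
theorem isDomain_of_loc (hloc : ∃ u ∈ A, (∃ v, u * v = 1) ∧ ∀ a, ∃ N : ℕ, a * u ^ N ∈ A) :
    IsDomain R := by
  have := E.isDomain
  obtain ⟨u, hu, ⟨v, huv⟩, hloc⟩ := hloc
  have hcancel : ∀ (a : R) (N : ℕ), a * u ^ N = 0 → a = 0 := by
    intro a N ha
    have : a * u ^ N * v ^ N = a := by rw [mul_assoc, ← mul_pow, huv, one_pow, mul_one]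
    rw [← this, ha, zero_mul]
  have : Nontrivial R := (Subtype.val_injective (p := (· ∈ A))).nontrivial
  have : NoZeroDivisors R := by
    refine ⟨fun {z z'} hz => ?_⟩
    obtain ⟨N, hN⟩ := hloc z
    obtain ⟨N', hN'⟩ := hloc z'
    have : (⟨_, hN⟩ * ⟨_, hN'⟩ : A) = 0 := Subtype.ext (by
      change z * u ^ N * (z' * u ^ N') = 0
      linear_combination u ^ N * u ^ N' * hz)
    rcases mul_eq_zero.mp this with h0 | h0
    · exact Or.inl (hcancel z N (congrArg Subtype.val h0))
    · exact Or.inr (hcancel z' N' (congrArg Subtype.val h0))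
  exact NoZeroDivisors.to_isDomain R

/-- The chart as a quadratic algebra over the polynomial ring. -/
def equiv : QuadraticAlgebra (MvPolynomial (Fin n) ℂ) E.h 0 ≃+* A :=
  letI : Algebra (MvPolynomial (Fin n) ℂ) A := E.poly.toRingHom.toAlgebra
  RingEquiv.ofBijective
    (QuadraticAlgebra.lift (R := MvPolynomial (Fin n) ℂ) (a := E.h) (b := 0) ⟨E.root, by
      rw [zero_smul, add_zero, Algebra.smul_def, mul_one]
      exact E.root_mul_root⟩).toRingHom (by
    have hl : ∀ z : QuadraticAlgebra (MvPolynomial (Fin n) ℂ) E.h 0,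
        (QuadraticAlgebra.lift (R := MvPolynomial (Fin n) ℂ) (a := E.h) (b := 0) ⟨E.root, by
          rw [zero_smul, add_zero, Algebra.smul_def, mul_one]
          exact E.root_mul_root⟩ z : A) = E.poly z.re + E.poly z.im * E.root := by
      intro z
      simp only [QuadraticAlgebra.lift_apply_apply, Algebra.smul_def, mul_one]
      rfl
    constructor
    · refine (injective_iff_map_eq_zero _).mpr fun z hz => ?_
      obtain ⟨h1, h2⟩ := E.eq_zero ((hl z).symm.trans hz)
      exact QuadraticAlgebra.ext h1 h2
    · intro z
      obtain ⟨a, b, rfl⟩ := E.exists_eq z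
      exact ⟨⟨a, b⟩, hl _⟩)

end DoubleChart

/-- An integral fraction is written as `(a + b√h) / c` with `c` in `P`. Its trace `2a / c` is
integral over `P`, which gives `c ∣ a`. The square `hb² / c²` of the remaining part is integral too,
and since `h` is squarefree this gives `c ∣ b`. -/
theorem isIntegrallyClosed_quadraticAlgebra {P : Type} [CommRing P] [IsDomain P]
    [UniqueFactorizationMonoid P] {h : P} (hs : Squarefree h) (h2 : IsUnit (2 : P))
    [IsDomain (QuadraticAlgebra P h 0)] : IsIntegrallyClosed (QuadraticAlgebra P h 0) := by
  have hPQ : Function.Injective (algebraMap P (QuadraticAlgebra P h 0)) := QuadraticAlgebra.algebraMap_injective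
  have hQF : Function.Injective (algebraMap (QuadraticAlgebra P h 0) (FractionRing (QuadraticAlgebra P h 0))) := IsFractionRing.injective (QuadraticAlgebra P h 0) (FractionRing (QuadraticAlgebra P h 0))
  have hPF : Function.Injective (algebraMap P (FractionRing (QuadraticAlgebra P h 0))) := by
    rw [IsScalarTower.algebraMap_eq P (QuadraticAlgebra P h 0) (FractionRing (QuadraticAlgebra P h 0))]
    exact hQF.comp hPQ
  have : FaithfulSMul P (QuadraticAlgebra P h 0) := (faithfulSMul_iff_algebraMap_injective P (QuadraticAlgebra P h 0)).mpr hPQ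
  let conj : QuadraticAlgebra P h 0 ≃+* QuadraticAlgebra P h 0 := starRingAut
  -- The conjugation `√h ↦ -√h` on the fraction field is `P`-linear, hence preserves integrality
  -- over `P`.
  let conjF : FractionRing (QuadraticAlgebra P h 0) ≃ₐ[P] FractionRing (QuadraticAlgebra P h 0) :=
    AlgEquiv.ofRingEquiv (f := IsFractionRing.ringEquivOfRingEquiv conj) (fun r => by
      rw [IsScalarTower.algebraMap_apply P (QuadraticAlgebra P h 0),
        IsFractionRing.ringEquivOfRingEquiv_algebraMap]
      congr 1
      refine QuadraticAlgebra.ext ?_ ?_ <;> simp [conj, starRingAut_apply])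
  have hconj : ∀ z : QuadraticAlgebra P h 0,
      conjF (algebraMap _ (FractionRing (QuadraticAlgebra P h 0)) z) =
        algebraMap _ (FractionRing (QuadraticAlgebra P h 0)) (star z) :=
    fun z => IsFractionRing.ringEquivOfRingEquiv_algebraMap conj z
  rw [isIntegrallyClosed_iff (FractionRing (QuadraticAlgebra P h 0))]
  intro z hz
  have hzP : IsIntegral P z := isIntegral_trans z hz
  obtain ⟨α, β, hβ, rfl⟩ := IsFractionRing.div_surjective (A := (QuadraticAlgebra P h 0)) z
  have hβ0 : β ≠ 0 := nonZeroDivisors.ne_zero hβ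
  -- Rationalization of the denominator: `z = γ / c` with `c` the norm of `β`.
  set c : P := QuadraticAlgebra.norm β with hcdef
  have hc : algebraMap P (QuadraticAlgebra P h 0) c = β * star β := QuadraticAlgebra.algebraMap_norm_eq_mul_star β
  have hc0 : c ≠ 0 := by
    intro h0
    rw [h0, map_zero] at hc
    rcases mul_eq_zero.mp hc.symm with h1 | h1
    · exact hβ0 h1
    · exact hβ0 (star_eq_zero.mp h1)
  set γ : (QuadraticAlgebra P h 0) := α * star β with hγ
  set z : (FractionRing (QuadraticAlgebra P h 0)) := algebraMap (QuadraticAlgebra P h 0) (FractionRing (QuadraticAlgebra P h 0)) α / algebraMap (QuadraticAlgebra P h 0) (FractionRing (QuadraticAlgebra P h 0)) β with hzdef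
  have hβF : algebraMap (QuadraticAlgebra P h 0) (FractionRing (QuadraticAlgebra P h 0)) β ≠ 0 := fun h0 => hβ0 (hQF (h0.trans (map_zero _).symm))
  have hzc : z * algebraMap P (FractionRing (QuadraticAlgebra P h 0)) c = algebraMap (QuadraticAlgebra P h 0) (FractionRing (QuadraticAlgebra P h 0)) γ := by
    rw [IsScalarTower.algebraMap_apply P (QuadraticAlgebra P h 0) (FractionRing (QuadraticAlgebra P h 0)), hc, map_mul, hγ, map_mul, hzdef]
    field_simp
  have hzc' : conjF z * algebraMap P (FractionRing (QuadraticAlgebra P h 0)) c = algebraMap (QuadraticAlgebra P h 0) (FractionRing (QuadraticAlgebra P h 0)) (star γ) := by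
    rw [← hconj, ← hzc, map_mul, AlgEquiv.commutes]
  have hzP' : IsIntegral P (conjF z) := hzP.map conjF
  have hγe : γ = algebraMap P (QuadraticAlgebra P h 0) γ.re + algebraMap P (QuadraticAlgebra P h 0) γ.im * QuadraticAlgebra.omega := by
    refine QuadraticAlgebra.ext ?_ ?_ <;> simp
  have hγs : γ + star γ = algebraMap P (QuadraticAlgebra P h 0) (2 * γ.re) := by
    refine QuadraticAlgebra.ext ?_ ?_
    · simp; ring
    · simp
  -- The trace `z + conjF z` equals `2 γ.re / c`; the factor 2 is harmless because it is a unit.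
  have hdvd : c ∣ γ.re := by
    have h1 := dvd_of_isIntegral_mul_eq hPF hc0 (hzP.add hzP') (a := 2 * γ.re) (by
      rw [add_mul, hzc, hzc', ← map_add, hγs, ← IsScalarTower.algebraMap_apply])
    exact (h2.dvd_mul_left).mp h1
  obtain ⟨a', ha'⟩ := hdvd
  have hz2 : (z - algebraMap P (FractionRing (QuadraticAlgebra P h 0)) a') * algebraMap P (FractionRing (QuadraticAlgebra P h 0)) c =
      algebraMap P (FractionRing (QuadraticAlgebra P h 0)) γ.im * algebraMap (QuadraticAlgebra P h 0) (FractionRing (QuadraticAlgebra P h 0)) QuadraticAlgebra.omega := by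
    rw [sub_mul, hzc, ← map_mul, mul_comm a', ← ha']
    have := congrArg (algebraMap _ (FractionRing (QuadraticAlgebra P h 0))) hγe
    simp only [map_add, map_mul, ← IsScalarTower.algebraMap_apply] at this
    linear_combination this
  have hω : algebraMap (QuadraticAlgebra P h 0) (FractionRing (QuadraticAlgebra P h 0)) QuadraticAlgebra.omega * algebraMap (QuadraticAlgebra P h 0) (FractionRing (QuadraticAlgebra P h 0)) QuadraticAlgebra.omega =
      algebraMap P (FractionRing (QuadraticAlgebra P h 0)) h := by
    rw [← map_mul, IsScalarTower.algebraMap_apply P (QuadraticAlgebra P h 0) (FractionRing (QuadraticAlgebra P h 0))]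
    congr 1
    refine QuadraticAlgebra.ext ?_ ?_ <;> simp
  have hint2 : IsIntegral P (z - algebraMap P (FractionRing (QuadraticAlgebra P h 0)) a') := hzP.sub isIntegral_algebraMap
  have hdvd2 : c * c ∣ h * (γ.im * γ.im) := by
    refine dvd_of_isIntegral_mul_eq hPF (mul_ne_zero hc0 hc0) (hint2.mul hint2) ?_
    simp only [map_mul, ← hω]
    linear_combination ((z - algebraMap P (FractionRing (QuadraticAlgebra P h 0)) a') * algebraMap P (FractionRing (QuadraticAlgebra P h 0)) c +
      algebraMap P (FractionRing (QuadraticAlgebra P h 0)) γ.im * algebraMap (QuadraticAlgebra P h 0) (FractionRing (QuadraticAlgebra P h 0)) QuadraticAlgebra.omega) * hz2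
  obtain ⟨b', hb'⟩ := dvd_of_mul_self_dvd_mul hs hc0 hdvd2
  refine ⟨⟨a', b'⟩, ?_⟩
  have hcF : algebraMap P (FractionRing (QuadraticAlgebra P h 0)) c ≠ 0 := fun h0 => hc0 (hPF (h0.trans (map_zero _).symm))
  apply mul_right_cancel₀ hcF
  rw [hzc, IsScalarTower.algebraMap_apply P (QuadraticAlgebra P h 0) (FractionRing (QuadraticAlgebra P h 0)), ← map_mul]
  congr 1
  refine QuadraticAlgebra.ext ?_ ?_
  · simp [ha', mul_comm]
  · simp [hb', mul_comm]

theorem DoubleChart.isIntegrallyClosed {R : Type} [CommRing R] [Algebra ℂ R] {A : Subalgebra ℂ R}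
    {n : ℕ} (E : DoubleChart A n) : IsIntegrallyClosed A := by
  have := E.isDomain
  have : IsDomain (QuadraticAlgebra (MvPolynomial (Fin n) ℂ) E.h 0) := E.equiv.toMulEquiv.isDomain _
  have := isIntegrallyClosed_quadraticAlgebra E.squarefree
    (by rw [← map_ofNat (algebraMap ℂ (MvPolynomial (Fin n) ℂ)) 2]
        exact (IsUnit.mk0 (2 : ℂ) two_ne_zero).map _)
  exact IsIntegrallyClosed.of_equiv E.equiv

/-! ### Top forms on double covers in codimension one -/

/-- A non-zero partial derivative has smaller total degree than `p`, so `p` divides all of them only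
if all vanish; in characteristic zero `p` is then a constant. -/
theorem exists_not_dvd_pderiv {n : ℕ} {p : MvPolynomial (Fin n) ℂ} (hp0 : p ≠ 0)
    (hp : ¬ IsUnit p) : ∃ i, ¬ p ∣ MvPolynomial.pderiv i p := by
  by_contra! hall
  have hzero : ∀ i, MvPolynomial.pderiv i p = 0 := by
    intro i
    by_contra hne
    obtain ⟨c, hc⟩ := hall i
    have hc0 : c ≠ 0 := by
      rintro rfl
      exact hne (by rw [hc, mul_zero])
    have hdeg : p.totalDegree ≤ (MvPolynomial.pderiv i p).totalDegree := by
      rw [hc, MvPolynomial.totalDegree_mul_of_isDomain hp0 hc0]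
      exact Nat.le_add_right _ _
    have hlt : ∀ m ∈ (MvPolynomial.pderiv i p).support, (m.sum fun _ e => e) + 1 ≤ p.totalDegree := by
      intro m hm
      rw [MvPolynomial.mem_support_iff, MvPolynomial.coeff_pderiv] at hm
      have h1 := MvPolynomial.le_totalDegree
        (MvPolynomial.mem_support_iff.mpr (left_ne_zero_of_mul hm))
      rwa [Finsupp.sum_add_index' (fun _ => rfl) (fun _ _ _ => rfl),
        Finsupp.sum_single_index rfl] at h1
    obtain ⟨m, hm⟩ := MvPolynomial.support_nonempty.mpr hne
    have h1 : (MvPolynomial.pderiv i p).totalDegree ≤ p.totalDegree - 1 :=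
      Finset.sup_le fun m hm => Nat.le_sub_one_of_lt (hlt m hm)
    have h2 := hlt m hm
    omega
  have hC : p = MvPolynomial.C (p.coeff 0) := by
    refine MvPolynomial.ext _ _ fun m => ?_
    rw [MvPolynomial.coeff_C]
    split_ifs with h0
    · rw [h0]
    · by_contra hm
      obtain ⟨i, hi⟩ : ∃ i, m i ≠ 0 := by
        by_contra! hall0
        exact h0 (Finsupp.ext fun i => (hall0 i).symm)
      have h1 := MvPolynomial.coeff_pderiv (i := i) p (m - Finsupp.single i 1)
      rw [hzero i, MvPolynomial.coeff_zero, tsub_add_cancel_of_le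
        (Finsupp.single_le_iff.mpr (Nat.one_le_iff_ne_zero.mpr hi))] at h1
      rcases mul_eq_zero.mp h1.symm with h2 | h2
      · exact hm h2
      · exact Nat.cast_add_one_ne_zero _ h2
  have hne : p.coeff 0 ≠ 0 := fun h0 => hp0 (by rw [hC, h0, map_zero])
  exact hp (hC ▸ (IsUnit.mk0 _ hne).map MvPolynomial.C)

/-! ### Derivatives of the branch equation at primes of height one -/

namespace DoubleChart

variable {R : Type} [CommRing R] [Algebra ℂ R] {A : Subalgebra ℂ R} {n : ℕ} (E : DoubleChart A n)

theorem equiv_apply (z : QuadraticAlgebra (MvPolynomial (Fin n) ℂ) E.h 0) :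
    E.equiv z = E.poly z.re + E.poly z.im * E.root := by
  simp only [equiv]
  let : Algebra (MvPolynomial (Fin n) ℂ) A := E.poly.toRingHom.toAlgebra
  change z.re • (1 : A) + z.im • E.root = _
  rw [Algebra.smul_def, Algebra.smul_def, mul_one]
  rfl

theorem equiv_symm_apply (a b : MvPolynomial (Fin n) ℂ) :
    E.equiv.symm (E.poly a + E.poly b * E.root) = ⟨a, b⟩ := by
  rw [RingEquiv.symm_apply_eq, equiv_apply]

/-- The chart is smooth at the generic points of its branch divisor. Such a prime `q` contains a
prime factor `p` of `h` and meets the polynomial ring in `(p)`. With `h = pk` and `p ∤ k`, the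
derivative `∂ᵢh` is congruent to `k ∂ᵢp` modulo `p`, and this is not divisible by `p` for a suitable
`i`. -/
theorem exists_pderiv_notMem (q : Ideal A) [hqp : q.IsPrime]
    (hq : ∀ q' : Ideal A, q'.IsPrime → q' ≤ q → q' ≠ ⊥ → q' = q) (hw : E.root ∈ q) :
    ∃ i, E.poly (MvPolynomial.pderiv i E.h) ∉ q := by
  have hh : E.poly E.h ∈ q := by
    rw [← E.root_mul_root]
    exact q.mul_mem_left _ hw
  have h0 : E.h ≠ 0 := E.squarefree.ne_zero
  obtain ⟨p, hpdvd, hpq, hpp⟩ : ∃ p, p ∣ E.h ∧ E.poly p ∈ q ∧ Prime p := by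
    obtain ⟨f, hf, ⟨u, hu⟩⟩ := UniqueFactorizationMonoid.exists_prime_factors E.h h0
    have hmem : f.prod ∈ q.comap E.poly := by
      have : E.h * ↑u⁻¹ ∈ q.comap E.poly := Ideal.mul_mem_right _ _ hh
      rwa [← hu, Units.mul_inv_cancel_right] at this
    obtain ⟨p, hp, hpm⟩ := (Ideal.IsPrime.multiset_prod_mem_iff_exists_mem
      (I := q.comap E.poly) inferInstance f).mp hmem
    exact ⟨p, (Multiset.dvd_prod hp).trans ⟨u, hu.symm⟩, hpm, hf p hp⟩
  obtain ⟨k, hk⟩ := hpdvd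
  have hprime : (Ideal.span {p}).IsPrime := (Ideal.span_singleton_prime hpp.ne_zero).mpr hpp
  -- Reduction modulo `p` and `w`; sending `w` to 0 is allowed because `p ∣ h`. The kernel is a
  -- non-zero prime inside `q`, hence equal to `q` by `hq`.
  let θ : A →+* MvPolynomial (Fin n) ℂ ⧸ Ideal.span {p} :=
    (QuadraticAlgebra.lift (R := MvPolynomial (Fin n) ℂ) (a := E.h) (b := 0) ⟨0, by
      rw [mul_zero, zero_smul, add_zero, Algebra.smul_def, mul_one, eq_comm]
      exact Ideal.Quotient.eq_zero_iff_mem.mpr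
        (Ideal.mem_span_singleton.mpr ⟨k, hk⟩)⟩).toRingHom.comp E.equiv.symm.toRingHom
  have hθ : ∀ a b, θ (E.poly a + E.poly b * E.root) = Ideal.Quotient.mk _ a := by
    intro a b
    change QuadraticAlgebra.lift _ (E.equiv.symm _) = _
    rw [equiv_symm_apply, QuadraticAlgebra.lift_apply_apply]
    simp only [Algebra.smul_def, mul_one, mul_zero, add_zero]
    rfl
  have hker : RingHom.ker θ = q := by
    refine hq _ (RingHom.ker_isPrime θ) (fun z hz => ?_) fun hbot => ?_
    · obtain ⟨a, b, rfl⟩ := E.exists_eq z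
      rw [RingHom.mem_ker, hθ, Ideal.Quotient.eq_zero_iff_mem, Ideal.mem_span_singleton] at hz
      obtain ⟨c, rfl⟩ := hz
      rw [map_mul]
      exact q.add_mem (q.mul_mem_right _ hpq) (q.mul_mem_left _ hw)
    · have h1 : E.poly p ∈ RingHom.ker θ := by
        rw [RingHom.mem_ker, show E.poly p = E.poly p + E.poly 0 * E.root by simp, hθ,
          Ideal.Quotient.eq_zero_iff_mem]
        exact Ideal.mem_span_singleton_self p
      rw [hbot, Ideal.mem_bot] at h1
      exact hpp.ne_zero (E.poly_injective (h1.trans (map_zero _).symm))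
  have hmem : ∀ a, E.poly a ∈ q → p ∣ a := by
    intro a ha
    rw [← hker, RingHom.mem_ker, show E.poly a = E.poly a + E.poly 0 * E.root by simp, hθ,
      Ideal.Quotient.eq_zero_iff_mem] at ha
    exact Ideal.mem_span_singleton.mp ha
  obtain ⟨i, hi⟩ := exists_not_dvd_pderiv hpp.ne_zero hpp.not_isUnit
  refine ⟨i, fun hmemi => ?_⟩
  have h1 := hmem _ hmemi
  rw [hk, Derivation.leibniz, smul_eq_mul, smul_eq_mul] at h1
  have h2 : p ∣ k * MvPolynomial.pderiv i p := (dvd_add_right (dvd_mul_right _ _)).mp h1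
  rcases hpp.dvd_or_dvd h2 with ⟨l, hl⟩ | h3
  · exact hpp.not_isUnit (E.squarefree p ⟨l, by rw [hk, hl, mul_assoc]⟩)
  · exact hi h3

end DoubleChart

/-- If the `v j` are `O`-combinations of the `e i`, the wedge is an alternating `O`-multilinear
function of the coefficient vectors, hence the determinant of the coefficients, an element of `O`,
times the wedge of the `e i`. -/
theorem ιMulti_mem_span {K M : Type} [Field K] [AddCommGroup M] [Module K M] (O : Subring K) {n : ℕ}
    (e v : Fin n → M) (hv : ∀ j, v j ∈ Submodule.span O (Set.range e)) :
    exteriorPower.ιMulti K n v ∈ Submodule.span O {exteriorPower.ιMulti K n e} := by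
  let f : (Fin n → O) →ₗ[O] M := Fintype.linearCombination O e
  let F : (Fin n → O) [⋀^Fin n]→ₗ[O] ⋀[K]^n M :=
    { ((exteriorPower.ιMulti K n (M := M)).toMultilinearMap.restrictScalars O).compLinearMap
        (fun _ => f) with
      map_eq_zero_of_eq' := fun c i j hij hne =>
        (exteriorPower.ιMulti K n).map_eq_zero_of_eq _ (congrArg f hij) hne }
  have hF : F = (LinearMap.toSpanSingleton O _ (exteriorPower.ιMulti K n e)).compAlternatingMap
      (Pi.basisFun O (Fin n)).det := by
    refine Module.Basis.ext_alternating (Pi.basisFun O (Fin n)) fun g hg => ?_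
    have hg' : Function.Bijective g := Finite.injective_iff_bijective.mp hg
    let π : Equiv.Perm (Fin n) := Equiv.ofBijective g hg'
    have h1 : (fun i => (Pi.basisFun O (Fin n)) (g i)) = (Pi.basisFun O (Fin n)) ∘ π := rfl
    rw [h1, AlternatingMap.map_perm, AlternatingMap.map_perm]
    congr 1
    simp only [LinearMap.compAlternatingMap_apply, Module.Basis.det_self,
      LinearMap.toSpanSingleton_apply, one_smul]
    change exteriorPower.ιMulti K n (fun j => f (Pi.basisFun O (Fin n) j)) = _
    congr 1
    ext j
    simp [f, Pi.basisFun_apply, Fintype.linearCombination_apply_single]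
  have hc : ∀ j, ∃ c : Fin n → O, f c = v j := fun j => by
    have := hv j
    rw [← Fintype.range_linearCombination] at this
    exact this
  choose c hc using hc
  have : exteriorPower.ιMulti K n v = F c := by
    change _ = exteriorPower.ιMulti K n (fun j => f (c j))
    simp_rw [hc]
  rw [this, hF]
  exact Submodule.smul_mem _ _ (Submodule.mem_span_singleton_self _)

/-! ### Differentials and lattices of top forms -/

open scoped KaehlerDifferential

theorem D_aeval {K : Type} [Field K] [Algebra ℂ K] {n : ℕ} (x : Fin n → K)
    (p : MvPolynomial (Fin n) ℂ) :
    KaehlerDifferential.D ℂ K (MvPolynomial.aeval x p) =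
      ∑ j, MvPolynomial.aeval x (MvPolynomial.pderiv j p) • KaehlerDifferential.D ℂ K (x j) := by
  induction p using MvPolynomial.induction_on with
  | C a => simp
  | add p q hp hq =>
    simp only [map_add, hp, hq, add_smul, Finset.sum_add_distrib]
  | mul_X p i hp =>
    simp only [map_mul, MvPolynomial.aeval_X, Derivation.leibniz, hp, map_add, add_smul,
      Finset.sum_add_distrib, Finset.smul_sum, smul_eq_mul, mul_smul]
    congr 1
    rw [eq_comm, Finset.sum_eq_single i]
    · simp
    · intro j _ hj
      rw [MvPolynomial.pderiv_X_of_ne hj.symm]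
      simp
    · simp

/-- The quotient rule `dk = c⁻¹(da - k dc)`: it suffices to control the differentials of numerators
and denominators. -/
theorem D_mem_of_fraction {K : Type} [Field K] [Algebra ℂ K] {O : Subring K}
    (N : Submodule O Ω[K⁄ℂ]) {k a c : K} (hk : k ∈ O) (hc : c⁻¹ ∈ O) (hc0 : c ≠ 0)
    (e : k * c = a) (ha : KaehlerDifferential.D ℂ K a ∈ N) (hcN : KaehlerDifferential.D ℂ K c ∈ N) :
    KaehlerDifferential.D ℂ K k ∈ N := by
  have h1 : KaehlerDifferential.D ℂ K k =
      c⁻¹ • (KaehlerDifferential.D ℂ K a - k • KaehlerDifferential.D ℂ K c) := by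
    rw [← e, Derivation.leibniz, add_sub_cancel_left, smul_smul, inv_mul_cancel₀ hc0, one_smul]
  rw [h1]
  exact N.smul_mem (⟨c⁻¹, hc⟩ : O) (N.sub_mem ha (N.smul_mem (⟨k, hk⟩ : O) hcN))

theorem span_singleton_smul_eq {K M : Type} [Field K] [AddCommGroup M] [Module K M] (O : Subring K)
    {c : K} (hc : c ∈ O) (hc' : c⁻¹ ∈ O) (hc0 : c ≠ 0) (m : M) :
    Submodule.span O {c • m} = Submodule.span O {m} := by
  apply le_antisymm <;> rw [Submodule.span_singleton_le_iff_mem]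
  · exact Submodule.smul_mem _ (⟨c, hc⟩ : O) (Submodule.mem_span_singleton_self m)
  · have : m = (⟨c⁻¹, hc'⟩ : O) • (c • m) := by
      change m = c⁻¹ • c • m
      rw [smul_smul, inv_mul_cancel₀ hc0, one_smul]
    rw [this]
    exact Submodule.smul_mem _ _ (by rw [← this]; exact Submodule.mem_span_singleton_self _)

/-- If the differentials of the elements of `O` are combinations of those of `g₁, …, gₙ ∈ O`, then
the lattice of forms is generated by `dg₁ ∧ ⋯ ∧ dgₙ`. -/
theorem formLattice_eq_span_of_generators {K : Type} [Field K] [Algebra ℂ K] {n : ℕ} (O : Subring K)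
    (g : Fin n → K) (hg : ∀ j, g j ∈ O)
    (hD : ∀ k ∈ O, KaehlerDifferential.D ℂ K k ∈
      Submodule.span O (Set.range fun j => KaehlerDifferential.D ℂ K (g j))) :
    formLattice K n O =
      Submodule.span O {exteriorPower.ιMulti K n fun j => KaehlerDifferential.D ℂ K (g j)} := by
  apply le_antisymm
  · refine Submodule.span_le.mpr ?_
    rintro _ ⟨v, hv, rfl⟩
    exact ιMulti_mem_span O _ _ fun j => hD _ (hv j)
  · rw [Submodule.span_singleton_le_iff_mem]
    exact Submodule.subset_span ⟨g, hg, rfl⟩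

/-! ### The generator of the top forms of a double chart in codimension one -/

namespace DoubleChart

variable {R : Type} [CommRing R] [Algebra ℂ R] {A : Subalgebra ℂ R} {n : ℕ} (E : DoubleChart A n)
  {K : Type} [Field K] [Algebra R K]

theorem algebraMap_w_ne_zero (hinj : Function.Injective (algebraMap R K)) :
    algebraMap R K E.w ≠ 0 := by
  intro h0
  have hw : E.w = 0 := hinj (h0.trans (map_zero _).symm)
  have := E.mul_self
  rw [hw, zero_mul] at this
  exact E.squarefree.ne_zero (E.aeval_injective (this.symm.trans (map_zero _).symm))

variable [Algebra ℂ K] [IsScalarTower ℂ R K]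

theorem algebraMap_aeval (p : MvPolynomial (Fin n) ℂ) :
    algebraMap R K (MvPolynomial.aeval E.x p) =
      MvPolynomial.aeval (fun j => algebraMap R K (E.x j)) p :=
  (MvPolynomial.aeval_algebraMap_apply K E.x p).symm

/-- Differentiation of `w² = h`. -/
theorem smul_D_w :
    (2 * algebraMap R K E.w) • KaehlerDifferential.D ℂ K (algebraMap R K E.w) =
      ∑ j, algebraMap R K (MvPolynomial.aeval E.x (MvPolynomial.pderiv j E.h)) •
        KaehlerDifferential.D ℂ K (algebraMap R K (E.x j)) := by
  have h1 := D_aeval (fun j => algebraMap R K (E.x j)) E.h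
  rw [← E.algebraMap_aeval, ← E.mul_self, map_mul, Derivation.leibniz, ← add_smul, ← two_mul] at h1
  rw [h1]
  simp_rw [E.algebraMap_aeval]

/-- Off the branch divisor `w` is a unit and the `xⱼ` are local coordinates. On it some `∂ᵢh` is a
unit by `exists_pderiv_notMem`, and `2w dw = ∑ ∂ⱼh dxⱼ` lets `w` replace `xᵢ` as a coordinate; the
new coordinate form is a unit times `dx₁ ∧ ⋯ ∧ dxₙ / w`. So one formula holds in both cases. -/
theorem formLattice_eq (hinj : Function.Injective (algebraMap R K)) (q : Ideal A) [q.IsPrime]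
    (hq : ∀ q' : Ideal A, q'.IsPrime → q' ≤ q → q' ≠ ⊥ → q' = q) (O : Subring K)
    (hO : ∀ k, k ∈ O ↔ ∃ a c : A, c ∉ q ∧ k * algebraMap R K c = algebraMap R K a) :
    formLattice K n O = Submodule.span O {(algebraMap R K E.w)⁻¹ •
      exteriorPower.ιMulti K n fun j => KaehlerDifferential.D ℂ K (algebraMap R K (E.x j))} := by
  have h1q : (1 : A) ∉ q := fun h => Ideal.IsPrime.ne_top ‹_› ((Ideal.eq_top_iff_one _).mpr h)
  have hAO : ∀ a ∈ A, algebraMap R K a ∈ O := fun a ha => (hO _).mpr ⟨⟨a, ha⟩, 1, h1q, by simp⟩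
  have hne : ∀ c : A, c ∉ q → algebraMap R K c ≠ 0 := by
    intro c hc h0
    have : c = 0 := Subtype.ext (hinj (h0.trans (map_zero _).symm))
    exact hc (this ▸ q.zero_mem)
  have hinv : ∀ c : A, c ∉ q → (algebraMap R K c)⁻¹ ∈ O := fun c hc =>
    (hO _).mpr ⟨1, c, hc, by rw [inv_mul_cancel₀ (hne c hc)]; simp⟩
  have hw0 := E.algebraMap_w_ne_zero hinj
  have h20 : (2 : K) ≠ 0 := by
    rw [← map_ofNat (algebraMap ℂ K) 2]
    exact (map_ne_zero _).mpr two_ne_zero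
  have h2inv : (2 : K)⁻¹ ∈ O := by
    have : algebraMap R K (algebraMap ℂ R 2⁻¹) ∈ O := hAO _ (A.algebraMap_mem _)
    rwa [← IsScalarTower.algebraMap_apply, map_inv₀, map_ofNat] at this
  set e : Fin n → Ω[K⁄ℂ] := fun j => KaehlerDifferential.D ℂ K (algebraMap R K (E.x j)) with he
  -- Elements of `O` are fractions of elements `a + bw`, so the differentials of the `xⱼ` and of `w`
  -- generate all the others over `O`.
  have hclosure : ∀ N : Submodule O Ω[K⁄ℂ], (∀ j, e j ∈ N) →
      KaehlerDifferential.D ℂ K (algebraMap R K E.w) ∈ N →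
      ∀ k ∈ O, KaehlerDifferential.D ℂ K k ∈ N := by
    intro N hxN hwN
    have hp : ∀ p : MvPolynomial (Fin n) ℂ,
        KaehlerDifferential.D ℂ K (algebraMap R K (MvPolynomial.aeval E.x p)) ∈ N := by
      intro p
      rw [E.algebraMap_aeval, D_aeval]
      refine N.sum_mem fun j _ => ?_
      rw [← E.algebraMap_aeval]
      exact N.smul_mem (⟨_, hAO _ (E.aeval_mem _)⟩ : O) (hxN j)
    have hA : ∀ a ∈ A, KaehlerDifferential.D ℂ K (algebraMap R K a) ∈ N := by
      intro a ha
      obtain ⟨a, b, rfl⟩ := (E.mem_iff a).mp ha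
      rw [map_add, map_add, map_mul, Derivation.leibniz]
      exact N.add_mem (hp a) (N.add_mem (N.smul_mem (⟨_, hAO _ (E.aeval_mem b)⟩ : O) hwN)
        (N.smul_mem (⟨_, hAO _ E.w_mem⟩ : O) (hp b)))
    intro k hk
    obtain ⟨a, c, hc, hkc⟩ := (hO k).mp hk
    exact D_mem_of_fraction N hk (hinv c hc) (hne c hc) hkc (hA a a.2) (hA c c.2)
  by_cases hw : E.root ∈ q
  · obtain ⟨i, hi⟩ := E.exists_pderiv_notMem q hq hw
    set c : Fin n → K :=
      fun j => algebraMap R K (MvPolynomial.aeval E.x (MvPolynomial.pderiv j E.h)) with hc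
    have hcO : ∀ j, c j ∈ O := fun j => hAO _ (E.aeval_mem _)
    have hci0 : c i ≠ 0 := hne _ hi
    have hciO : (c i)⁻¹ ∈ O := hinv _ hi
    have hDw : (2 * algebraMap R K E.w) • KaehlerDifferential.D ℂ K (algebraMap R K E.w) =
      ∑ j, c j • e j := E.smul_D_w
    -- The coordinates near the branch divisor: `w` takes the place of `xᵢ`.
    let g : Fin n → K := Function.update (fun j => algebraMap R K (E.x j)) i (algebraMap R K E.w)
    have hgi : g i = algebraMap R K E.w := Function.update_self ..
    have hgj : ∀ j, j ≠ i → g j = algebraMap R K (E.x j) := fun j hj =>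
      Function.update_of_ne hj ..
    have hgO : ∀ j, g j ∈ O := by
      intro j
      by_cases hj : j = i
      · rw [hj, hgi]; exact hAO _ E.w_mem
      · rw [hgj j hj]; exact hAO _ (E.x_mem j)
    let N := Submodule.span O (Set.range fun j => KaehlerDifferential.D ℂ K (g j))
    have hDg : ∀ j, KaehlerDifferential.D ℂ K (g j) ∈ N := fun j => Submodule.subset_span ⟨j, rfl⟩
    have hwN : KaehlerDifferential.D ℂ K (algebraMap R K E.w) ∈ N := hgi ▸ hDg i
    have hjN : ∀ j, j ≠ i → e j ∈ N := fun j hj => by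
      have := hDg j
      rwa [hgj j hj] at this
    have hxN : ∀ j, e j ∈ N := by
      intro j
      by_cases hj : j = i
      · subst hj
        have h3 : e j = (c j)⁻¹ • ((2 * algebraMap R K E.w) •
            KaehlerDifferential.D ℂ K (algebraMap R K E.w) -
              ∑ k ∈ Finset.univ.erase j, c k • e k) := by
          rw [hDw, ← Finset.add_sum_erase _ _ (Finset.mem_univ j), add_sub_cancel_right, smul_smul,
            inv_mul_cancel₀ hci0, one_smul]
        rw [h3]
        refine N.smul_mem (⟨_, hciO⟩ : O) (N.sub_mem ?_ (N.sum_mem fun k hk => ?_))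
        · refine N.smul_mem (⟨2 * algebraMap R K E.w, O.mul_mem ?_ (hAO _ E.w_mem)⟩ : O) hwN
          exact ofNat_mem O 2
        · exact N.smul_mem (⟨_, hcO k⟩ : O) (hjN k (Finset.ne_of_mem_erase hk))
      · exact hjN j hj
    rw [formLattice_eq_span_of_generators O g hgO (hclosure N hxN hwN)]
    have hDg' : (fun j => KaehlerDifferential.D ℂ K (g j)) =
        Function.update e i (KaehlerDifferential.D ℂ K (algebraMap R K E.w)) := by
      funext j
      by_cases hj : j = i
      · rw [hj, hgi, Function.update_self]
      · rw [hgj j hj, Function.update_of_ne hj]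
    have hDw' : KaehlerDifferential.D ℂ K (algebraMap R K E.w) =
        ∑ j, ((2 * algebraMap R K E.w)⁻¹ * c j) • e j := by
      simp_rw [mul_smul]
      rw [← Finset.smul_sum, ← hDw, smul_smul, inv_mul_cancel₀ (mul_ne_zero h20 hw0), one_smul]
    -- In the expansion of `dw` only the `dxᵢ` term survives the wedge, with coefficient `∂ᵢh /
    -- (2w)`.
    have hform : exteriorPower.ιMulti K n (fun j => KaehlerDifferential.D ℂ K (g j)) =
        (2⁻¹ * c i) • ((algebraMap R K E.w)⁻¹ • exteriorPower.ιMulti K n e) := by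
      rw [hDg', hDw', AlternatingMap.map_update_sum, Finset.sum_eq_single i]
      · rw [AlternatingMap.map_update_smul, Function.update_eq_self, smul_smul]
        congr 1
        rw [mul_inv]
        ring
      · intro j _ hj
        rw [AlternatingMap.map_update_smul, AlternatingMap.map_update_self _ _ hj.symm, smul_zero]
      · simp
    rw [hform]
    refine span_singleton_smul_eq O (O.mul_mem h2inv (hcO i)) ?_
      (mul_ne_zero (inv_ne_zero h20) hci0) _
    rw [mul_inv, inv_inv]
    exact O.mul_mem (ofNat_mem O 2) hciO
  · have hwO : (algebraMap R K E.w)⁻¹ ∈ O := hinv _ hw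
    let N := Submodule.span O (Set.range e)
    have hxN : ∀ j, e j ∈ N := fun j => Submodule.subset_span ⟨j, rfl⟩
    have hwN : KaehlerDifferential.D ℂ K (algebraMap R K E.w) ∈ N := by
      have h3 : KaehlerDifferential.D ℂ K (algebraMap R K E.w) = (2⁻¹ * (algebraMap R K E.w)⁻¹) •
          ((2 * algebraMap R K E.w) • KaehlerDifferential.D ℂ K (algebraMap R K E.w)) := by
        rw [smul_smul, ← mul_inv, inv_mul_cancel₀ (mul_ne_zero h20 hw0), one_smul]
      rw [h3, E.smul_D_w]
      exact N.smul_mem (⟨_, O.mul_mem h2inv hwO⟩ : O) (N.sum_mem fun j _ =>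
        N.smul_mem (⟨_, hAO _ (E.aeval_mem _)⟩ : O) (hxN j))
    rw [formLattice_eq_span_of_generators O (fun j => algebraMap R K (E.x j))
      (fun j => hAO _ (E.x_mem j)) (hclosure N hxN hwN)]
    refine (span_singleton_smul_eq O hwO ?_ (inv_ne_zero hw0) _).symm
    rw [inv_inv]
    exact hAO _ E.w_mem

end DoubleChart

namespace DoubleChart

variable {R : Type} [CommRing R] [Algebra ℂ R] {A : Subalgebra ℂ R} {n : ℕ} (E : DoubleChart A n)
  {K : Type} [Field K] [Algebra ℂ K] [Algebra R K] [IsScalarTower ℂ R K]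

/-- `K` is algebraic over `ℂ(x₁, …, xₙ)`, hence separable in characteristic zero, hence formally
étale over the polynomial ring. So the `dxⱼ` form a basis of `Ω[K⁄ℂ]`, and the determinant in this
basis takes the value 1 on their wedge. -/
theorem ιMulti_D_ne_zero (hinj : Function.Injective (algebraMap R K))
    (hfrac : ∀ k : K, ∃ a c : A, (c : R) ≠ 0 ∧ k * algebraMap R K c = algebraMap R K a) :
    (exteriorPower.ιMulti K n fun j => KaehlerDifferential.D ℂ K (algebraMap R K (E.x j))) ≠ 0 := by
  let x : Fin n → K := fun j => algebraMap R K (E.x j)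
  let : Algebra (MvPolynomial (Fin n) ℂ) K := (MvPolynomial.aeval x).toRingHom.toAlgebra
  have hmap : ∀ p : MvPolynomial (Fin n) ℂ,
      algebraMap (MvPolynomial (Fin n) ℂ) K p = MvPolynomial.aeval x p := fun _ => rfl
  have : IsScalarTower ℂ (MvPolynomial (Fin n) ℂ) K :=
    IsScalarTower.of_algebraMap_eq fun c => by rw [hmap, MvPolynomial.algebraMap_eq,
      MvPolynomial.aeval_C]
  have hPK : Function.Injective (algebraMap (MvPolynomial (Fin n) ℂ) K) := by
    intro p p' hpp
    rw [hmap, hmap, ← E.algebraMap_aeval, ← E.algebraMap_aeval] at hpp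
    exact E.aeval_injective (hinj hpp)
  have : FaithfulSMul (MvPolynomial (Fin n) ℂ) K :=
    (faithfulSMul_iff_algebraMap_injective _ K).mpr hPK
  let := FractionRing.liftAlgebra (MvPolynomial (Fin n) ℂ) K
  have hintegral : ∀ a : A, IsAlgebraic (FractionRing (MvPolynomial (Fin n) ℂ)) (algebraMap R K a) := by
    intro a
    have h1 : _root_.IsIntegral (MvPolynomial (Fin n) ℂ) (algebraMap R K a) := by
      obtain ⟨p, p', hp⟩ := (E.mem_iff _).mp a.2
      have hw : _root_.IsIntegral (MvPolynomial (Fin n) ℂ) (algebraMap R K E.w) := by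
        refine IsIntegral.of_pow (n := 2) two_pos ?_
        rw [sq, ← map_mul, E.mul_self, E.algebraMap_aeval]
        exact isIntegral_algebraMap
      rw [hp, map_add, map_mul, E.algebraMap_aeval, E.algebraMap_aeval]
      exact isIntegral_algebraMap.add (isIntegral_algebraMap.mul hw)
    exact h1.tower_top.isAlgebraic
  have : Algebra.IsAlgebraic (FractionRing (MvPolynomial (Fin n) ℂ)) K := by
    refine ⟨fun k => ?_⟩
    obtain ⟨a, c, hc, hk⟩ := hfrac k
    have hc' : algebraMap R K c ≠ 0 := fun h0 => hc (hinj (h0.trans (map_zero _).symm))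
    rw [eq_div_of_mul_eq hc' hk, div_eq_mul_inv]
    exact (hintegral a).mul (hintegral c).inv
  have : CharZero (FractionRing (MvPolynomial (Fin n) ℂ)) := inferInstance
  have : Algebra.FormallyEtale (MvPolynomial (Fin n) ℂ) (FractionRing (MvPolynomial (Fin n) ℂ)) :=
    Algebra.FormallyEtale.of_isLocalization (nonZeroDivisors (MvPolynomial (Fin n) ℂ))
  have : Algebra.FormallyEtale (FractionRing (MvPolynomial (Fin n) ℂ)) K :=
    Algebra.FormallyEtale.of_isSeparable _ _
  have : Algebra.FormallyEtale (MvPolynomial (Fin n) ℂ) K :=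
    Algebra.FormallyEtale.comp _ (FractionRing (MvPolynomial (Fin n) ℂ)) _
  let b : Module.Basis (Fin n) K Ω[K⁄ℂ] :=
    ((KaehlerDifferential.mvPolynomialBasis ℂ (Fin n)).baseChange K).map
      (KaehlerDifferential.tensorKaehlerEquivOfFormallyEtale ℂ (MvPolynomial (Fin n) ℂ) K)
  have hb : ∀ j, b j = KaehlerDifferential.D ℂ K (x j) := by
    intro j
    simp only [b, Module.Basis.map_apply, Module.Basis.baseChange_apply]
    rw [← LinearEquiv.eq_symm_apply, KaehlerDifferential.mvPolynomialBasis_apply,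
      show x j = algebraMap (MvPolynomial (Fin n) ℂ) K (MvPolynomial.X j) by
        rw [hmap, MvPolynomial.aeval_X],
      KaehlerDifferential.tensorKaehlerEquivOfFormallyEtale_symm_D_algebraMap]
  have hb' : (fun j => KaehlerDifferential.D ℂ K (algebraMap R K (E.x j))) = b :=
    funext fun j => (hb j).symm
  rw [hb']
  intro h0
  have := exteriorPower.alternatingMapLinearEquiv_apply_ιMulti b.det b
  rw [h0, map_zero, Module.Basis.det_self] at this
  exact zero_ne_one this

end DoubleChart

/-! ### Functions on affine charts -/

/-- The prime ideal of a point of an affine scheme. -/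
def pointIdeal {A : Type} [CommRing A] (p : Spec (.of A)) : Ideal A := PrimeSpectrum.asIdeal (R := A) p

instance {A : Type} [CommRing A] (p : Spec (.of A)) : (pointIdeal p).IsPrime :=
  PrimeSpectrum.isPrime (R := A) p

section ChartSection

variable {A B : Type} [CommRing A] [CommRing B] {X Y : Scheme.{0}}

theorem top_le_preimage_opensRange {U : Scheme.{0}} (j : U ⟶ X) [IsOpenImmersion j] :
    ⊤ ≤ j ⁻¹ᵁ j.opensRange :=
  fun u _ => ⟨u, rfl⟩

theorem mem_opensRange_self {U : Scheme.{0}} (j : U ⟶ X) [IsOpenImmersion j] (p : U) :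
    j p ∈ j.opensRange :=
  ⟨p, rfl⟩

instance isIso_appLE_opensRange {U : Scheme.{0}} (j : U ⟶ X) [IsOpenImmersion j] :
    IsIso (j.appLE j.opensRange ⊤ (top_le_preimage_opensRange j)) := by
  have h1 := Scheme.Hom.isIso_app j j.opensRange le_rfl
  have h2 : (⊤ : U.Opens) = j ⁻¹ᵁ j.opensRange :=
    le_antisymm (top_le_preimage_opensRange j) le_top
  rw [Scheme.Hom.appLE]
  have : IsIso (homOfLE (top_le_preimage_opensRange j)) := by
    rw [show homOfLE (top_le_preimage_opensRange j) = eqToHom h2 from Subsingleton.elim _ _]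
    infer_instance
  infer_instance

/-- The function on the image of an affine chart given by an element of the coordinate ring. -/
def chartSection (j : Spec (.of A) ⟶ X) [IsOpenImmersion j] : A →+* Γ(X, j.opensRange) :=
  ((Scheme.ΓSpecIso (.of A)).inv ≫
    inv (j.appLE j.opensRange ⊤ (top_le_preimage_opensRange j))).hom

theorem appLE_chartSection (j : Spec (.of A) ⟶ X) [IsOpenImmersion j] (a : A) :
    j.appLE j.opensRange ⊤ (top_le_preimage_opensRange j) (chartSection j a) =
      (Scheme.ΓSpecIso (.of A)).inv a := by
  rw [chartSection, ← ConcreteCategory.comp_apply]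
  exact congrArg (fun f : CommRingCat.of A ⟶ Γ(Spec (.of A), ⊤) => f a) (by simp)

theorem appLE_opensRange_injective {U : Scheme.{0}} (j : U ⟶ X) [IsOpenImmersion j] :
    Function.Injective (j.appLE j.opensRange ⊤ (top_le_preimage_opensRange j)) :=
  (ConcreteCategory.bijective_of_isIso
    (j.appLE j.opensRange ⊤ (top_le_preimage_opensRange j))).injective

theorem chart_le_preimage {φ : A →+* B} {j : Spec (.of A) ⟶ X} [IsOpenImmersion j]
    {j' : Spec (.of B) ⟶ Y} [IsOpenImmersion j'] {f : Y ⟶ X}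
    (e : j' ≫ f = Spec.map (CommRingCat.ofHom φ) ≫ j) : j'.opensRange ≤ f ⁻¹ᵁ j.opensRange := by
  rintro _ ⟨y, rfl⟩
  exact ⟨Spec.map (CommRingCat.ofHom φ) y, by
    rw [← Scheme.Hom.comp_apply, ← e, Scheme.Hom.comp_apply]⟩

/-- Restriction to `Spec B` is injective on functions over the image of `j'`; there the claim is the
naturality of global sections of spectra. -/
theorem appLE_chartSection_of_comp {φ : A →+* B} {j : Spec (.of A) ⟶ X} [IsOpenImmersion j]
    {j' : Spec (.of B) ⟶ Y} [IsOpenImmersion j'] {f : Y ⟶ X}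
    (e : j' ≫ f = Spec.map (CommRingCat.ofHom φ) ≫ j) (a : A) :
    f.appLE j.opensRange j'.opensRange (chart_le_preimage e) (chartSection j a) =
      chartSection j' (φ a) := by
  apply appLE_opensRange_injective j'
  rw [appLE_chartSection, ← ConcreteCategory.comp_apply, Scheme.Hom.appLE_comp_appLE]
  have h1 : ∀ (g : Spec (.of B) ⟶ X) (hg : g = Spec.map (CommRingCat.ofHom φ) ≫ j)
      (h : ⊤ ≤ g ⁻¹ᵁ j.opensRange), g.appLE j.opensRange ⊤ h =
      j.appLE j.opensRange ⊤ (top_le_preimage_opensRange j) ≫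
        (Spec.map (CommRingCat.ofHom φ)).appLE ⊤ ⊤ (Scheme.Hom.preimage_top _).ge := by
    rintro _ rfl h
    rw [Scheme.Hom.appLE_comp_appLE]
  rw [h1 _ e, ConcreteCategory.comp_apply, appLE_chartSection]
  have h2 := congrArg (fun f => f.hom a) (Scheme.ΓSpecIso_inv_naturality (CommRingCat.ofHom φ))
  refine Eq.trans ?_ h2.symm
  simp only [Scheme.Hom.appLE]
  rfl

/-- The germ at `x` of the function given by an element of the coordinate ring of a chart. -/
def chartGerm (j : Spec (.of A) ⟶ X) [IsOpenImmersion j] (x : X) (hx : x ∈ j.opensRange) :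
    A →+* X.presheaf.stalk x :=
  (X.presheaf.germ j.opensRange x hx).hom.comp (chartSection j)

theorem stalkMap_chartGerm_self (j : Spec (.of A) ⟶ X) [IsOpenImmersion j] (p : Spec (.of A))
    (a : A) :
    j.stalkMap p (chartGerm j (j p) (mem_opensRange_self j p) a) = StructureSheaf.toStalk A p a := by
  change j.stalkMap p (X.presheaf.germ j.opensRange (j p) _ (chartSection j a)) = _
  rw [Scheme.Hom.germ_stalkMap_apply]
  have h1 := appLE_chartSection j a
  rw [Scheme.Hom.appLE, ConcreteCategory.comp_apply] at h1
  have h2 := congrArg ((Spec (.of A)).presheaf.germ ⊤ p (TopologicalSpace.Opens.mem_top p)) h1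
  rw [TopCat.Presheaf.germ_res_apply] at h2
  exact h2

/-- The open immersion identifies the stalk at `j p` with the stalk of `Spec A` at `p`. All later
statements about stalks are reduced to coordinate rings through this. -/
theorem isLocalization_chartGerm (j : Spec (.of A) ⟶ X) [IsOpenImmersion j] (p : Spec (.of A)) :
    letI := (chartGerm j (j p) (mem_opensRange_self j p)).toAlgebra
    IsLocalization.AtPrime (X.presheaf.stalk (j p)) (pointIdeal p) := by
  let := (chartGerm j (j p) (mem_opensRange_self j p)).toAlgebra
  have h1 : ∀ q : PrimeSpectrum A, letI := (StructureSheaf.toStalk A q).hom.toAlgebra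
      IsLocalization.AtPrime ((Spec.structureSheaf A).presheaf.stalk q) q.asIdeal :=
    fun q => StructureSheaf.IsLocalization.to_stalk A q
  let : Algebra A ((Spec (.of A)).presheaf.stalk p) := (StructureSheaf.toStalk A p).hom.toAlgebra
  have h2 : IsLocalization.AtPrime ((Spec (.of A)).presheaf.stalk p) (pointIdeal p) := h1 p
  let e : ((Spec (.of A)).presheaf.stalk p) ≃ₐ[A] (X.presheaf.stalk (j p)) :=
    (AlgEquiv.ofRingEquiv (f := (asIso (j.stalkMap p)).commRingCatIsoToRingEquiv)
      (fun a => stalkMap_chartGerm_self j p a)).symm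
  exact IsLocalization.isLocalization_of_algEquiv (pointIdeal p).primeCompl e

theorem isUnit_chartGerm_iff (j : Spec (.of A) ⟶ X) [IsOpenImmersion j] (p : Spec (.of A))
    (a : A) : IsUnit (chartGerm j (j p) (mem_opensRange_self j p) a) ↔ a ∉ (pointIdeal p) := by
  let := (chartGerm j (j p) (mem_opensRange_self j p)).toAlgebra
  have := isLocalization_chartGerm j p
  exact IsLocalization.AtPrime.isUnit_to_map_iff (X.presheaf.stalk (j p)) (pointIdeal p) a

theorem exists_chartGerm_mul_eq (j : Spec (.of A) ⟶ X) [IsOpenImmersion j] (p : Spec (.of A))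
    (z : X.presheaf.stalk (j p)) : ∃ a c : A, c ∉ (pointIdeal p) ∧
      z * chartGerm j (j p) (mem_opensRange_self j p) c = chartGerm j (j p) (mem_opensRange_self j p) a := by
  let := (chartGerm j (j p) (mem_opensRange_self j p)).toAlgebra
  have := isLocalization_chartGerm j p
  obtain ⟨⟨a, c⟩, h⟩ := IsLocalization.surj (pointIdeal p).primeCompl z
  exact ⟨a, c, c.2, h⟩

theorem isIntegrallyClosed_stalk (j : Spec (.of A) ⟶ X) [IsOpenImmersion j] [IsDomain A]
    [IsIntegrallyClosed A] (p : Spec (.of A)) :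
    IsIntegrallyClosed (X.presheaf.stalk (j p)) := by
  let := (chartGerm j (j p) (mem_opensRange_self j p)).toAlgebra
  have := isLocalization_chartGerm j p
  exact isIntegrallyClosed_of_isLocalization (R := A) (X.presheaf.stalk (j p)) (pointIdeal p).primeCompl
    (pointIdeal p).primeCompl_le_nonZeroDivisors

theorem isDomain_stalk (j : Spec (.of A) ⟶ X) [IsOpenImmersion j] [IsDomain A]
    (p : Spec (.of A)) : IsDomain (X.presheaf.stalk (j p)) := by
  let := (chartGerm j (j p) (mem_opensRange_self j p)).toAlgebra
  have := isLocalization_chartGerm j p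
  exact IsLocalization.isDomain_of_le_nonZeroDivisors (R := A) _
    (pointIdeal p).primeCompl_le_nonZeroDivisors

theorem chartGerm_injective [IsIntegral X] (j : Spec (.of A) ⟶ X) [IsOpenImmersion j] (x : X)
    (hx : x ∈ j.opensRange) : Function.Injective (chartGerm j x hx) := by
  refine (germ_injective_of_isIntegral X x hx).comp ?_
  rw [chartSection]
  exact (ConcreteCategory.bijective_of_isIso ((Scheme.ΓSpecIso (.of A)).inv ≫
    inv (j.appLE j.opensRange ⊤ (top_le_preimage_opensRange j)))).injective

theorem chartGerm_congr {j : Spec (.of A) ⟶ X} [IsOpenImmersion j] {φ : A →+* B}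
    {j' : Spec (.of B) ⟶ X} [IsOpenImmersion j'] (e : j' = Spec.map (CommRingCat.ofHom φ) ≫ j)
    (x : X) (hx : x ∈ j'.opensRange) (hx' : x ∈ j.opensRange) (a : A) :
    chartGerm j' x hx (φ a) = chartGerm j x hx' a := by
  have h1 := appLE_chartSection_of_comp (f := 𝟙 X) ((Category.comp_id _).trans e) a
  change X.presheaf.germ _ x hx (chartSection j' (φ a)) = _
  rw [← h1, Scheme.Hom.appLE, ConcreteCategory.comp_apply, TopCat.Presheaf.germ_res_apply]
  rfl

theorem stalkMap_chartGerm {φ : A →+* B} {j : Spec (.of A) ⟶ X} [IsOpenImmersion j]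
    {j' : Spec (.of B) ⟶ Y} [IsOpenImmersion j'] {f : Y ⟶ X}
    (e : j' ≫ f = Spec.map (CommRingCat.ofHom φ) ≫ j) (y : Y) (hy : y ∈ j'.opensRange)
    (hy' : f y ∈ j.opensRange) (a : A) :
    f.stalkMap y (chartGerm j (f y) hy' a) = chartGerm j' y hy (φ a) := by
  change f.stalkMap y (X.presheaf.germ j.opensRange (f y) _ (chartSection j a)) =
    Y.presheaf.germ _ y hy (chartSection j' (φ a))
  rw [Scheme.Hom.germ_stalkMap_apply, ← appLE_chartSection_of_comp e, Scheme.Hom.appLE,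
    ConcreteCategory.comp_apply, TopCat.Presheaf.germ_res_apply]

end ChartSection

theorem algebraMap_chartGerm {A : Type} [CommRing A] {X : Scheme.{0}} [IsIntegral X]
    (j : Spec (.of A) ⟶ X) [IsOpenImmersion j] (x : X) (hx : x ∈ j.opensRange)
    (hg : genericPoint X ∈ j.opensRange) (a : A) :
    algebraMap (X.presheaf.stalk x) X.functionField (chartGerm j x hx a) =
      chartGerm j (genericPoint X) hg a := by
  have : Nonempty j.opensRange := ⟨⟨x, hx⟩⟩
  exact Scheme.algebraMap_germ_eq_germToFunctionField X hx (chartSection j a)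

theorem localRing_genericPoint {X : Scheme.{0}} [IsIntegral X] (k : X.functionField) :
    k ∈ localRing (genericPoint X) := by
  refine ⟨k, ?_⟩
  rw [RingHom.algebraMap_toAlgebra]
  change X.presheaf.stalkSpecializes _ k = k
  rw [TopCat.Presheaf.stalkSpecializes_refl]
  rfl

/-! ### Points and integrality of a glued scheme -/

namespace ChartSystem

variable {J : Type} [PartialOrder J] {R : Type} [CommRing R] [Algebra ℂ R] (C : ChartSystem J R)

/-- The inclusion of a chart. -/
def ι (j : J) : Spec (.of (C.A j)) ⟶ C.scheme := colimit.ι C.diagram j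

instance (j : J) : IsOpenImmersion (C.ι j) :=
  inferInstanceAs (IsOpenImmersion (colimit.ι C.diagram j))

theorem map_ι {i k : J} (h : i ≤ k) :
    C.ι i = Spec.map (CommRingCat.ofHom (Subalgebra.inclusion (C.anti h)).toRingHom) ≫ C.ι k :=
  (colimit.w C.diagram (homOfLE h)).symm

theorem ι_structureMap (j : J) :
    C.ι j ≫ C.structureMap = Spec.map (CommRingCat.ofHom (algebraMap ℂ (C.A j))) :=
  colimit.ι_desc _ _

theorem exists_ι_eq (x : C.scheme) : ∃ (j : J) (p : Spec (.of (C.A j))), C.ι j p = x :=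
  Scheme.IsLocallyDirected.ι_jointly_surjective C.diagram x

/-- The diagram is locally directed, so points of two charts are identified only if both come from
one point of a common smaller chart. -/
theorem ι_eq_ι {i j : J} {p : Spec (.of (C.A i))} {q : Spec (.of (C.A j))}
    (h : C.ι i p = C.ι j q) : ∃ (k : J) (hi : k ≤ i) (hj : k ≤ j) (r : Spec (.of (C.A k))),
      pointIdeal p = (pointIdeal r).comap (Subalgebra.inclusion (C.anti hi)) ∧
      pointIdeal q = (pointIdeal r).comap (Subalgebra.inclusion (C.anti hj)) := by
  obtain ⟨k, fi, fj, r, rfl, rfl⟩ :=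
    (Scheme.IsLocallyDirected.ι_eq_ι_iff C.diagram (xi := p) (xj := q)).mp h
  exact ⟨k, fi.le, fj.le, r, rfl, rfl⟩

theorem opensRange_le {i k : J} (h : i ≤ k) : (C.ι i).opensRange ≤ (C.ι k).opensRange := by
  rintro _ ⟨p, rfl⟩
  exact ⟨Spec.map (CommRingCat.ofHom (Subalgebra.inclusion (C.anti h)).toRingHom) p, by
    rw [C.map_ι h, Scheme.Hom.comp_apply]⟩

/-- A point of the chart `k` at which the denominators of the chart `i ≤ k` do not vanish lies in
the chart `i`. -/
theorem ι_mem_opensRange {i k : J} (h : i ≤ k) (u : C.A k) (hu : ∃ v ∈ C.A i, (u : R) * v = 1)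
    (hs : ∀ a ∈ C.A i, ∃ N : ℕ, a * (u : R) ^ N ∈ C.A k) (p : Spec (.of (C.A k)))
    (hp : u ∉ pointIdeal p) : C.ι k p ∈ (C.ι i).opensRange := by
  let := (Subalgebra.inclusion (C.anti h)).toRingHom.toAlgebra
  have hl := C.isLocalization_away h u hu hs
  have hmem : (show PrimeSpectrum (C.A k) from p) ∈
      Set.range (PrimeSpectrum.comap (algebraMap (C.A k) (C.A i))) := by
    rw [PrimeSpectrum.localization_away_comap_range (C.A i) u]
    exact hp
  obtain ⟨q, hq⟩ := hmem
  let q' : Spec (.of (C.A i)) := q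
  refine ⟨q', ?_⟩
  rw [C.map_ι h, Scheme.Hom.comp_apply]
  exact congrArg (C.ι k) hq

theorem specializes_of_le {j : J} {p q : Spec (.of (C.A j))} (h : pointIdeal q ≤ pointIdeal p) :
    C.ι j q ⤳ C.ι j p :=
  ((PrimeSpectrum.le_iff_specializes (R := C.A j) q p).mp h).map (C.ι j).continuous

/-- The generic point of an integral chart. -/
def botPoint [IsDomain R] (j : J) : Spec (.of (C.A j)) := (⊥ : PrimeSpectrum (C.A j))

theorem ι_botPoint [IsDomain R] {i k : J} (h : i ≤ k) :
    C.ι i (C.botPoint i) = C.ι k (C.botPoint k) := by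
  rw [C.map_ι h, Scheme.Hom.comp_apply]
  congr 1
  refine PrimeSpectrum.ext (R := C.A k) ?_
  change Ideal.comap (Subalgebra.inclusion (C.anti h)).toRingHom ⊥ = ⊥
  rw [← RingHom.ker_eq_comap_bot]
  exact (RingHom.injective_iff_ker_eq_bot _).mp (Subalgebra.inclusion_injective (C.anti h))

/-- The generic point of the smallest chart is the generic point of every chart, so it specializes
to every point; the stalks are localizations of domains. -/
theorem isIntegral [IsDomain R] (b : J) (hb : ∀ j, b ≤ j) : IsIntegral C.scheme := by
  have : IrreducibleSpace C.scheme := by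
    have hcl : closure {C.ι b (C.botPoint b)} = (Set.univ : Set C.scheme) := by
      refine Set.eq_univ_of_forall fun x => ?_
      obtain ⟨j, p, rfl⟩ := C.exists_ι_eq x
      rw [← specializes_iff_mem_closure, C.ι_botPoint (hb j)]
      exact C.specializes_of_le bot_le
    have : IsIrreducible (Set.univ : Set C.scheme) := hcl ▸ isIrreducible_singleton.closure
    have : PreirreducibleSpace C.scheme := ⟨this.2⟩
    exact { toNonempty := ⟨C.ι b (C.botPoint b)⟩ }
  have : ∀ x : C.scheme, _root_.IsReduced (C.scheme.presheaf.stalk x) := by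
    intro x
    obtain ⟨j, p, rfl⟩ := C.exists_ι_eq x
    have := isDomain_stalk (C.ι j) p
    infer_instance
  have := isReduced_of_isReduced_stalk C.scheme
  exact isIntegral_of_irreducibleSpace_of_isReduced C.scheme

/-- In the specialization order generizations are larger, so coheight is codimension: a prime
strictly between `⊥` and that of `p` would give a strict chain of three points starting at `ι j p`.
-/
theorem eq_of_coheight_eq_one [IsDomain R] {j : J} {p : Spec (.of (C.A j))}
    (h : Order.coheight (C.ι j p) = 1) (q' : Ideal (C.A j)) (hq' : q'.IsPrime)
    (hle : q' ≤ pointIdeal p) (hne : q' ≠ ⊥) : q' = pointIdeal p := by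
  by_contra hlt
  let q : Spec (.of (C.A j)) := (⟨q', hq'⟩ : PrimeSpectrum (C.A j))
  have key : ∀ p q : Spec (.of (C.A j)), pointIdeal q ≤ pointIdeal p → pointIdeal q ≠ pointIdeal p →
      C.ι j p < C.ι j q := by
    intro p q hpq hne
    refine lt_of_le_not_ge (C.specializes_of_le hpq) fun hge => hne (le_antisymm hpq ?_)
    have h1 : C.ι j p ⤳ C.ι j q := hge
    have h2 := ((C.ι j).isOpenEmbedding.isInducing.specializes_iff).mp h1
    exact (PrimeSpectrum.le_iff_specializes (R := C.A j) p q).mpr h2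
  have h1 := Order.coheight_add_one_le (key p q hle hlt)
  have h2 := Order.coheight_add_one_le (key q (C.botPoint j) bot_le (Ne.symm hne))
  rw [h] at h1
  have h3 : (1 : ℕ∞) ≤ Order.coheight (C.ι j q) := le_add_self.trans h2
  have h4 : (1 : ℕ∞) + 1 ≤ 1 := (add_le_add_left h3 1).trans h1
  exact absurd h4 (by decide)

/-! ### The function field of a glued scheme and its local rings -/

section FunctionField

variable [IsDomain R] [IsIntegral C.scheme]

theorem genericPoint_mem (j : J) : genericPoint C.scheme ∈ (C.ι j).opensRange :=
  ((genericPoint_spec C.scheme).mem_open_set_iff (C.ι j).opensRange.isOpen).mpr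
    ⟨C.ι j (C.botPoint j), trivial, mem_opensRange_self _ _⟩

variable {b : J} (hb : ∀ j, b ≤ j) (hA : C.A b = ⊤)

/-- The inclusion of the ring containing all charts into the function field. -/
def toFunctionField (hA : C.A b = ⊤) : R →+* C.scheme.functionField :=
  (chartGerm (C.ι b) (genericPoint C.scheme) (C.genericPoint_mem b)).comp
    ((RingHom.id R).codRestrict (C.A b) fun r => by rw [hA]; trivial)

theorem toFunctionField_injective : Function.Injective (C.toFunctionField hA) := by
  intro r r' h
  rw [toFunctionField, RingHom.comp_apply, RingHom.comp_apply] at h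
  have h' := chartGerm_injective (C.ι b) (genericPoint C.scheme) (C.genericPoint_mem b) h
  exact congrArg Subtype.val h'

include hb in
theorem chartGerm_genericPoint (j : J) (a : C.A j) :
    chartGerm (C.ι j) (genericPoint C.scheme) (C.genericPoint_mem j) a =
      C.toFunctionField hA a := by
  have h := chartGerm_congr (C.map_ι (hb j)) (genericPoint C.scheme) (C.genericPoint_mem b)
    (C.genericPoint_mem j) a
  rw [← h, toFunctionField, RingHom.comp_apply]
  congr 1

include hb in
theorem algebraMap_chartGerm (j : J) (x : C.scheme) (hx : x ∈ (C.ι j).opensRange) (a : C.A j) :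
    algebraMap (C.scheme.presheaf.stalk x) C.scheme.functionField (chartGerm (C.ι j) x hx a) =
      C.toFunctionField hA a := by
  rw [ToricDoubleCover.algebraMap_chartGerm _ _ _ (C.genericPoint_mem j),
    C.chartGerm_genericPoint hb]

include hb in
-- The stalk is the localization of the chart at the prime of `p`. This description by fractions is
-- the one that `DoubleChart.formLattice_eq` requires of its subring.
theorem mem_localRing_iff (j : J) (p : Spec (.of (C.A j))) (k : C.scheme.functionField) :
    k ∈ localRing (C.ι j p) ↔ ∃ a c : C.A j, c ∉ pointIdeal p ∧
      k * C.toFunctionField hA c = C.toFunctionField hA a := by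
  have hmap := C.algebraMap_chartGerm hb hA j (C.ι j p) (mem_opensRange_self _ p)
  constructor
  · rintro ⟨z, rfl⟩
    obtain ⟨a, c, hc, h⟩ := exists_chartGerm_mul_eq (C.ι j) p z
    exact ⟨a, c, hc, by rw [← hmap, ← hmap, ← map_mul, h]⟩
  · rintro ⟨a, c, hc, h⟩
    obtain ⟨u, hu⟩ := (isUnit_chartGerm_iff (C.ι j) p c).mpr hc
    refine ⟨chartGerm (C.ι j) (C.ι j p) (mem_opensRange_self _ p) a * ↑u⁻¹, ?_⟩
    have hne : C.toFunctionField hA c ≠ 0 := by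
      rw [← hmap, ← hu]
      exact (u.isUnit.map _).ne_zero
    apply mul_right_cancel₀ hne
    rw [h, ← hmap, ← hmap, ← map_mul, ← hu, Units.inv_mul_cancel_right]

include hb in
-- The local ring of the generic point is the whole function field, so the fractions of any one
-- chart exhaust it.
theorem exists_mul_eq (j : J) (k : C.scheme.functionField) : ∃ a c : C.A j, (c : R) ≠ 0 ∧
    k * C.toFunctionField hA c = C.toFunctionField hA a := by
  obtain ⟨p, hp⟩ := C.genericPoint_mem j
  have hk := localRing_genericPoint k
  rw [← hp, C.mem_localRing_iff hb hA] at hk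
  obtain ⟨a, c, hc, h⟩ := hk
  refine ⟨a, c, fun h0 => hc ?_, h⟩
  rw [show c = 0 from Subtype.ext h0]
  exact Ideal.zero_mem _

/-- The constants coming from the structure morphism agree with those of `R`, so that differentials
over `ℂ` can be computed in the charts. -/
theorem constants_eq (f : C.scheme ⟶ Spec (.of ℂ))
    (hf : C.ι b ≫ f = Spec.map (CommRingCat.ofHom (algebraMap ℂ (C.A b)))) (c : ℂ) :
    constants f c = C.toFunctionField hA (algebraMap ℂ R c) := by
  have h1 : f.appLE ⊤ (C.ι b).opensRange (le_top.trans (Scheme.Hom.preimage_top f).ge)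
      ((Scheme.ΓSpecIso (.of ℂ)).inv c) = chartSection (C.ι b) (algebraMap ℂ (C.A b) c) := by
    apply appLE_opensRange_injective (C.ι b)
    rw [appLE_chartSection, ← ConcreteCategory.comp_apply, Scheme.Hom.appLE_comp_appLE]
    have h2 := congrArg (fun f => f.hom c)
      (Scheme.ΓSpecIso_inv_naturality (CommRingCat.ofHom (algebraMap ℂ (C.A b))))
    refine Eq.trans ?_ h2.symm
    have h4 : ∀ (g : Spec (.of (C.A b)) ⟶ Spec (.of ℂ)) (g' : Spec (.of (C.A b)) ⟶ Spec (.of ℂ))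
        (_ : g = g') (h : ⊤ ≤ g ⁻¹ᵁ ⊤), g.appLE ⊤ ⊤ h = g'.appTop := by
      rintro g _ rfl h
      simp only [Scheme.Hom.appLE]
      rfl
    rw [h4 _ _ hf]
    rfl
  have h3 : C.toFunctionField hA (algebraMap ℂ R c) =
      C.scheme.presheaf.germ _ _ (C.genericPoint_mem b) (chartSection (C.ι b)
        (algebraMap ℂ (C.A b) c)) := rfl
  rw [h3, ← h1, Scheme.Hom.appLE, ConcreteCategory.comp_apply, TopCat.Presheaf.germ_res_apply]
  rfl

end FunctionField
end ChartSystem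

/-- On the integral scheme `Y` germs determine sections, so a function whose pullback has zero germ
at `y` pulls back to zero on its whole domain. -/
theorem idealStalk_eq_ker {X Y : Scheme.{0}} [IsIntegral Y] (i : Y ⟶ X) (y : Y) :
    idealStalk i (i y) = RingHom.ker (i.stalkMap y).hom := by
  apply le_antisymm
  · refine Ideal.span_le.mpr ?_
    rintro _ ⟨U, hx, t, ht, rfl⟩
    change i.stalkMap y (X.presheaf.germ U (i y) hx t) = 0
    rw [Scheme.Hom.germ_stalkMap_apply, ht, map_zero]
  · intro a ha
    obtain ⟨U, hx, t, rfl⟩ := X.presheaf.exists_germ_eq a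
    refine Ideal.subset_span ⟨U, hx, t, ?_, rfl⟩
    have h1 : i.stalkMap y (X.presheaf.germ U (i y) hx t) = 0 := ha
    rw [Scheme.Hom.germ_stalkMap_apply] at h1
    exact germ_injective_of_isIntegral Y y hx (h1.trans (map_zero _).symm)

theorem idealStalk_eq_top {X Y : Scheme.{0}} (i : Y ⟶ X) (x : X) (U : X.Opens) (hx : x ∈ U)
    (hU : ∀ y, i y ∉ U) : idealStalk i x = ⊤ := by
  rw [Ideal.eq_top_iff_one]
  refine Ideal.subset_span ⟨U, hx, 1, ?_, (map_one _).symm⟩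
  have : i ⁻¹ᵁ U = ⊥ := by
    ext y
    exact ⟨fun h => (hU y h).elim, fun h => h.elim⟩
  have h1 : Subsingleton Γ(Y, i ⁻¹ᵁ U) := by
    rw [this]
    infer_instance
  exact Subsingleton.elim _ _

/-! ### Maximal cones -/

/-- The coordinate functional of a generator of a simplicial cone. -/
theorem exists_dual_functional {n : ℕ} {σ : Finset (Fin n → ℤ)}
    (hσ : LinearIndependent ℚ (fun v : σ => ratVec v.1)) {v : Fin n → ℤ} (hv : v ∈ σ) :
    ∃ l : (Fin n → ℝ) →ₗ[ℝ] ℝ, l (realVec v) = 1 ∧ ∀ w ∈ σ, w ≠ v → l (realVec w) = 0 := by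
  classical
  obtain ⟨m, h0, h1⟩ := exists_face_character (⊤ : AddSubgroup (Fin n → ℤ)) hσ (σ.erase v)
  let l₀ : (Fin n → ℝ) →ₗ[ℝ] ℝ := ∑ i, (m.1 i : ℝ) • LinearMap.proj i
  have hl₀ : ∀ w, l₀ (realVec w) = (pairing m.1 w : ℝ) := by
    intro w
    simp [l₀, pairing, realVec]
  have hpos : (pairing m.1 v : ℝ) ≠ 0 := by
    exact_mod_cast (h1 v hv (Finset.notMem_erase v σ)).ne'
  refine ⟨(pairing m.1 v : ℝ)⁻¹ • l₀, ?_, fun w hw hne => ?_⟩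
  · rw [LinearMap.smul_apply, hl₀, smul_eq_mul, inv_mul_cancel₀ hpos]
  · rw [LinearMap.smul_apply, hl₀, h0 w hw (Finset.mem_erase.mpr ⟨hne, hw⟩)]
    simp

theorem apply_sum_realVec {n : ℕ} {σ τ : Finset (Fin n → ℤ)} (hτ : τ ⊆ σ) {v : Fin n → ℤ}
    {l : (Fin n → ℝ) →ₗ[ℝ] ℝ} (h1 : l (realVec v) = 1)
    (h0 : ∀ w ∈ σ, w ≠ v → l (realVec w) = 0) (c : (Fin n → ℤ) → ℝ) :
    l (∑ w ∈ τ, c w • realVec w) = if v ∈ τ then c v else 0 := by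
  classical
  rw [map_sum, ← Finset.sum_ite_eq' τ v c]
  refine Finset.sum_congr rfl fun w hw => ?_
  rw [map_smul, smul_eq_mul]
  split_ifs with h
  · rw [h, h1, mul_one]
  · rw [h0 w (hτ hw) h, mul_zero]

/-- The sum `p` of the generators of `σ` is moved slightly in a direction `w` lying in no proper
span of a cone. By finiteness one cone `τ` contains infinitely many of the moved points. Two of them
differ by a multiple of `w`, so `τ` spans the space; in the limit `τ` contains `p`. Since cones meet
in common faces and `p` is interior to `σ`, the cone `σ` is a face of `τ`. -/
theorem exists_maximal_cone {S : ConeComplex 3} (hS : IsSmoothMPCPFan S)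
    {σ : Finset (Fin 3 → ℤ)} (hσ : σ ∈ S.cones) : ∃ τ ∈ S.cones, σ ⊆ τ ∧ τ.card = 3 := by
  classical
  let E : Finset (Fin 3 → ℤ) → Submodule ℝ (Fin 3 → ℝ) :=
    fun τ => Submodule.span ℝ (τ.image realVec : Finset (Fin 3 → ℝ))
  have hcone : ∀ τ : Finset (Fin 3 → ℤ), ∀ x ∈ realCone τ, x ∈ E τ := by
    rintro τ _ ⟨c, _, rfl⟩
    exact Submodule.sum_mem _ fun v hv => Submodule.smul_mem _ _
      (Submodule.subset_span (Finset.mem_coe.mpr (Finset.mem_image_of_mem _ hv)))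
  -- A real vector space is not a finite union of proper subspaces.
  obtain ⟨w, hw⟩ : ∃ w : Fin 3 → ℝ, ∀ τ ∈ S.cones, w ∈ E τ → E τ = ⊤ := by
    by_contra! hall
    let F : Finset (Submodule ℝ (Fin 3 → ℝ)) :=
      (hS.finite.toFinset.image E).filter (· ≠ ⊤)
    refine Subspace.biUnion_ne_univ_of_top_notMem (s := F) (by simp [F])
      (Set.eq_univ_of_forall fun x => ?_)
    obtain ⟨τ, hτ, hx, hne⟩ := hall x
    refine Set.mem_biUnion (x := E τ) ?_ hx
    exact Finset.mem_filter.mpr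
      ⟨Finset.mem_image_of_mem E (hS.finite.mem_toFinset.mpr hτ), hne⟩
  let p : Fin 3 → ℝ := ∑ v ∈ σ, (1 : ℝ) • realVec v
  let x : ℕ → Fin 3 → ℝ := fun n => p + (1 / ((n : ℝ) + 1)) • w
  obtain ⟨τ, hτ, hfreq⟩ : ∃ τ ∈ S.cones, ∃ᶠ n in Filter.atTop, x n ∈ realCone τ := by
    by_contra! hall
    have h1 : ∀ᶠ n in Filter.atTop, ∀ τ ∈ S.cones, x n ∉ realCone τ :=
      (Filter.eventually_all_finite hS.finite).mpr fun τ hτ => hall τ hτ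
    obtain ⟨n, hn⟩ := h1.exists
    obtain ⟨τ, hτ, hx⟩ := hS.complete (x n)
    exact hn τ hτ hx
  have htop : E τ = ⊤ := by
    refine hw τ hτ ?_
    obtain ⟨n, hn⟩ := hfreq.exists
    obtain ⟨m, hm, hnm⟩ := (hfreq.and_eventually (Filter.eventually_gt_atTop n)).exists
    have h1 := (E τ).sub_mem (hcone τ _ hn) (hcone τ _ hm)
    have h2 : x n - x m = (1 / ((n : ℝ) + 1) - 1 / ((m : ℝ) + 1)) • w := by
      simp only [x, sub_smul]
      abel
    rw [h2] at h1
    refine ((E τ).smul_mem_iff ?_).mp h1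
    have hlt : 1 / ((m : ℝ) + 1) < 1 / ((n : ℝ) + 1) := Nat.one_div_lt_one_div hnm
    exact (sub_pos.mpr hlt).ne'
  -- The coefficients with respect to the generators of `τ` are linear functionals, so those of `p`
  -- are limits of non-negative numbers along a subsequence.
  have hpτ : p ∈ realCone τ := by
    have hspan : ∀ y ∈ E τ, ∃ c : (Fin 3 → ℤ) → ℝ, y = ∑ v ∈ τ, c v • realVec v := by
      intro y hy
      induction hy using Submodule.span_induction with
      | mem y hy =>
        obtain ⟨v, hv, rfl⟩ := Finset.mem_image.mp (Finset.mem_coe.mp hy)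
        refine ⟨fun u => if u = v then 1 else 0, ?_⟩
        simp [ite_smul, hv]
      | zero => exact ⟨0, by simp⟩
      | add y z _ _ hy hz =>
        obtain ⟨c, rfl⟩ := hy
        obtain ⟨d, rfl⟩ := hz
        exact ⟨c + d, by simp [add_smul, Finset.sum_add_distrib]⟩
      | smul a y _ hy =>
        obtain ⟨c, rfl⟩ := hy
        exact ⟨a • c, by simp [Finset.smul_sum, mul_smul]⟩
    obtain ⟨c, hc⟩ := hspan p (by rw [htop]; trivial)
    refine ⟨fun v => if v ∈ τ then c v else 0, fun v => ?_, ?_⟩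
    · dsimp only
      split_ifs with hv
      · obtain ⟨l, hl1, hl0⟩ := exists_dual_functional (S.linearIndependent hτ) hv
        have hlp : l p = c v := by
          rw [hc, apply_sum_realVec Finset.Subset.rfl hl1 hl0, if_pos hv]
        have hlim : Filter.Tendsto (fun n : ℕ => l p + 1 / ((n : ℝ) + 1) * l w) Filter.atTop
            (nhds (l p + 0 * l w)) :=
          (tendsto_one_div_add_atTop_nhds_zero_nat.mul_const _).const_add _
        rw [zero_mul, add_zero, hlp] at hlim
        refine ge_of_tendsto_of_frequently hlim (hfreq.mono fun n hn => ?_)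
        obtain ⟨d, hd, hxd⟩ := hn
        have h1 : l (x n) = d v := by
          rw [hxd, apply_sum_realVec Finset.Subset.rfl hl1 hl0, if_pos hv]
        have h2 : l (x n) = c v + 1 / ((n : ℝ) + 1) * l w := by
          simp only [x, map_add, map_smul, smul_eq_mul, hlp]
        rw [← h2, h1]
        exact hd v
      · exact le_rfl
    · rw [hc]
      exact Finset.sum_congr rfl fun v hv => by simp only [if_pos hv]
  have hpσ : p ∈ realCone σ := ⟨fun _ => 1, fun _ => zero_le_one, rfl⟩
  have hpi : p ∈ realCone (σ ∩ τ) := hS.inter σ hσ τ hτ ▸ ⟨hpσ, hpτ⟩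
  obtain ⟨c, _, hc⟩ := hpi
  refine ⟨τ, hτ, fun v hv => ?_, ?_⟩
  -- The coefficient of `p` at `v` is 1, but it would be 0 if `v` were missing from `σ ∩ τ`.
  · obtain ⟨l, hl1, hl0⟩ := exists_dual_functional (S.linearIndependent hσ) hv
    have h1 : l p = 1 := by
      rw [apply_sum_realVec Finset.Subset.rfl hl1 hl0, if_pos hv]
    rw [hc, apply_sum_realVec Finset.inter_subset_left hl1 hl0] at h1
    by_contra hvτ
    rw [if_neg (fun h => hvτ (Finset.mem_inter.mp h).2)] at h1
    exact zero_ne_one h1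
  · apply le_antisymm
    · have := (S.linearIndependent hτ).fintype_card_le_finrank
      simpa using this
    · have h1 := finrank_span_finset_le_card (R := ℝ) (τ.image realVec)
      have h2 : Module.finrank ℝ (E τ) = 3 := by
        rw [htop, finrank_top]
        simp
      calc 3 = Module.finrank ℝ (E τ) := h2.symm
        _ ≤ _ := h1.trans Finset.card_image_le

/-- The generators of a maximal cone form a basis of the lattice. -/
theorem exists_basis {S : ConeComplex 3} (hS : IsSmoothMPCPFan S) {σ : Finset (Fin 3 → ℤ)}
    (hσ : σ ∈ S.cones) (hc : σ.card = 3) :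
    ∃ b : Module.Basis (Fin 3) ℤ (Fin 3 → ℤ), (σ : Set (Fin 3 → ℤ)) = Set.range b := by
  classical
  obtain ⟨b, hb⟩ := hS.smooth σ hσ
  refine ⟨b, ?_⟩
  have hsub : σ ⊆ Finset.univ.image b := fun v hv => by
    obtain ⟨i, rfl⟩ := hb v hv
    exact Finset.mem_image_of_mem _ (Finset.mem_univ i)
  have heq := Finset.eq_of_subset_of_card_le hsub (by
    rw [hc]
    exact Finset.card_image_le.trans (by simp))
  rw [heq]
  simp

/-! ### Coordinates on the charts of maximal cones -/

/-- Both sides are algebra homomorphisms in `p`, the right one induced by the additive map `a ↦ ∑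
aⱼwⱼ`, and they agree on the variables. -/
theorem aeval_single_eq {G : Type} [AddCommMonoid G] {n : ℕ} (w : Fin n → G)
    (p : MvPolynomial (Fin n) ℂ) :
    MvPolynomial.aeval (fun j => (AddMonoidAlgebra.single (w j) 1 : AddMonoidAlgebra ℂ G)) p =
      AddMonoidAlgebra.mapDomain (fun a : Fin n →₀ ℕ => ∑ j, a j • w j) p := by
  let μ : (Fin n →₀ ℕ) →+ G :=
    { toFun := fun a => ∑ j, a j • w j
      map_zero' := by simp
      map_add' := fun a b => by simp [add_smul, Finset.sum_add_distrib] }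
  have h : (MvPolynomial.aeval fun j => (AddMonoidAlgebra.single (w j) 1 : AddMonoidAlgebra ℂ G)) =
      AddMonoidAlgebra.mapDomainAlgHom ℂ ℂ μ := by
    refine MvPolynomial.algHom_ext fun j => ?_
    rw [MvPolynomial.aeval_X]
    change _ = AddMonoidAlgebra.mapDomain μ (AddMonoidAlgebra.single _ _)
    rw [AddMonoidAlgebra.mapDomain_single]
    congr 1
    simp [μ, Finsupp.single_apply]
  exact congrArg (fun f => f p) h

/-- A basis `w` of the dual lattice which is dual to `n` given vectors. -/
structure DualFrame {n : ℕ} (Λ : AddSubgroup (Fin n → ℤ)) (v : Fin n → Fin n → ℤ) where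
  w : Fin n → dualLattice Λ
  pairing_w : ∀ i j, pairing (w i).1 (v j) = if i = j then 1 else 0
  eq_zero : ∀ m : Fin n → ℚ, (∀ j, pairing m (v j) = 0) → m = 0

namespace DualFrame

variable {n : ℕ} {Λ : AddSubgroup (Fin n → ℤ)} {v : Fin n → Fin n → ℤ} (F : DualFrame Λ v)

/-- The coordinate functions. -/
def x (j : Fin n) : Laurent Λ := monomial (F.w j)

/-- The exponent with given coordinates. -/
def exponent (a : Fin n → ℕ) : dualLattice Λ := ∑ j, a j • F.w j

theorem pairing_exponent (a : Fin n → ℕ) (j : Fin n) : pairing (F.exponent a).1 (v j) = a j := by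
  have h : ∀ s : Finset (Fin n), pairing (∑ i ∈ s, a i • F.w i : dualLattice Λ).1 (v j) =
      ∑ i ∈ s, (a i : ℚ) * pairing (F.w i).1 (v j) := by
    classical
    intro s
    induction s using Finset.induction_on with
    | empty => simp [pairing]
    | insert i s hi ih =>
      rw [Finset.sum_insert hi, Finset.sum_insert hi, ← ih, AddSubgroup.coe_add, pairing_add,
        AddSubgroup.coe_nsmul, pairing_nsmul]
  rw [exponent, h]
  simp [F.pairing_w]

include F in
theorem ext_pairing {m m' : dualLattice Λ} (h : ∀ j, pairing m.1 (v j) = pairing m'.1 (v j)) :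
    m = m' := by
  have h0 : m.1 - m'.1 = 0 := F.eq_zero _ fun j => by
    rw [sub_eq_add_neg, pairing_add, pairing_neg, h j, add_neg_cancel]
  exact Subtype.ext (sub_eq_zero.mp h0)

theorem exponent_injective : Function.Injective fun a : Fin n →₀ ℕ => F.exponent a := by
  intro a b hab
  ext j
  have h : F.exponent a = F.exponent b := hab
  have := F.pairing_exponent a j
  rw [h, F.pairing_exponent] at this
  exact_mod_cast this.symm

theorem aeval_x (p : MvPolynomial (Fin n) ℂ) : MvPolynomial.aeval F.x p =
    AddMonoidAlgebra.mapDomain (fun a : Fin n →₀ ℕ => F.exponent a) p :=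
  aeval_single_eq F.w p

theorem coeff_aeval (p : MvPolynomial (Fin n) ℂ) (a : Fin n →₀ ℕ) :
    (MvPolynomial.aeval F.x p).coeff (F.exponent a) = p.coeff a := by
  rw [F.aeval_x]
  exact Finsupp.mapDomain_apply F.exponent_injective _ _

theorem exists_of_mem_support {p : MvPolynomial (Fin n) ℂ} {m : dualLattice Λ}
    (hm : m ∈ (MvPolynomial.aeval F.x p).coeff.support) : ∃ a : Fin n → ℕ, m = F.exponent a := by
  classical
  rw [F.aeval_x] at hm
  obtain ⟨a, _, rfl⟩ := Finset.mem_image.mp (Finsupp.mapDomain_support hm)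
  exact ⟨a, rfl⟩

theorem aeval_injective : Function.Injective (MvPolynomial.aeval F.x : _ →ₐ[ℂ] Laurent Λ) := by
  intro p q h
  refine MvPolynomial.ext _ _ fun a => ?_
  rw [← F.coeff_aeval, h, F.coeff_aeval]

theorem monomial_exponent (a : Fin n → ℕ) :
    monomial (F.exponent a) =
      MvPolynomial.aeval F.x (∏ j, MvPolynomial.X j ^ a j : MvPolynomial (Fin n) ℂ) := by
  rw [map_prod]
  simp only [map_pow, MvPolynomial.aeval_X, x, monomial_pow]
  have h : ∀ s : Finset (Fin n), monomial (∑ i ∈ s, a i • F.w i : dualLattice Λ) =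
      ∏ i ∈ s, monomial (a i • F.w i) := by
    classical
    intro s
    induction s using Finset.induction_on with
    | empty => simp [monomial_zero]
    | insert i s hi ih => rw [Finset.sum_insert hi, Finset.prod_insert hi, ← ih, monomial_mul]
  exact h _

theorem exists_eq_exponent {m : dualLattice Λ} (h : ∀ j, ∃ k : ℤ, pairing m.1 (v j) = k)
    (h0 : ∀ j, 0 ≤ pairing m.1 (v j)) : ∃ a : Fin n → ℕ, m = F.exponent a := by
  choose k hk using h
  refine ⟨fun j => (k j).toNat, F.ext_pairing fun j => ?_⟩
  rw [F.pairing_exponent, hk]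
  have : 0 ≤ k j := by exact_mod_cast (hk j) ▸ h0 j
  exact_mod_cast (Int.toNat_of_nonneg this).symm

theorem aeval_mem (p : MvPolynomial (Fin n) ℂ) :
    MvPolynomial.aeval F.x p ∈ coneAlgebra Λ (Set.range v) := by
  intro m hm u hu
  obtain ⟨j, rfl⟩ := hu
  obtain ⟨a, rfl⟩ := F.exists_of_mem_support hm
  rw [F.pairing_exponent]
  exact_mod_cast Nat.zero_le _

theorem eq_aeval_of_forall {f : Laurent Λ}
    (h : ∀ m ∈ f.coeff.support, ∃ a : Fin n → ℕ, m = F.exponent a) :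
    ∃ p : MvPolynomial (Fin n) ℂ, f = MvPolynomial.aeval F.x p := by
  classical
  have h1 : ∀ m ∈ f.coeff.support, ∃ p : MvPolynomial (Fin n) ℂ,
      (AddMonoidAlgebra.single m (f.coeff m) : Laurent Λ) = MvPolynomial.aeval F.x p := by
    intro m hm
    obtain ⟨a, rfl⟩ := h m hm
    refine ⟨MvPolynomial.C (f.coeff (F.exponent a)) * ∏ j, MvPolynomial.X j ^ a j, ?_⟩
    rw [map_mul, ← F.monomial_exponent, MvPolynomial.aeval_C, monomial, ← Algebra.smul_def]
    simp
  have h2 : f ∈ (MvPolynomial.aeval F.x : MvPolynomial (Fin n) ℂ →ₐ[ℂ] Laurent Λ).range := by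
    rw [← AddMonoidAlgebra.sum_coeff_single f, Finsupp.sum]
    refine Subalgebra.sum_mem _ fun m hm => ?_
    obtain ⟨p, hp⟩ := h1 m hm
    exact ⟨p, hp.symm⟩
  obtain ⟨p, hp⟩ := h2
  exact ⟨p, hp.symm⟩

end DualFrame

theorem squarefree_prod_X {n : ℕ} (s : Finset (Fin n)) :
    Squarefree (∏ j ∈ s, MvPolynomial.X j : MvPolynomial (Fin n) ℂ) := by
  classical
  induction s using Finset.induction_on with
  | empty => simp
  | insert i s hi ih =>
    have hX : Irreducible (MvPolynomial.X i : MvPolynomial (Fin n) ℂ) :=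
      (MvPolynomial.X_prime).irreducible
    rw [Finset.prod_insert hi, squarefree_mul_iff]
    refine ⟨IsRelPrime.prod_right fun j hj => hX.isRelPrime_iff_not_dvd.mpr fun hd => hi ?_,
      hX.squarefree, ih⟩
    rwa [MvPolynomial.X_dvd_X.mp hd]

/-! ### Charts branched along all coordinate hyperplanes -/

namespace DualFrame

variable {n : ℕ} {Λ : AddSubgroup (Fin n → ℤ)} {v : Fin n → Fin n → ℤ} (F : DualFrame Λ v)

theorem coeff_aeval_eq_zero (p : MvPolynomial (Fin n) ℂ) {m : dualLattice Λ} (j : Fin n)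
    (hm : ∀ k : ℤ, pairing m.1 (v j) ≠ k) : (MvPolynomial.aeval F.x p).coeff m = 0 := by
  by_contra h
  obtain ⟨a, rfl⟩ := F.exists_of_mem_support (Finsupp.mem_support_iff.mpr h)
  exact hm (a j) (by rw [F.pairing_exponent]; norm_cast)

/-- The chart of a cone whose generators pair with the dual lattice either all in `ℤ` or all in
`½ + ℤ`. -/
def doubleChart (j₀ : Fin n) (ν : dualLattice Λ) (hν : ∀ j, pairing ν.1 (v j) = 1 / 2)
    (hpar : ∀ m : dualLattice Λ, (∀ j, ∃ k : ℤ, pairing m.1 (v j) = k) ∨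
      ∀ j, ∃ k : ℤ, pairing m.1 (v j) = k + 1 / 2) :
    DoubleChart (coneAlgebra Λ (Set.range v)) n where
  x := F.x
  w := monomial ν
  h := ∏ j, MvPolynomial.X j
  mul_self := by
    -- Both sides pair to 1 with every generator, so the square of the monomial of `ν` is the
    -- product of the coordinates.
    have h : ν + ν = F.exponent 1 := F.ext_pairing fun j => by
      rw [F.pairing_exponent, AddSubgroup.coe_add, pairing_add, hν]
      norm_num
    rw [monomial_mul, h, F.monomial_exponent]
    simp
  inj := by
    intro a b hab
    -- The two summands have disjoint supports: exponents of the first pair with `v j₀` in `ℤ`,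
    -- those of the second in `½ + ℤ`.
    have ha : a = 0 := by
      refine MvPolynomial.ext _ _ fun α => ?_
      have h1 := congrArg (fun f : Laurent Λ => f.coeff (F.exponent α)) hab
      simp only [AddMonoidAlgebra.coeff_add, Finsupp.add_apply, F.coeff_aeval, monomial,
        AddMonoidAlgebra.coeff_mul_single_apply] at h1
      rw [F.coeff_aeval_eq_zero b j₀, zero_mul, add_zero] at h1
      · exact h1
      · intro k hk
        rw [AddSubgroup.coe_add, pairing_add, AddSubgroup.coe_neg, pairing_neg, hν,
          F.pairing_exponent] at hk
        have h2 : (2 * (α j₀ : ℤ) - 1 : ℚ) = 2 * k := by push_cast; linarith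
        have h3 : 2 * (α j₀ : ℤ) - 1 = 2 * k := by exact_mod_cast h2
        omega
    refine ⟨ha, F.aeval_injective ?_⟩
    rw [ha, map_zero, zero_add] at hab
    rw [map_zero, ← mul_one (MvPolynomial.aeval F.x b), ← monomial_mul_neg ν, ← mul_assoc, hab,
      zero_mul]
  mem_iff := by
    intro r
    constructor
    · intro hr
      let T : (MvPolynomial (Fin n) ℂ × MvPolynomial (Fin n) ℂ) →ₗ[ℂ] Laurent Λ :=
        LinearMap.coprod (MvPolynomial.aeval F.x).toLinearMap
          ((LinearMap.mulRight ℂ (monomial ν)).comp (MvPolynomial.aeval F.x).toLinearMap)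
      have hT : r ∈ LinearMap.range T := by
        rw [← AddMonoidAlgebra.sum_coeff_single r, Finsupp.sum]
        refine Submodule.sum_mem _ fun m hm => ?_
        have hs : (AddMonoidAlgebra.single m (r.coeff m) : Laurent Λ) =
            r.coeff m • monomial m := by simp [monomial]
        rw [hs]
        refine Submodule.smul_mem _ _ ?_
        have h0 : ∀ j, 0 ≤ pairing m.1 (v j) := fun j => by
          simpa using hr m hm (v j) ⟨j, rfl⟩
        rcases hpar m with h | h
        · obtain ⟨a, rfl⟩ := F.exists_eq_exponent h h0
          exact ⟨(∏ j, MvPolynomial.X j ^ a j, 0), by simp [T, F.monomial_exponent]⟩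
        -- A non-negative element of `½ + ℤ` is at least `½`, so `m - ν` still pairs non-negatively
        -- with the generators, and now integrally.
        · have hmν : ∀ j, pairing (m - ν).1 (v j) = pairing m.1 (v j) - 1 / 2 := fun j => by
            rw [sub_eq_add_neg, AddSubgroup.coe_add, AddSubgroup.coe_neg, pairing_add,
              pairing_neg, hν]
            ring
          obtain ⟨a, ha⟩ := F.exists_eq_exponent (m := m - ν)
            (fun j => by
              obtain ⟨k, hk⟩ := h j
              exact ⟨k, by rw [hmν, hk]; ring⟩)
            (fun j => by
              obtain ⟨k, hk⟩ := h j
              have h1 := h0 j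
              rw [hmν, hk]
              rw [hk] at h1
              have h2 : (-1 : ℚ) < k := by linarith
              have h3 : -1 < k := by exact_mod_cast h2
              have h4 : (0 : ℚ) ≤ k := by exact_mod_cast (by omega : 0 ≤ k)
              linarith)
          refine ⟨(0, ∏ j, MvPolynomial.X j ^ a j), ?_⟩
          rw [← sub_add_cancel m ν, ← monomial_mul, ha, F.monomial_exponent]
          simp [T]
      obtain ⟨⟨a, b⟩, hab⟩ := hT
      exact ⟨a, b, hab.symm⟩
    · rintro ⟨a, b, rfl⟩
      refine Subalgebra.add_mem _ (F.aeval_mem a) (Subalgebra.mul_mem _ (F.aeval_mem b) ?_)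
      refine single_mem_cutoff ν 1 ?_
      rintro _ ⟨j, rfl⟩
      rw [hν]
      norm_num
  squarefree := squarefree_prod_X _
  not_isUnit := fun hu => (MvPolynomial.X_prime (i := j₀)).not_isUnit
    (isUnit_of_dvd_unit (Finset.dvd_prod_of_mem _ (Finset.mem_univ j₀)) hu)

end DualFrame

/-! ### The dual bases of the maximal cones -/

theorem pairing_intCast {n : ℕ} (b : Module.Basis (Fin n) ℤ (Fin n → ℤ)) (i : Fin n)
    (u : Fin n → ℤ) : pairing (fun k => (b.coord i (Pi.single k 1) : ℚ)) u = b.coord i u := by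
  rw [pairing, LinearMap.pi_apply_eq_sum_univ (b.coord i) u]
  push_cast
  refine Finset.sum_congr rfl fun k _ => ?_
  rw [smul_eq_mul, Int.cast_mul, mul_comm]
  congr 4
  ext j
  simp [Pi.single_apply, eq_comm]

/-- The frame dual to a basis. -/
def basisFrame {n : ℕ} (b : Module.Basis (Fin n) ℤ (Fin n → ℤ)) :
    DualFrame (⊤ : AddSubgroup (Fin n → ℤ)) b where
  w i := ⟨fun k => (b.coord i (Pi.single k 1) : ℚ), fun u _ => ⟨_, pairing_intCast b i u⟩⟩
  pairing_w i j := by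
    rw [pairing_intCast]
    simp [Finsupp.single_apply, eq_comm]
  eq_zero m hm := by
    have h : ∀ u : Fin n → ℤ, pairing m u = 0 := by
      intro u
      let l : (Fin n → ℤ) →ₗ[ℤ] ℚ :=
        (AddMonoidHom.mk' (fun u => pairing m u) fun u u' => by
          simp [pairing, mul_add, Finset.sum_add_distrib]).toIntLinearMap
      have hl : l = 0 := b.ext hm
      exact congrArg (fun f => f u) hl
    ext i
    have := h (Pi.single i 1)
    simpa [pairing, Pi.single_apply] using this

theorem pairing_top_int {n : ℕ} (m : dualLattice (⊤ : AddSubgroup (Fin n → ℤ)))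
    (u : Fin n → ℤ) : ∃ k : ℤ, pairing m.1 u = k := m.2 u trivial

/-- The character `x^m t^d` of the torus with lattice `M × 2ℤ`, where `t` has weight `½`. -/
def liftExponent (m : dualLattice (⊤ : AddSubgroup (Fin 3 → ℤ))) (d : ℤ) :
    dualLattice evenLattice :=
  ⟨![m.1 0, m.1 1, m.1 2, d / 2], by
    rintro u ⟨e, he⟩
    obtain ⟨k, hk⟩ := m.2 ![u 0, u 1, u 2] trivial
    -- The last coordinate of `u` is `e + e`, so the exponent `d / 2` pairs with it to the integer
    -- `d * e`.
    refine ⟨k + d * e, ?_⟩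
    simp only [pairing, Fin.sum_univ_four, Fin.sum_univ_three] at hk ⊢
    simp only [Matrix.cons_val] at hk ⊢
    rw [hk, he]
    push_cast
    ring⟩

theorem pairing_liftExponent (m : dualLattice (⊤ : AddSubgroup (Fin 3 → ℤ))) (d : ℤ)
    (η : Fin 3 → ℤ) (e : ℤ) : pairing (liftExponent m d).1 ![η 0, η 1, η 2, e] =
      pairing m.1 η + d * e / 2 := by
  simp [pairing, liftExponent, Fin.sum_univ_four, Fin.sum_univ_three]
  ring

theorem pairing_liftExponent_vertical (m : dualLattice (⊤ : AddSubgroup (Fin 3 → ℤ))) (d : ℤ)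
    (e : ℤ) : pairing (liftExponent m d).1 ![0, 0, 0, e] = d * e / 2 := by
  simp [pairing, liftExponent, Fin.sum_univ_four]
  ring

theorem liftExponent_add (m m' : dualLattice (⊤ : AddSubgroup (Fin 3 → ℤ))) (d d' : ℤ) :
    liftExponent m d + liftExponent m' d' = liftExponent (m + m') (d + d') := by
  apply Subtype.ext
  ext i
  fin_cases i <;> simp [liftExponent, add_div]

theorem liftExponent_surjective (m : dualLattice evenLattice) :
    ∃ m' d, m = liftExponent m' d := by
  -- The degree in `t` is the pairing with twice the vertical generator.
  obtain ⟨d, hd⟩ := m.2 ![0, 0, 0, 2] ⟨1, rfl⟩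
  refine ⟨⟨![m.1 0, m.1 1, m.1 2], fun u _ => ?_⟩, d, ?_⟩
  · obtain ⟨k, hk⟩ := m.2 ![u 0, u 1, u 2, 0] ⟨0, rfl⟩
    refine ⟨k, ?_⟩
    rw [← hk]
    simp [pairing, Fin.sum_univ_four, Fin.sum_univ_three]
  · apply Subtype.ext
    simp only [pairing, Fin.sum_univ_four] at hd
    ext i
    fin_cases i <;> simp [liftExponent]
    simp at hd
    linarith

theorem liftExponent_injective {m m' : dualLattice (⊤ : AddSubgroup (Fin 3 → ℤ))} {d d' : ℤ}
    (h : liftExponent m d = liftExponent m' d') : m = m' ∧ d = d' := by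
  have h' := congrArg Subtype.val h
  constructor
  · apply Subtype.ext
    ext i
    fin_cases i
    · exact congrFun h' 0
    · exact congrFun h' 1
    · exact congrFun h' 2
  · have h3 : (d / 2 : ℚ) = d' / 2 := congrFun h' 3
    have h4 : (d : ℚ) = d' := by linarith
    exact_mod_cast h4

/-- The generators of the cone over a maximal cone. -/
def liftVectors (b : Fin 3 → Fin 3 → ℤ) (ε : ℤ) : Fin 4 → Fin 4 → ℤ :=
  Fin.snoc (fun j => ![b j 0, b j 1, b j 2, -1]) ![0, 0, 0, ε]

theorem liftCone_eq_range {σ : Finset (Fin 3 → ℤ)} {b : Fin 3 → Fin 3 → ℤ}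
    (hσ : (σ : Set (Fin 3 → ℤ)) = Set.range b) (ε : ℤ) :
    (liftCone σ ε : Set (Fin 4 → ℤ)) = Set.range (liftVectors b ε) := by
  ext u
  simp only [liftCone, Finset.coe_insert, Finset.coe_image, hσ, liftVectors]
  constructor
  · rintro (rfl | ⟨_, ⟨j, rfl⟩, rfl⟩)
    · exact ⟨Fin.last 3, Fin.snoc_last (α := fun _ => Fin 4 → ℤ) _ _⟩
    · exact ⟨Fin.castSucc j, by simp⟩
  · rintro ⟨j, rfl⟩
    refine Fin.lastCases ?_ (fun j => ?_) j
    · exact Or.inl (Fin.snoc_last (α := fun _ => Fin 4 → ℤ) _ _)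
    · right; exact ⟨b j, ⟨j, rfl⟩, by simp⟩

/-- The same chart, for an equal subalgebra. -/
def DoubleChart.copy {R : Type} [CommRing R] [Algebra ℂ R] {A A' : Subalgebra ℂ R} {n : ℕ}
    (E : DoubleChart A n) (h : A = A') : DoubleChart A' n :=
  { E with mem_iff := fun r => h ▸ E.mem_iff r }

/-! ### Charts of the bundle -/

section LiftFrame

variable (b : Module.Basis (Fin 3) ℤ (Fin 3 → ℤ)) (ε : ℤ)

theorem pairing_liftVectors_castSucc (m : dualLattice (⊤ : AddSubgroup (Fin 3 → ℤ))) (d : ℤ)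
    (j : Fin 3) : pairing (liftExponent m d).1 (liftVectors b ε j.castSucc) =
      pairing m.1 (b j) - d / 2 := by
  have h : liftVectors b ε j.castSucc = ![b j 0, b j 1, b j 2, -1] :=
    Fin.snoc_castSucc (α := fun _ => Fin 4 → ℤ) _ _ _
  rw [h, pairing_liftExponent]
  push_cast
  ring

theorem pairing_liftVectors_last (m : dualLattice (⊤ : AddSubgroup (Fin 3 → ℤ))) (d : ℤ) :
    pairing (liftExponent m d).1 (liftVectors b ε (Fin.last 3)) = d * ε / 2 := by
  have h : liftVectors b ε (Fin.last 3) = ![0, 0, 0, ε] :=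
    Fin.snoc_last (α := fun _ => Fin 4 → ℤ) _ _
  rw [h, pairing_liftExponent_vertical]

theorem pairing_zsmul {n : ℕ} (k : ℤ) (m : Fin n → ℚ) (v : Fin n → ℤ) :
    pairing (k • m) v = k * pairing m v := by
  simp [pairing, Finset.mul_sum, mul_assoc]

theorem pairing_zsmul_exponent_one (c : ℤ) (j : Fin 3) :
    pairing (c • (basisFrame b).exponent 1).1 (b j) = c := by
  rw [AddSubgroup.coe_zsmul, pairing_zsmul, (basisFrame b).pairing_exponent]
  simp

/-- The exponents of the coordinates `x₁, x₂, x₃` and `(x₁ x₂ x₃ t²)^ε`. -/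
def liftFrameExponent : Fin 4 → dualLattice evenLattice :=
  Fin.snoc (fun j => liftExponent ((basisFrame b).w j) 0)
    (liftExponent (ε • (basisFrame b).exponent 1) (2 * ε))

theorem liftFrameExponent_castSucc (j : Fin 3) :
    liftFrameExponent b ε j.castSucc = liftExponent ((basisFrame b).w j) 0 :=
  Fin.snoc_castSucc (α := fun _ => dualLattice evenLattice) _ _ _

theorem liftFrameExponent_last : liftFrameExponent b ε (Fin.last 3) =
    liftExponent (ε • (basisFrame b).exponent 1) (2 * ε) :=
  Fin.snoc_last (α := fun _ => dualLattice evenLattice) _ _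

/-- The frame dual to the generators of a maximal cone of the bundle. -/
def liftFrame (hε : ε * ε = 1) : DualFrame evenLattice (liftVectors b ε) where
  w := liftFrameExponent b ε
  pairing_w i j := by
    have hε' : (ε : ℚ) * ε = 1 := by exact_mod_cast hε
    refine Fin.lastCases ?_ (fun i => ?_) i <;> refine Fin.lastCases ?_ (fun j => ?_) j
    · rw [liftFrameExponent_last, pairing_liftVectors_last, if_pos rfl]
      push_cast
      linarith
    · rw [liftFrameExponent_last, pairing_liftVectors_castSucc, pairing_zsmul_exponent_one,
        if_neg (Fin.castSucc_lt_last j).ne']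
      push_cast
      ring
    · rw [liftFrameExponent_castSucc, pairing_liftVectors_last, if_neg (Fin.castSucc_lt_last i).ne]
      simp
    · rw [liftFrameExponent_castSucc, pairing_liftVectors_castSucc, (basisFrame b).pairing_w]
      simp [Fin.castSucc_inj]
  eq_zero m hm := by
    have hε0 : (ε : ℚ) ≠ 0 := by
      rintro h
      rw [Int.cast_eq_zero.mp h] at hε
      exact absurd hε (by decide)
    have h3 : m 3 = 0 := by
      have h := hm (Fin.last 3)
      rw [show liftVectors b ε (Fin.last 3) = ![0, 0, 0, ε] from
        Fin.snoc_last (α := fun _ => Fin 4 → ℤ) _ _] at h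
      simp [pairing, Fin.sum_univ_four] at h
      exact h.resolve_right (by exact_mod_cast hε0)
    have h0 := (basisFrame b).eq_zero ![m 0, m 1, m 2] fun j => by
      have h := hm j.castSucc
      rw [show liftVectors b ε j.castSucc = ![b j 0, b j 1, b j 2, -1] from
        Fin.snoc_castSucc (α := fun _ => Fin 4 → ℤ) _ _ _] at h
      simpa [pairing, Fin.sum_univ_four, Fin.sum_univ_three, h3] using h
    ext i
    fin_cases i
    · exact congrFun h0 0
    · exact congrFun h0 1
    · exact congrFun h0 2
    · exact h3

/-- The coordinates on the chart of a maximal cone of the bundle. -/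
def liftChart {σ : Finset (Fin 3 → ℤ)} (hσ : (σ : Set (Fin 3 → ℤ)) = Set.range b) {ε : ℤ} (c : ℤ)
    (hε : ε * ε = 1) (hc : 2 * c = 1 + ε) :
    DoubleChart (coneAlgebra evenLattice (liftCone σ ε : Set (Fin 4 → ℤ))) 4 :=
  -- The square root is `(x₁x₂x₃)ᶜ tᵋ` with `c = (1 + ε) / 2`, that is `x₁x₂x₃t` near zero and `t⁻¹`
  -- near infinity. It pairs to `c - ε/2 = ½` with the lifted generators and to `ε²/2 = ½` with the
  -- vertical one.
  ((liftFrame b ε hε).doubleChart 0 (liftExponent (c • (basisFrame b).exponent 1) ε)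
    (by
      have hε' : (ε : ℚ) * ε = 1 := by exact_mod_cast hε
      have hc' : 2 * (c : ℚ) = 1 + ε := by exact_mod_cast hc
      intro j
      refine Fin.lastCases ?_ (fun j => ?_) j
      · rw [pairing_liftVectors_last, hε']
      · rw [pairing_liftVectors_castSucc, pairing_zsmul_exponent_one]
        linarith)
    (by
      intro m
      obtain ⟨m, d, rfl⟩ := liftExponent_surjective m
      have hodd : Odd ε := by
        rcases Int.even_or_odd ε with ⟨k, hk⟩ | h
        · omega
        · exact h
      -- The parity of the degree in `t` decides, simultaneously for all generators, whether the
      -- pairings are integers or half-integers.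
      rcases Int.even_or_odd' d with ⟨k, rfl | rfl⟩
      · left
        intro j
        refine Fin.lastCases ?_ (fun j => ?_) j
        · refine ⟨k * ε, ?_⟩
          rw [pairing_liftVectors_last]
          push_cast
          ring
        · obtain ⟨l, hl⟩ := pairing_top_int m (b j)
          refine ⟨l - k, ?_⟩
          rw [pairing_liftVectors_castSucc, hl]
          push_cast
          ring
      · right
        intro j
        refine Fin.lastCases ?_ (fun j => ?_) j
        · obtain ⟨e, he⟩ := hodd
          refine ⟨k * ε + e, ?_⟩
          rw [pairing_liftVectors_last, he]
          push_cast
          ring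
        · obtain ⟨l, hl⟩ := pairing_top_int m (b j)
          refine ⟨l - k - 1, ?_⟩
          rw [pairing_liftVectors_castSucc, hl]
          push_cast
          ring)).copy (by rw [liftCone_eq_range hσ])

end LiftFrame

/-! ### Simple normal crossing divisors are reduced -/

/-- The local ring at `(π)` has dimension at most one, so a product of distinct parameters is 1 or
the generator of the maximal ideal. If `π²` divided `H`, then `π` would be a multiple of `π²` in the
local ring, hence zero. -/
theorem IsSNC.not_mul_self_dvd {A : Type} [CommRing A] [IsDomain A] [IsNoetherianRing A] {H π : A}
    (hI : IsSNC (Ideal.span {H})) (hπ : Prime π) : ¬ π * π ∣ H := by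
  rintro ⟨c, rfl⟩
  let p : Ideal A := Ideal.span {π}
  have hp : p.IsPrime := (Ideal.span_singleton_prime hπ.ne_zero).mpr hπ
  obtain ⟨d, x, T, ⟨_, hdim, hspan⟩, hmap⟩ := hI p
  have hd : d ≤ 1 := by
    rw [IsLocalization.AtPrime.ringKrullDim_eq_height p] at hdim
    have h1 : p.height ≤ 1 := Ideal.height_le_one_of_isPrincipal_of_mem_minimalPrimes p p
      (by rw [Ideal.minimalPrimes_eq_subsingleton_self]; rfl)
    have h2 : (p.height : WithBot ℕ∞) ≤ 1 := by exact_mod_cast h1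
    rw [hdim] at h2
    exact_mod_cast h2
  have hle : IsLocalRing.maximalIdeal (Localization.AtPrime p) ≤
      Ideal.span {∏ j ∈ T, x j} := by
    rcases T.eq_empty_or_nonempty with rfl | ⟨j, hj⟩
    · simp
    · have hss : Subsingleton (Fin d) := Fin.subsingleton_iff_le_one.mpr hd
      have hT : T = {j} := by
        ext k
        simp [Subsingleton.elim k j, hj]
      have hx : Set.range x = {x j} := by
        ext y
        simp only [Set.mem_range, Set.mem_singleton_iff]
        exact ⟨fun ⟨k, hk⟩ => by rw [← hk, Subsingleton.elim k j], fun h => ⟨j, h.symm⟩⟩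
      rw [← hspan, hT, hx, Finset.prod_singleton]
  have hmem : algebraMap A (Localization.AtPrime p) π ∈
      IsLocalRing.maximalIdeal (Localization.AtPrime p) :=
    (IsLocalization.AtPrime.to_map_mem_maximal_iff _ p π).mpr (Ideal.mem_span_singleton_self π)
  have h1 := hle hmem
  rw [← hmap, Ideal.map_span, Set.image_singleton, Ideal.mem_span_singleton] at h1
  obtain ⟨e, he⟩ := h1
  have hunit : IsUnit (1 - algebraMap A (Localization.AtPrime p) π * (algebraMap A _ c * e)) := by
    refine IsLocalRing.isUnit_one_sub_self_of_mem_nonunits _ ?_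
    exact Ideal.mul_mem_right _ _ hmem
  have h0 : algebraMap A (Localization.AtPrime p) π *
      (1 - algebraMap A (Localization.AtPrime p) π * (algebraMap A _ c * e)) = 0 := by
    rw [map_mul, map_mul] at he
    linear_combination he
  have h2 : algebraMap A (Localization.AtPrime p) π = 0 := hunit.mul_left_eq_zero.mp h0
  exact hπ.ne_zero ((IsLocalization.injective (Localization.AtPrime p)
    p.primeCompl_le_nonZeroDivisors) (h2.trans (map_zero _).symm))

theorem IsSNC.squarefree {A : Type} [CommRing A] {n : ℕ} (e : MvPolynomial (Fin (n + 1)) ℂ ≃+* A)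
    {h : MvPolynomial (Fin (n + 1)) ℂ} (hI : IsSNC (Ideal.span {e h})) : Squarefree h := by
  have : IsDomain A := MulEquiv.isDomain _ e.symm.toMulEquiv
  have := isNoetherianRing_of_ringEquiv _ e
  rcases (irreducible_sq_not_dvd_iff_eq_zero_and_no_irreducibles_or_squarefree h).mp
    (fun π hπ hd => hI.not_mul_self_dvd (π := e π) ((MulEquiv.prime_iff e).mpr hπ.prime)
      (by rw [← map_mul]; exact map_dvd e hd)) with ⟨_, h0⟩ | h0
  -- The degenerate alternative, `h = 0` in a ring without irreducible elements, is excluded by the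
  -- variable `X 0`; hence the number of variables `n + 1`.
  · exact absurd (MvPolynomial.X_prime (i := 0)).irreducible (h0 _)
  · exact h0

/-! ### Charts of the double cover -/

theorem algebraMap_add_mul_root {T : Type} [CommRing T] {f : T} (p q c : T) :
    algebraMap T (QuadraticAlgebra T f 0) p + algebraMap T (QuadraticAlgebra T f 0) q * ⟨0, c⟩ =
      ⟨p, q * c⟩ := by
  ext <;> simp

theorem root_mul_root_eq {T : Type} [CommRing T] {f : T} (c d : T) :
    (⟨0, c⟩ * ⟨0, d⟩ : QuadraticAlgebra T f 0) = algebraMap T _ (c * (d * f)) := by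
  ext
  · simp; ring
  · simp

section CoverChart

variable (b : Module.Basis (Fin 3) ℤ (Fin 3 → ℤ))

/-- The characters that are non-negative on a lattice basis form the free monoid on the dual basis.
-/
theorem basisFrame_mem_iff (f : Laurent (⊤ : AddSubgroup (Fin 3 → ℤ))) :
    f ∈ coneAlgebra ⊤ (Set.range b) ↔
      ∃ p : MvPolynomial (Fin 3) ℂ, f = MvPolynomial.aeval (basisFrame b).x p := by
  constructor
  · intro hf
    refine (basisFrame b).eq_aeval_of_forall fun m hm => ?_
    exact (basisFrame b).exists_eq_exponent (fun j => pairing_top_int m (b j))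
      fun j => by simpa using hf m hm (b j) ⟨j, rfl⟩
  · rintro ⟨p, rfl⟩
    exact (basisFrame b).aeval_mem p

/-- The product of the coordinates. -/
def coordProd : Laurent (⊤ : AddSubgroup (Fin 3 → ℤ)) := monomial ((basisFrame b).exponent 1)

theorem coordProd_eq : coordProd b =
    MvPolynomial.aeval (basisFrame b).x (∏ j, MvPolynomial.X j : MvPolynomial (Fin 3) ℂ) := by
  rw [coordProd, (basisFrame b).monomial_exponent]
  simp

theorem coordProd_mem : coordProd b ∈ cutoff ⊤ (Set.range b) 1 := by
  refine single_mem_cutoff _ 1 ?_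
  rintro _ ⟨j, rfl⟩
  rw [(basisFrame b).pairing_exponent]
  simp

/-- The inverse of the product of the coordinates. -/
def coordProdInv : Laurent (⊤ : AddSubgroup (Fin 3 → ℤ)) :=
  monomial (-(basisFrame b).exponent 1)

theorem coordProdInv_mem : coordProdInv b ∈ cutoff ⊤ (Set.range b) (-1) := by
  refine single_mem_cutoff _ 1 ?_
  rintro _ ⟨j, rfl⟩
  rw [AddSubgroup.coe_neg, pairing_neg, (basisFrame b).pairing_exponent]
  simp

theorem coordProd_mul_inv : coordProd b * coordProdInv b = 1 := monomial_mul_neg _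

/-- An anticanonical section has at most simple poles along the coordinate hyperplanes, and the
product of the coordinates clears them. -/
theorem exists_equation {f : Laurent (⊤ : AddSubgroup (Fin 3 → ℤ))}
    (hf : f ∈ cutoff ⊤ (Set.range b) (-1)) :
    ∃ g : MvPolynomial (Fin 3) ℂ, coordProd b * f = MvPolynomial.aeval (basisFrame b).x g :=
  (basisFrame_mem_iff b _).mp (cutoff_mul (k := 1) (l := -1) (coordProd_mem b) hf)

/-- The polynomial ring as the coordinate ring of the chart of a maximal cone. -/
def baseEquiv : MvPolynomial (Fin 3) ℂ ≃+* coneAlgebra ⊤ (Set.range b) :=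
  RingEquiv.ofBijective
    ((MvPolynomial.aeval (basisFrame b).x).codRestrict _ (basisFrame b).aeval_mem)
    ⟨fun _ _ h => (basisFrame b).aeval_injective (congrArg Subtype.val h), fun a => by
      obtain ⟨p, hp⟩ := (basisFrame_mem_iff b _).mp a.2
      exact ⟨p, Subtype.ext hp.symm⟩⟩

theorem coe_baseEquiv (p : MvPolynomial (Fin 3) ℂ) :
    (baseEquiv b p : Laurent ⊤) = MvPolynomial.aeval (basisFrame b).x p := rfl

/-- The square of the product of the coordinates generates `𝒪(-2 ∑ D_ρ)` on this chart, so the ideal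
of `s₀s` is generated by this square times `f`. -/
theorem zeroIdeal_two_eq {f : Laurent (⊤ : AddSubgroup (Fin 3 → ℤ))}
    {g : MvPolynomial (Fin 3) ℂ}
    (hg : coordProd b * f = MvPolynomial.aeval (basisFrame b).x g) :
    zeroIdeal (Set.range b) 2 f =
      Ideal.span {baseEquiv b ((∏ j, MvPolynomial.X j) * g)} := by
  have hH : (baseEquiv b ((∏ j, MvPolynomial.X j) * g) : Laurent ⊤) =
      coordProd b * coordProd b * f := by
    rw [coe_baseEquiv, map_mul, ← hg, ← coordProd_eq, mul_assoc]
  apply le_antisymm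
  · refine Ideal.span_le.mpr ?_
    rintro a ⟨c, hc, ha⟩
    refine Ideal.mem_span_singleton.mpr
      ⟨⟨c * (coordProdInv b * coordProdInv b), ?_⟩, Subtype.ext ?_⟩
    · have := cutoff_mul hc (cutoff_mul (coordProdInv_mem b) (coordProdInv_mem b))
      exact this
    · rw [ha]
      change c * f = (baseEquiv b ((∏ j, MvPolynomial.X j) * g) : Laurent ⊤) * _
      rw [hH]
      linear_combination (-c * f * (1 + coordProd b * coordProdInv b)) * coordProd_mul_inv b
  · refine (Ideal.span_singleton_le_iff_mem _).mpr (Ideal.subset_span ⟨_, ?_, hH⟩)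
    exact cutoff_mul (k := 1) (l := 1) (coordProd_mem b) (coordProd_mem b)

/-- The coordinates on the chart of a maximal cone of the double cover. -/
def coverChart {V : Set (Fin 3 → ℤ)} (hV : V = Set.range b)
    {f : Laurent (⊤ : AddSubgroup (Fin 3 → ℤ))} (hf : f ∈ cutoff ⊤ V (-1))
    (hsnc : IsSNC (zeroIdeal V 2 f)) {g : MvPolynomial (Fin 3) ℂ}
    (hg : coordProd b * f = MvPolynomial.aeval (basisFrame b).x g) :
    DoubleChart (coverAlgebra hf) 3 where
  x := algebraMap _ _ ∘ (basisFrame b).x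
  w := ⟨0, coordProd b⟩
  h := (∏ j, MvPolynomial.X j) * g
  mul_self := by
    rw [MvPolynomial.aeval_algebraMap_apply, map_mul, ← hg, ← coordProd_eq]
    exact root_mul_root_eq _ _
  inj := by
    intro p q h
    rw [MvPolynomial.aeval_algebraMap_apply, MvPolynomial.aeval_algebraMap_apply,
      algebraMap_add_mul_root] at h
    have h1 : MvPolynomial.aeval (basisFrame b).x p = 0 := congrArg QuadraticAlgebra.re h
    have h2 : MvPolynomial.aeval (basisFrame b).x q * coordProd b = 0 :=
      congrArg QuadraticAlgebra.im h
    refine ⟨(basisFrame b).aeval_injective (by rw [h1, map_zero]),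
      (basisFrame b).aeval_injective ?_⟩
    rw [map_zero, ← mul_one (MvPolynomial.aeval _ q), ← coordProd_mul_inv b, ← mul_assoc, h2,
      zero_mul]
  mem_iff := by
    subst hV
    intro z
    constructor
    · rintro ⟨h1, h2⟩
      obtain ⟨p, hp⟩ := (basisFrame_mem_iff b _).mp h1
      -- A function vanishing on every coordinate hyperplane is a polynomial multiple of `x₁x₂x₃`,
      -- so the part in `L⁻¹` is a polynomial multiple of `w`.
      obtain ⟨q, hq⟩ := (basisFrame_mem_iff b _).mp (cutoff_mul h2 (coordProdInv_mem b))
      refine ⟨p, q, ?_⟩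
      rw [MvPolynomial.aeval_algebraMap_apply, MvPolynomial.aeval_algebraMap_apply, ← hp, ← hq,
        algebraMap_add_mul_root, mul_assoc, mul_comm (coordProdInv b), coordProd_mul_inv, mul_one]
    · rintro ⟨p, q, rfl⟩
      rw [MvPolynomial.aeval_algebraMap_apply, MvPolynomial.aeval_algebraMap_apply]
      refine Subalgebra.add_mem _ ⟨(basisFrame b).aeval_mem p, Submodule.zero_mem _⟩
        (Subalgebra.mul_mem _ ⟨(basisFrame b).aeval_mem q, Submodule.zero_mem _⟩
          ⟨Submodule.zero_mem _, coordProd_mem b⟩)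
  squarefree := by
    subst hV
    rw [zeroIdeal_two_eq b hg] at hsnc
    exact hsnc.squarefree
  not_isUnit := fun hu => (MvPolynomial.X_prime (i := (0 : Fin 3))).not_isUnit
    (isUnit_of_dvd_unit (Finset.dvd_prod_of_mem _ (Finset.mem_univ 0)) (isUnit_of_mul_isUnit_left hu))

end CoverChart

/-! ### The substitution `t² = s` -/

/-- The exponent of `x` in a character `x^m t^d`. -/
def baseExponent (m : dualLattice evenLattice) : dualLattice (⊤ : AddSubgroup (Fin 3 → ℤ)) :=
  (liftExponent_surjective m).choose

/-- The exponent of `t` in a character `x^m t^d`. -/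
def fiberDegree (m : dualLattice evenLattice) : ℤ := (liftExponent_surjective m).choose_spec.choose

theorem eq_liftExponent (m : dualLattice evenLattice) :
    m = liftExponent (baseExponent m) (fiberDegree m) :=
  (liftExponent_surjective m).choose_spec.choose_spec

theorem baseExponent_liftExponent (m : dualLattice (⊤ : AddSubgroup (Fin 3 → ℤ))) (d : ℤ) :
    baseExponent (liftExponent m d) = m :=
  (liftExponent_injective (eq_liftExponent (liftExponent m d))).1.symm

theorem fiberDegree_liftExponent (m : dualLattice (⊤ : AddSubgroup (Fin 3 → ℤ))) (d : ℤ) :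
    fiberDegree (liftExponent m d) = d :=
  (liftExponent_injective (eq_liftExponent (liftExponent m d))).2.symm

/-- The ray `(0, 0, 0, 1)`. -/
def verticalRay : Set (Fin 4 → ℤ) := {![0, 0, 0, 1]}

theorem mem_cutoff_verticalRay {f : Laurent evenLattice} (hf : f ∈ cutoff evenLattice verticalRay 0)
    {m : dualLattice evenLattice} (hm : m ∈ f.coeff.support) : 0 ≤ fiberDegree m := by
  have h := hf m hm _ rfl
  rw [eq_liftExponent m, pairing_liftExponent_vertical] at h
  have h' : (0 : ℚ) ≤ fiberDegree m := by
    push_cast at h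
    linarith
  exact_mod_cast h'

section Substitution

variable (f : Laurent (⊤ : AddSubgroup (Fin 3 → ℤ)))

/-- The image `x^m y^d` of the character `x^m t^d` for `d ≥ 0`. -/
def characterImage (m : dualLattice evenLattice) :
    QuadraticAlgebra (Laurent (⊤ : AddSubgroup (Fin 3 → ℤ))) f 0 :=
  algebraMap _ _ (monomial (baseExponent m)) * ⟨0, 1⟩ ^ (fiberDegree m).toNat

theorem root_pow_two_mul {T : Type} [CommRing T] (f : T) (k : ℕ) :
    (⟨0, 1⟩ ^ (2 * k) : QuadraticAlgebra T f 0) = algebraMap T _ (f ^ k) := by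
  rw [pow_mul, sq, root_mul_root_eq, one_mul, one_mul, map_pow]

theorem characterImage_even (m : dualLattice (⊤ : AddSubgroup (Fin 3 → ℤ))) (k : ℕ) :
    characterImage f (liftExponent m (2 * k)) = algebraMap _ _ (monomial m * f ^ k) := by
  rw [characterImage, baseExponent_liftExponent, fiberDegree_liftExponent,
    show (2 * (k : ℤ)).toNat = 2 * k by omega, root_pow_two_mul, map_mul]

theorem characterImage_odd (m : dualLattice (⊤ : AddSubgroup (Fin 3 → ℤ))) (k : ℕ) :
    characterImage f (liftExponent m (2 * k + 1)) = ⟨0, monomial m * f ^ k⟩ := by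
  rw [characterImage, baseExponent_liftExponent, fiberDegree_liftExponent,
    show (2 * (k : ℤ) + 1).toNat = 2 * k + 1 by omega, pow_succ, root_pow_two_mul, ← mul_assoc,
    ← map_mul]
  have h := algebraMap_add_mul_root (f := f) 0 (monomial m * f ^ k) 1
  rwa [map_zero, zero_add, mul_one] at h

theorem characterImage_add {m n : dualLattice evenLattice} (hm : 0 ≤ fiberDegree m)
    (hn : 0 ≤ fiberDegree n) :
    characterImage f (m + n) = characterImage f m * characterImage f n := by
  have h : m + n = liftExponent (baseExponent m + baseExponent n)
      (fiberDegree m + fiberDegree n) := by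
    rw [← liftExponent_add, ← eq_liftExponent, ← eq_liftExponent]
  rw [characterImage, characterImage, characterImage, h, baseExponent_liftExponent,
    fiberDegree_liftExponent, Int.toNat_add hm hn, pow_add, ← monomial_mul, map_mul]
  ring

/-- The linear map with `x^m t^d ↦ x^m y^d` for `d ≥ 0`. -/
def substitution : Laurent evenLattice →ₗ[ℂ]
    QuadraticAlgebra (Laurent (⊤ : AddSubgroup (Fin 3 → ℤ))) f 0 :=
  (Finsupp.linearCombination ℂ (characterImage f)).comp
    (AddMonoidAlgebra.coeffLinearEquiv ℂ).toLinearMap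

theorem substitution_single (m : dualLattice evenLattice) (c : ℂ) :
    substitution f (AddMonoidAlgebra.single m c) = c • characterImage f m := by
  change Finsupp.linearCombination ℂ (characterImage f) (Finsupp.single m c) = _
  rw [Finsupp.linearCombination_single]

theorem substitution_monomial (m : dualLattice evenLattice) :
    substitution f (monomial m) = characterImage f m := by
  rw [monomial, substitution_single, one_smul]

theorem substitution_eq_sum (g : Laurent evenLattice) :
    substitution f g = ∑ m ∈ g.coeff.support, g.coeff m • characterImage f m := rfl

/-- The substitution is linear everywhere but multiplicative only where `t` has no negative
exponents, since `toNat` truncates those. -/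
theorem substitution_mul {g g' : Laurent evenLattice}
    (hg : g ∈ cutoff evenLattice verticalRay 0) (hg' : g' ∈ cutoff evenLattice verticalRay 0) :
    substitution f (g * g') = substitution f g * substitution f g' := by
  rw [AddMonoidAlgebra.mul_def, substitution_eq_sum f g, substitution_eq_sum f g',
    Finset.sum_mul_sum]
  simp only [Finsupp.sum, map_sum]
  refine Finset.sum_congr rfl fun m hm => Finset.sum_congr rfl fun n hn => ?_
  rw [substitution_single, characterImage_add f (mem_cutoff_verticalRay hg hm)
    (mem_cutoff_verticalRay hg' hn), smul_mul_smul_comm]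

theorem substitution_one : substitution f 1 = 1 := by
  have h0 : (0 : dualLattice evenLattice) = liftExponent 0 (2 * (0 : ℕ)) := by
    apply Subtype.ext
    ext i
    fin_cases i <;> simp [liftExponent]
  rw [← monomial_zero, substitution_monomial, h0, characterImage_even]
  simp [monomial_zero]

variable {f}

theorem cutoff_pow {n : ℕ} {Λ : AddSubgroup (Fin n → ℤ)} {V : Set (Fin n → ℤ)} {g : Laurent Λ}
    (hg : g ∈ cutoff Λ V (-1)) (k : ℕ) : g ^ k ∈ cutoff Λ V (-k) := by
  induction k with
  | zero =>
    simp only [pow_zero, Nat.cast_zero, neg_zero]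
    exact (coneAlgebra Λ V).one_mem
  | succ k ih =>
    rw [pow_succ]
    push_cast
    rw [neg_add]
    exact cutoff_mul ih hg

/-- Membership in the dual of `τ₀` for `x^m t^d` means `d ≥ 0` and order at least `d/2` of `x^m`
along each divisor. This order compensates the poles of the power of `f` in `y^d`. -/
theorem characterImage_mem {σ : Finset (Fin 3 → ℤ)} (hf : f ∈ cutoff ⊤ (σ : Set (Fin 3 → ℤ)) (-1))
    {m : dualLattice evenLattice}
    (hm : ∀ v ∈ liftCone σ 1, 0 ≤ pairing m.1 v) : characterImage f m ∈ coverAlgebra hf := by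
  obtain ⟨m, d, rfl⟩ := liftExponent_surjective m
  have hd : 0 ≤ d := by
    have h := hm ![0, 0, 0, 1] (Finset.mem_insert_self _ _)
    rw [pairing_liftExponent_vertical] at h
    have h' : (0 : ℚ) ≤ d := by push_cast at h; linarith
    exact_mod_cast h'
  have hη : ∀ η ∈ σ, (d : ℚ) / 2 ≤ pairing m.1 η := fun η hη => by
    have h := hm ![η 0, η 1, η 2, -1]
      (Finset.mem_insert_of_mem (Finset.mem_image_of_mem (fun η => ![η 0, η 1, η 2, -1]) hη))
    rw [pairing_liftExponent] at h
    push_cast at h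
    linarith
  obtain ⟨d, rfl⟩ := Int.eq_ofNat_of_zero_le hd
  obtain ⟨k, rfl | rfl⟩ := Nat.even_or_odd' d
  · push_cast
    rw [characterImage_even]
    refine ⟨?_, Submodule.zero_mem _⟩
    have h1 : monomial m ∈ cutoff ⊤ (σ : Set (Fin 3 → ℤ)) k := by
      refine single_mem_cutoff m 1 fun η hη' => ?_
      have := hη η hη'
      push_cast at this ⊢
      linarith
    have h2 := cutoff_mul h1 (cutoff_pow hf k)
    rwa [add_neg_cancel] at h2
  · push_cast
    rw [characterImage_odd]
    refine ⟨Submodule.zero_mem _, ?_⟩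
    -- For odd degree `2k + 1` the pairing is an integer and at least `k + ½`, hence at least `k +
    -- 1`; the extra order puts the imaginary part into `L⁻¹`.
    have h1 : monomial m ∈ cutoff ⊤ (σ : Set (Fin 3 → ℤ)) (k + 1) := by
      refine single_mem_cutoff m 1 fun η hη' => ?_
      have h := hη η hη'
      obtain ⟨l, hl⟩ := pairing_top_int m η
      rw [hl] at h ⊢
      push_cast at h
      have h3 : (k : ℚ) < l := by linarith
      have h4 : (k : ℤ) < l := by exact_mod_cast h3
      exact_mod_cast Int.add_one_le_of_lt h4
    have h2 := cutoff_mul h1 (cutoff_pow hf k)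
    rwa [show (k : ℤ) + 1 + -k = 1 by ring] at h2

theorem mem_cutoff_of_liftCone {σ : Finset (Fin 3 → ℤ)} {g : Laurent evenLattice}
    (hg : g ∈ coneAlgebra evenLattice (liftCone σ 1 : Set (Fin 4 → ℤ))) :
    g ∈ cutoff evenLattice verticalRay 0 :=
  cutoff_anti (Set.singleton_subset_iff.mpr
    (Finset.mem_coe.mpr (Finset.mem_insert_self _ _))) 0 hg

theorem substitution_mem {σ : Finset (Fin 3 → ℤ)} (hf : f ∈ cutoff ⊤ (σ : Set (Fin 3 → ℤ)) (-1))
    {g : Laurent evenLattice}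
    (hg : g ∈ coneAlgebra evenLattice (liftCone σ 1 : Set (Fin 4 → ℤ))) :
    substitution f g ∈ coverAlgebra hf := by
  rw [substitution_eq_sum]
  refine Subalgebra.sum_mem _ fun m hm => Subalgebra.smul_mem _ (characterImage_mem hf fun v hv => ?_) _
  simpa using hg m hm v hv

/-- The homomorphism of coordinate rings given by `t² = s`. -/
def chartHom {σ : Finset (Fin 3 → ℤ)} (hf : f ∈ cutoff ⊤ (σ : Set (Fin 3 → ℤ)) (-1)) :
    coneAlgebra evenLattice (liftCone σ 1 : Set (Fin 4 → ℤ)) →ₐ[ℂ] coverAlgebra hf :=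
  AlgHom.ofLinearMap
    (((substitution f).comp (coneAlgebra evenLattice
      (liftCone σ 1 : Set (Fin 4 → ℤ))).val.toLinearMap).codRestrict
      (Subalgebra.toSubmodule (coverAlgebra hf)) fun g => substitution_mem hf g.2)
    (Subtype.ext (substitution_one f))
    fun g g' => Subtype.ext (substitution_mul f (mem_cutoff_of_liftCone g.2)
      (mem_cutoff_of_liftCone g'.2))

theorem coe_chartHom {σ : Finset (Fin 3 → ℤ)} (hf : f ∈ cutoff ⊤ (σ : Set (Fin 3 → ℤ)) (-1))
    (g : coneAlgebra evenLattice (liftCone σ 1 : Set (Fin 4 → ℤ))) :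
    (chartHom hf g : QuadraticAlgebra (Laurent (⊤ : AddSubgroup (Fin 3 → ℤ))) f 0) =
      substitution f g := rfl

end Substitution

/-! ### The embedding of the double cover -/

theorem comp_comp_eq {C : Type*} [Category C] {X Y Z W : C} {a : X ⟶ Y} {b : Y ⟶ Z} {c : X ⟶ Z}
    {d : Z ⟶ W} {e : X ⟶ W} (h : a ≫ b = c) (h' : c ≫ d = e) : a ≫ b ≫ d = e := by
  rw [← Category.assoc, h, h']

namespace ChartSystem

variable {J J' : Type} [PartialOrder J] [PartialOrder J'] {R R' : Type} [CommRing R] [CommRing R']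
  [Algebra ℂ R] [Algebra ℂ R'] (C : ChartSystem J R) (C' : ChartSystem J' R') (κ : J → J')
  (hκ : ∀ {i j}, i ≤ j → κ i ≤ κ j) (φ : ∀ j, C'.A (κ j) →+* C.A j)
  (hφ : ∀ {i j} (h : i ≤ j) (a : C'.A (κ j)), Subalgebra.inclusion (C.anti h) (φ j a) =
    φ i (Subalgebra.inclusion (C'.anti (hκ h)) a))

/-- The morphism glued from homomorphisms of the coordinate rings of the charts. -/
def glue : C.scheme ⟶ C'.scheme :=
  colimit.desc C.diagram
    { pt := C'.scheme
      ι :=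
        { app := fun j => Spec.map (CommRingCat.ofHom (φ j)) ≫ C'.ι (κ j)
          naturality := fun i j h => by
            refine Eq.trans ?_ (Category.comp_id _).symm
            have h1 : CommRingCat.ofHom (φ j) ≫
                CommRingCat.ofHom (Subalgebra.inclusion (C.anti h.le)).toRingHom =
                CommRingCat.ofHom (Subalgebra.inclusion (C'.anti (hκ h.le))).toRingHom ≫
                CommRingCat.ofHom (φ i) := by
              ext a
              exact congrArg Subtype.val (hφ h.le a)
            have h2 : Spec.map (CommRingCat.ofHom (Subalgebra.inclusion (C.anti h.le)).toRingHom) ≫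
                Spec.map (CommRingCat.ofHom (φ j)) ≫ C'.ι (κ j) =
                Spec.map (CommRingCat.ofHom (φ i)) ≫ C'.ι (κ i) := by
              rw [C'.map_ι (hκ h.le), ← Category.assoc, ← Category.assoc, ← Spec.map_comp,
                ← Spec.map_comp, h1]
            exact h2 } }

theorem ι_glue (j : J) : C.ι j ≫ C.glue C' κ hκ φ hφ =
    Spec.map (CommRingCat.ofHom (φ j)) ≫ C'.ι (κ j) :=
  colimit.ι_desc _ _

end ChartSystem

theorem liftCone_mono {τ σ : Finset (Fin 3 → ℤ)} (h : τ ⊆ σ) (ε : ℤ) :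
    liftCone τ ε ⊆ liftCone σ ε :=
  Finset.insert_subset_insert _ (Finset.image_subset_image h)

section Embedding

variable (S : ConeComplex 3) (s : anticanonicalSections S)

/-- The cone `τ₀`. -/
def zeroCone (σ : S.cones) : (bundleFan S).cones :=
  ⟨liftCone σ.1 1, σ.1, σ.2, 1, Or.inl rfl, Finset.Subset.rfl⟩

/-- The cone `τ_∞`. -/
def inftyCone (σ : S.cones) : (bundleFan S).cones :=
  ⟨liftCone σ.1 (-1), σ.1, σ.2, -1, Or.inr rfl, Finset.Subset.rfl⟩

theorem zeroCone_mono {τ σ : S.cones} (h : τ ≤ σ) : zeroCone S τ ≤ zeroCone S σ :=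
  liftCone_mono h 1

theorem section_mem (σ : S.cones) : s.1 ∈ cutoff ⊤ (σ.1 : Set (Fin 3 → ℤ)) (-1) :=
  cutoff_anti (S.subset_rays σ.2) (-1) s.2

/-- The homomorphism of coordinate rings of the charts of `σ`. -/
def embeddingHom (σ : S.cones) :
    (toricCharts (bundleFan S) evenLattice).A (zeroCone S σ) →+* (coverCharts S s).A σ :=
  (chartHom (section_mem S s σ)).toRingHom

theorem coe_embeddingHom (σ : S.cones)
    (g : (toricCharts (bundleFan S) evenLattice).A (zeroCone S σ)) :
    (embeddingHom S s σ g : QuadraticAlgebra (Laurent (⊤ : AddSubgroup (Fin 3 → ℤ))) s.1 0) =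
      substitution s.1 g := rfl

/-- The morphism from the double cover to the bundle given by `t² = s`. -/
def embedding : (coverCharts S s).scheme ⟶ (toricCharts (bundleFan S) evenLattice).scheme :=
  (coverCharts S s).glue (toricCharts (bundleFan S) evenLattice) (zeroCone S)
    (zeroCone_mono S) (embeddingHom S s) fun _ _ => rfl

theorem ι_embedding (σ : S.cones) : (coverCharts S s).ι σ ≫ embedding S s =
    Spec.map (CommRingCat.ofHom (embeddingHom S s σ)) ≫
      (toricCharts (bundleFan S) evenLattice).ι (zeroCone S σ) :=
  (coverCharts S s).ι_glue _ _ _ _ (fun _ _ => rfl) σ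

theorem embeddingHom_comp_algebraMap (σ : S.cones) :
    (embeddingHom S s σ).comp (algebraMap ℂ _) = algebraMap ℂ ((coverCharts S s).A σ) :=
  (chartHom (section_mem S s σ)).comp_algebraMap

theorem ι_embedding_structureMap (σ : S.cones) : (coverCharts S s).ι σ ≫ embedding S s ≫
      (toricCharts (bundleFan S) evenLattice).structureMap =
      Spec.map (CommRingCat.ofHom (algebraMap ℂ ((coverCharts S s).A σ))) := by
  rw [← Category.assoc, ι_embedding, Category.assoc, ChartSystem.ι_structureMap, ← Spec.map_comp,
    ← CommRingCat.ofHom_comp, embeddingHom_comp_algebraMap]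

theorem embedding_structureMap : embedding S s ≫
    (toricCharts (bundleFan S) evenLattice).structureMap = doubleCover.toSpec S s := by
  refine colimit.hom_ext fun σ => (ι_embedding_structureMap S s σ).trans ?_
  have hι : colimit.ι (coverCharts S s).diagram σ ≫ doubleCover.map S s = _ := ι_colimMap _ _
  refine (comp_comp_eq hι ?_).symm
  refine (Category.assoc _ _ _).trans ?_
  refine (congrArg _ ((toricCharts S ⊤).ι_structureMap σ)).trans ?_
  exact (Spec.map_comp _ _).symm

end Embedding

/-- Being a closed immersion is local on the target. Over an open set missed by `i` the source is
empty; over a chart whose preimage is a chart, `i` is given by a surjection of rings. -/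
theorem isClosedImmersion_of_charts {X Y : Scheme.{0}} (i : Y ⟶ X)
    (h : ∀ x : X, (∃ U : X.Opens, x ∈ U ∧ ∀ y, i y ∉ U) ∨
      ∃ (A B : Type) (_ : CommRing A) (_ : CommRing B) (j : Spec (.of A) ⟶ X)
        (j' : Spec (.of B) ⟶ Y) (_ : IsOpenImmersion j) (_ : IsOpenImmersion j') (φ : A →+* B),
        Function.Surjective φ ∧ x ∈ j.opensRange ∧
        j' ≫ i = Spec.map (CommRingCat.ofHom φ) ≫ j ∧
        ∀ y, i y ∈ j.opensRange → y ∈ j'.opensRange) : IsClosedImmersion i := by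
  have key : ∀ x : X, ∃ U : X.Opens, x ∈ U ∧ IsClosedImmersion (i ∣_ U) := by
    intro x
    rcases h x with ⟨U, hx, hU⟩ | ⟨A, B, _, _, j, j', _, _, φ, hφ, hx, e, hpre⟩
    · refine ⟨U, hx, ?_⟩
      have : IsEmpty (i ⁻¹ᵁ U : Scheme) := ⟨fun y => hU _ y.2⟩
      infer_instance
    · refine ⟨j.opensRange, hx, ?_⟩
      have : IsClosedImmersion (Spec.map (CommRingCat.ofHom φ)) :=
        IsClosedImmersion.spec_of_surjective _ hφ
      -- The hypothesis `hpre` says that `j'` is the full preimage of `j`, so the square is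
      -- cartesian.
      have hpb : IsPullback (Spec.map (CommRingCat.ofHom φ) ≫ j.isoOpensRange.hom) j'
          j.opensRange.ι i := by
        refine IsOpenImmersion.isPullback _ _ _ _ ?_ ?_
        · rw [Category.assoc, Scheme.Hom.isoOpensRange_hom_ι, e]
        · rw [Scheme.Opens.opensRange_ι]
          apply le_antisymm
          · exact fun y hy => hpre y hy
          · exact chart_le_preimage e
      have h1 := IsPullback.isoIsPullback_hom_fst _ _ (isPullback_morphismRestrict i j.opensRange)
        hpb
      rw [← h1]
      infer_instance
  choose U hU hcl using key
  exact IsZariskiLocalAtTarget.of_iSup_eq_top U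
    (top_unique fun x _ => TopologicalSpace.Opens.mem_iSup.mpr ⟨x, hU x⟩) hcl

/-! ### Localization of charts by face characters -/

theorem toricCharts_mem_opensRange {n : ℕ} {S : ConeComplex n} {Λ : AddSubgroup (Fin n → ℤ)}
    {τ σ : S.cones} (hle : τ ≤ σ) (m : dualLattice Λ)
    (h0 : ∀ v ∈ σ.1, v ∈ τ.1 → pairing m.1 v = 0) (h1 : ∀ v ∈ σ.1, v ∉ τ.1 → 0 < pairing m.1 v)
    (p : Spec (.of ((toricCharts S Λ).A σ)))
    (hp : (⟨monomial m, monomial_mem h0 h1⟩ : (toricCharts S Λ).A σ) ∉ pointIdeal p) :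
    (toricCharts S Λ).ι σ p ∈ ((toricCharts S Λ).ι τ).opensRange := by
  refine (toricCharts S Λ).ι_mem_opensRange hle ⟨monomial m, monomial_mem h0 h1⟩
    ⟨monomial (-m), monomial_neg_mem h0 hle, monomial_mul_neg m⟩ (fun a ha => ?_) p hp
  obtain ⟨N, hN⟩ := exists_mul_monomial_mem m h0 h1 ha
  exact ⟨N, hN N le_rfl⟩

theorem coverCharts_mem_opensRange {n : ℕ} {S : ConeComplex n} {s : anticanonicalSections S}
    {τ σ : S.cones} (hle : τ ≤ σ) (m : dualLattice (⊤ : AddSubgroup (Fin n → ℤ)))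
    (h0 : ∀ v ∈ σ.1, v ∈ τ.1 → pairing m.1 v = 0) (h1 : ∀ v ∈ σ.1, v ∉ τ.1 → 0 < pairing m.1 v)
    (p : Spec (.of ((coverCharts S s).A σ)))
    (hp : (⟨algebraMap _ _ (monomial m), monomial_mem h0 h1, Submodule.zero_mem _⟩ :
      (coverCharts S s).A σ) ∉ pointIdeal p) :
    (coverCharts S s).ι σ p ∈ ((coverCharts S s).ι τ).opensRange := by
  refine (coverCharts S s).ι_mem_opensRange hle _
    ⟨algebraMap _ _ (monomial (-m)), ⟨monomial_neg_mem h0 hle, Submodule.zero_mem _⟩, ?_⟩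
    (fun z hz => ?_) p hp
  · rw [← map_mul, monomial_mul_neg, map_one]
  · obtain ⟨N, hN⟩ := exists_mul_monomial_mem m h0 h1 hz.1
    obtain ⟨N', hN'⟩ := exists_mul_monomial_mem m h0 h1 hz.2
    refine ⟨max N N', ?_, ?_⟩
    · rw [← map_pow]
      simpa [-map_pow] using hN _ (le_max_left N N')
    · rw [← map_pow]
      simpa [-map_pow] using hN' _ (le_max_right N N')

theorem notMem_of_mul_eq_one {A : Type} [CommRing A] {q : Ideal A} [hq : q.IsPrime] {u v : A}
    (h : u * v = 1) : u ∉ q := fun hu => hq.ne_top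
  ((Ideal.eq_top_iff_one _).mpr (h ▸ Ideal.mul_mem_right v _ hu))

theorem mem_liftCone {τ : Finset (Fin 3 → ℤ)} {ε : ℤ} {v : Fin 4 → ℤ} :
    v ∈ liftCone τ ε ↔ v = ![0, 0, 0, ε] ∨ ∃ η ∈ τ, ![η 0, η 1, η 2, -1] = v := by
  simp [liftCone]

theorem lift_injective {η η' : Fin 3 → ℤ}
    (h : (![η 0, η 1, η 2, -1] : Fin 4 → ℤ) = ![η' 0, η' 1, η' 2, -1]) : η = η' := by
  ext i
  fin_cases i
  · exact congrFun h 0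
  · exact congrFun h 1
  · exact congrFun h 2

section Embedding

variable (S : ConeComplex 3) (s : anticanonicalSections S)

theorem pointIdeal_map {A B : Type} [CommRing A] [CommRing B] (φ : A →+* B)
    (p : Spec (.of B)) : pointIdeal (Spec.map (CommRingCat.ofHom φ) p) = (pointIdeal p).comap φ :=
  rfl

theorem embedding_ι (σ : S.cones) (p : Spec (.of ((coverCharts S s).A σ))) :
    embedding S s ((coverCharts S s).ι σ p) =
      (toricCharts (bundleFan S) evenLattice).ι (zeroCone S σ)
        (Spec.map (CommRingCat.ofHom (embeddingHom S s σ)) p) := by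
  rw [← Scheme.Hom.comp_apply, ι_embedding, Scheme.Hom.comp_apply]

/-- The preimage of the chart of `σ₀` is the chart of `σ`. A point of the chart of `τ` that is
mapped into the chart of `σ₀` is mapped into the chart of a common face of `τ₀` and `σ₀`. There the
character of the base cutting out `τ ∩ σ` in `τ` is invertible, so the point lies in the chart of `τ
∩ σ`. -/
theorem mem_opensRange_of_embedding (σ : S.cones) (y : (coverCharts S s).scheme)
    (hy : embedding S s y ∈
      ((toricCharts (bundleFan S) evenLattice).ι (zeroCone S σ)).opensRange) :
    y ∈ ((coverCharts S s).ι σ).opensRange := by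
  classical
  obtain ⟨τ, p, rfl⟩ := (coverCharts S s).exists_ι_eq y
  obtain ⟨q, hq⟩ := hy
  rw [embedding_ι] at hq
  obtain ⟨k, hkσ, hkτ, r, -, hr⟩ := (toricCharts (bundleFan S) evenLattice).ι_eq_ι hq
  let ρ : S.cones := ⟨τ.1 ∩ σ.1, S.down_closed τ.2 Finset.inter_subset_left⟩
  have hρτ : ρ ≤ τ := Finset.inter_subset_left
  have hρσ : ρ ≤ σ := Finset.inter_subset_right
  refine (coverCharts S s).opensRange_le hρσ ?_
  obtain ⟨m, h0, h1⟩ := exists_face_character ⊤ (S.linearIndependent τ.2) ρ.1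
  refine coverCharts_mem_opensRange hρτ m h0 h1 p fun hmem => ?_
  have hnn : ∀ η ∈ τ.1, 0 ≤ pairing m.1 η := fun η hη => by
    by_cases h : η ∈ ρ.1
    · exact (h0 η hη h).ge
    · exact (h1 η hη h).le
  have hχ : monomial (liftExponent m (2 * (0 : ℕ))) ∈
      (toricCharts (bundleFan S) evenLattice).A (zeroCone S τ) := by
    refine single_mem_cutoff _ 1 fun v hv => ?_
    rcases mem_liftCone.mp hv with rfl | ⟨η, hη, rfl⟩
    · rw [pairing_liftExponent_vertical]
      simp
    · rw [pairing_liftExponent]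
      simpa using hnn η hη
  -- A generator of the common face `k` is vertical or the lift of some `η ∈ τ ∩ σ`; the lifted
  -- character vanishes on both kinds.
  have hχ' : monomial (-liftExponent m (2 * (0 : ℕ))) ∈
      (toricCharts (bundleFan S) evenLattice).A k := by
    refine single_mem_cutoff _ 1 fun v hv => ?_
    rw [AddSubgroup.coe_neg, pairing_neg]
    rcases mem_liftCone.mp (hkτ hv) with rfl | ⟨η, hη, rfl⟩
    · rw [pairing_liftExponent_vertical]
      simp
    · rw [pairing_liftExponent]
      have hησ : η ∈ σ.1 := by
        rcases mem_liftCone.mp (hkσ hv) with h | ⟨η', hη', h⟩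
        · exact absurd (show (-1 : ℤ) = 1 from congrFun h 3) (by decide)
        · rwa [← lift_injective h]
      rw [h0 η hη (Finset.mem_inter.mpr ⟨hη, hησ⟩)]
      simp
  have h2 : (⟨_, hχ⟩ : (toricCharts (bundleFan S) evenLattice).A (zeroCone S τ)) ∈
      pointIdeal (Spec.map (CommRingCat.ofHom (embeddingHom S s τ)) p) := by
    rw [pointIdeal_map, Ideal.mem_comap]
    convert hmem using 1
    apply Subtype.ext
    rw [coe_embeddingHom, substitution_monomial, characterImage_even, pow_zero, mul_one]
  rw [hr, Ideal.mem_comap] at h2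
  have hunit : (⟨_, (toricCharts (bundleFan S) evenLattice).anti hkτ hχ⟩ :
      (toricCharts (bundleFan S) evenLattice).A k) ∉ pointIdeal r :=
    notMem_of_mul_eq_one (v := ⟨_, hχ'⟩) (Subtype.ext (monomial_mul_neg _))
  exact hunit h2

/-! ### The part of the bundle near infinity -/

/-- The inclusion of the functions on the base. -/
def liftLaurent : Laurent (⊤ : AddSubgroup (Fin 3 → ℤ)) →ₐ[ℂ] Laurent evenLattice :=
  AddMonoidAlgebra.mapDomainAlgHom ℂ ℂ
    (AddMonoidHom.mk' (fun m => liftExponent m 0) fun m m' => by rw [liftExponent_add, add_zero])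

theorem liftLaurent_single (m : dualLattice (⊤ : AddSubgroup (Fin 3 → ℤ))) (c : ℂ) :
    liftLaurent (AddMonoidAlgebra.single m c) = AddMonoidAlgebra.single (liftExponent m 0) c :=
  AddMonoidAlgebra.mapDomain_single

theorem liftLaurent_monomial (m : dualLattice (⊤ : AddSubgroup (Fin 3 → ℤ))) :
    liftLaurent (monomial m) = monomial (liftExponent m 0) := liftLaurent_single m 1

theorem exists_of_mem_support_liftLaurent {f : Laurent (⊤ : AddSubgroup (Fin 3 → ℤ))}
    {m : dualLattice evenLattice} (hm : m ∈ (liftLaurent f).coeff.support) :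
    ∃ m' ∈ f.coeff.support, m = liftExponent m' 0 := by
  classical
  obtain ⟨m', h, rfl⟩ := Finset.mem_image.mp (Finsupp.mapDomain_support hm)
  exact ⟨m', h, rfl⟩

theorem substitution_liftLaurent (f g : Laurent (⊤ : AddSubgroup (Fin 3 → ℤ))) :
    substitution f (liftLaurent g) = algebraMap _ _ g := by
  induction g using AddMonoidAlgebra.induction_linear with
  | zero => simp
  | add g g' hg hg' => rw [map_add, map_add, map_add, hg, hg']
  | single m c =>
    rw [liftLaurent_single, substitution_single]
    have h := characterImage_even f m 0
    rw [Nat.cast_zero, mul_zero] at h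
    rw [h, pow_zero, mul_one, ← algebraMap_smul (Laurent (⊤ : AddSubgroup (Fin 3 → ℤ))) c,
      Algebra.smul_def, ← map_mul, ← Algebra.smul_def]
    simp [monomial]

/-- The coordinate `t^d`. -/
def fiberPower (d : ℤ) : Laurent evenLattice := monomial (liftExponent 0 d)

theorem fiberPower_add (d e : ℤ) : fiberPower d * fiberPower e = fiberPower (d + e) := by
  rw [fiberPower, fiberPower, fiberPower, monomial_mul, liftExponent_add, add_zero]

theorem fiberPower_zero : fiberPower 0 = 1 := by
  have := liftLaurent_monomial 0
  rw [monomial_zero, map_one] at this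
  exact this.symm

theorem monomial_liftExponent (m : dualLattice (⊤ : AddSubgroup (Fin 3 → ℤ))) (d : ℤ) :
    monomial (liftExponent m d) = liftLaurent (monomial m) * fiberPower d := by
  rw [liftLaurent_monomial, fiberPower, monomial_mul, liftExponent_add, add_zero, zero_add]

/-- The equation `1 - s t⁻²` of the double cover in the charts at infinity. -/
def inftyEquation (f : Laurent (⊤ : AddSubgroup (Fin 3 → ℤ))) : Laurent evenLattice :=
  1 - liftLaurent f * fiberPower (-2)

theorem fiberPower_mul_inftyEquation (f : Laurent (⊤ : AddSubgroup (Fin 3 → ℤ))) :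
    fiberPower 2 * inftyEquation f = fiberPower 2 - liftLaurent f := by
  rw [inftyEquation, mul_sub, mul_one, mul_left_comm, fiberPower_add, add_neg_cancel,
    fiberPower_zero, mul_one]

/-- The simple poles of `f` are cancelled by `t⁻²`, which pairs to 1 with each `(η, -1)`. -/
theorem liftLaurent_mul_mem {f : Laurent (⊤ : AddSubgroup (Fin 3 → ℤ))} {σ : Finset (Fin 3 → ℤ)}
    (hf : f ∈ cutoff ⊤ (σ : Set (Fin 3 → ℤ)) (-1)) :
    liftLaurent f * fiberPower (-2) ∈
      coneAlgebra evenLattice (liftCone σ (-1) : Set (Fin 4 → ℤ)) := by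
  classical
  intro m hm v hv
  obtain ⟨a, ha, c, hc, rfl⟩ :=
    Finset.mem_add.mp (AddMonoidAlgebra.support_coeff_mul_subset _ _ hm)
  obtain ⟨a, ha', rfl⟩ := exists_of_mem_support_liftLaurent ha
  have hc' : c = liftExponent 0 (-2) := by simpa using Finsupp.support_single_subset hc
  rw [hc', liftExponent_add, add_zero, zero_add]
  rcases mem_liftCone.mp hv with rfl | ⟨η, hη, rfl⟩
  · rw [pairing_liftExponent_vertical]
    norm_num
  · rw [pairing_liftExponent]
    have := hf a ha' η hη
    push_cast at this ⊢
    linarith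

theorem inftyEquation_mem {f : Laurent (⊤ : AddSubgroup (Fin 3 → ℤ))} {σ : Finset (Fin 3 → ℤ)}
    (hf : f ∈ cutoff ⊤ (σ : Set (Fin 3 → ℤ)) (-1)) :
    inftyEquation f ∈ coneAlgebra evenLattice (liftCone σ (-1) : Set (Fin 4 → ℤ)) :=
  Subalgebra.sub_mem _ (Subalgebra.one_mem _) (liftLaurent_mul_mem hf)

theorem liftLaurent_mem_verticalRay (f : Laurent (⊤ : AddSubgroup (Fin 3 → ℤ))) :
    liftLaurent f ∈ cutoff evenLattice verticalRay 0 := by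
  rintro m hm _ rfl
  obtain ⟨a, _, rfl⟩ := exists_of_mem_support_liftLaurent hm
  rw [pairing_liftExponent_vertical]
  norm_num

theorem fiberPower_mem_verticalRay {d : ℤ} (hd : 0 ≤ d) :
    fiberPower d ∈ cutoff evenLattice verticalRay 0 := by
  refine single_mem_cutoff _ 1 ?_
  rintro _ rfl
  rw [pairing_liftExponent_vertical]
  have hd' : (0 : ℚ) ≤ d := by exact_mod_cast hd
  push_cast
  linarith

theorem substitution_fiberPower_two (f : Laurent (⊤ : AddSubgroup (Fin 3 → ℤ))) :
    substitution f (fiberPower 2) = algebraMap _ _ f := by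
  have h := characterImage_even f 0 1
  rw [fiberPower, substitution_monomial]
  rw [Nat.cast_one, mul_one] at h
  rw [h, pow_one, monomial_zero, one_mul]

/-- Multiplication by `t²` turns the argument into `(t² - f)u`, which the substitution kills, and
the image `f` of `t²` is not a zero divisor. The detour is needed because `inftyEquation` itself
contains `t⁻²`, where the substitution is not multiplicative. -/
theorem substitution_eq_zero {f : Laurent (⊤ : AddSubgroup (Fin 3 → ℤ))}
    [IsDomain (QuadraticAlgebra (Laurent (⊤ : AddSubgroup (Fin 3 → ℤ))) f 0)]
    {u : Laurent evenLattice} (hu : u ∈ cutoff evenLattice verticalRay 0)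
    (h : inftyEquation f * u ∈ cutoff evenLattice verticalRay 0) :
    substitution f (inftyEquation f * u) = 0 := by
  -- `f` is the square of `y`, which is not zero.
  have hf : algebraMap _ (QuadraticAlgebra (Laurent (⊤ : AddSubgroup (Fin 3 → ℤ))) f 0) f ≠ 0 := by
    intro h0
    have h1 := root_mul_root_eq (f := f) 1 1
    rw [one_mul, one_mul, h0, mul_self_eq_zero] at h1
    exact one_ne_zero (congrArg QuadraticAlgebra.im h1)
  have h2 : fiberPower 2 * (inftyEquation f * u) = (fiberPower 2 - liftLaurent f) * u := by
    rw [← mul_assoc, fiberPower_mul_inftyEquation]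
  have h3 := congrArg (substitution f) h2
  have h2mem : fiberPower 2 ∈ cutoff evenLattice verticalRay 0 :=
    fiberPower_mem_verticalRay (by norm_num)
  rw [substitution_mul f h2mem h, substitution_mul f (Submodule.sub_mem _ h2mem
    (liftLaurent_mem_verticalRay f)) hu, map_sub, substitution_liftLaurent,
    substitution_fiberPower_two, sub_self, zero_mul] at h3
  exact (mul_eq_zero.mp h3).resolve_left hf

/-- The image point lies in the chart of a common face `k` of some `τ₀` and `σ_∞`. A power of a face
character extends the equation from the chart of `k` to that of `τ₀`, where the substitution kills
it; on the chart of `k` this character is a unit, so the equation vanishes at the point. -/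
theorem inftyEquation_mem_of_embedding
    [IsDomain (QuadraticAlgebra (Laurent (⊤ : AddSubgroup (Fin 3 → ℤ))) s.1 0)]
    (σ : S.cones) (p : Spec (.of ((toricCharts (bundleFan S) evenLattice).A (inftyCone S σ))))
    (y : (coverCharts S s).scheme)
    (hy : embedding S s y = (toricCharts (bundleFan S) evenLattice).ι (inftyCone S σ) p) :
    (⟨inftyEquation s.1, inftyEquation_mem (section_mem S s σ)⟩ :
      (toricCharts (bundleFan S) evenLattice).A (inftyCone S σ)) ∈ pointIdeal p := by
  obtain ⟨τ, q, rfl⟩ := (coverCharts S s).exists_ι_eq y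
  rw [embedding_ι] at hy
  obtain ⟨k, hkτ, hkσ, r, hrτ, hrσ⟩ := (toricCharts (bundleFan S) evenLattice).ι_eq_ι hy
  obtain ⟨m, h0, h1⟩ := exists_face_character evenLattice
    ((bundleFan S).linearIndependent (zeroCone S τ).2) k.1
  have hE : inftyEquation s.1 ∈ (toricCharts (bundleFan S) evenLattice).A k :=
    (toricCharts (bundleFan S) evenLattice).anti hkσ (inftyEquation_mem (section_mem S s σ))
  obtain ⟨N, hN⟩ := exists_mul_monomial_mem m h0 h1 hE
  have hN' : inftyEquation s.1 * monomial m ^ N ∈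
    (toricCharts (bundleFan S) evenLattice).A (zeroCone S τ) := hN N le_rfl
  have hu : monomial m ∈ (toricCharts (bundleFan S) evenLattice).A (zeroCone S τ) :=
    monomial_mem h0 h1
  have hu' : monomial m ∈ (toricCharts (bundleFan S) evenLattice).A k :=
    (toricCharts (bundleFan S) evenLattice).anti hkτ hu
  have hzero : substitution s.1 (inftyEquation s.1 * monomial m ^ N) = 0 :=
    substitution_eq_zero (mem_cutoff_of_liftCone (σ := τ.1) (Subalgebra.pow_mem _ hu N))
      (mem_cutoff_of_liftCone (σ := τ.1) hN')
  have h2 : (⟨_, hN'⟩ : (toricCharts (bundleFan S) evenLattice).A (zeroCone S τ)) ∈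
      pointIdeal (Spec.map (CommRingCat.ofHom (embeddingHom S s τ)) q) := by
    rw [pointIdeal_map, Ideal.mem_comap]
    convert Ideal.zero_mem _
    exact Subtype.ext hzero
  rw [hrτ, Ideal.mem_comap] at h2
  have h3 : (⟨_, hE⟩ * ⟨_, hu'⟩ ^ N : (toricCharts (bundleFan S) evenLattice).A k) ∈
    pointIdeal r := h2
  have hunit : (⟨_, hu'⟩ : (toricCharts (bundleFan S) evenLattice).A k) ∉ pointIdeal r :=
    notMem_of_mul_eq_one (v := ⟨_, monomial_neg_mem h0 hkτ⟩) (Subtype.ext (monomial_mul_neg m))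
  rw [hrσ, Ideal.mem_comap]
  rcases Ideal.IsPrime.mem_or_mem inferInstance h3 with h4 | h4
  · exact h4
  · exact absurd (Ideal.IsPrime.mem_of_pow_mem inferInstance N h4) hunit

end Embedding

/-! ### The equation of the double cover in the charts at zero -/

theorem liftLaurent_coordProd_mul_inv (b : Module.Basis (Fin 3) ℤ (Fin 3 → ℤ)) :
    liftLaurent (coordProd b) * liftLaurent (coordProdInv b) = 1 := by
  rw [← map_mul, coordProd_mul_inv, map_one]

section Chart

variable (b : Module.Basis (Fin 3) ℤ (Fin 3 → ℤ)) {σ : Finset (Fin 3 → ℤ)}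
  (hσ : (σ : Set (Fin 3 → ℤ)) = Set.range b) {f : Laurent (⊤ : AddSubgroup (Fin 3 → ℤ))}

/-- The chart of the cone `σ₀`. -/
def zeroChart : DoubleChart (coneAlgebra evenLattice (liftCone σ 1 : Set (Fin 4 → ℤ))) 4 :=
  liftChart b hσ 1 rfl rfl

/-- The chart of the cone `σ_∞`. -/
def inftyChart : DoubleChart (coneAlgebra evenLattice (liftCone σ (-1) : Set (Fin 4 → ℤ))) 4 :=
  liftChart b hσ 0 rfl rfl

theorem zeroChart_x_castSucc (j : Fin 3) :
    (zeroChart b hσ).x j.castSucc = liftLaurent ((basisFrame b).x j) := by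
  change monomial (liftFrameExponent b 1 j.castSucc) = _
  rw [liftFrameExponent_castSucc, DualFrame.x, liftLaurent_monomial]

theorem zeroChart_x_last : (zeroChart b hσ).x (Fin.last 3) =
    liftLaurent (coordProd b) * fiberPower 2 := by
  change monomial (liftFrameExponent b 1 (Fin.last 3)) = _
  rw [liftFrameExponent_last, one_smul, mul_one, monomial_liftExponent, coordProd]

theorem inftyChart_x_last : (inftyChart b hσ).x (Fin.last 3) =
    liftLaurent (coordProdInv b) * fiberPower (-2) := by
  change monomial (liftFrameExponent b (-1) (Fin.last 3)) = _
  rw [liftFrameExponent_last, neg_smul, one_smul, monomial_liftExponent, coordProdInv]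
  rfl

theorem zeroChart_w : (zeroChart b hσ).w = liftLaurent (coordProd b) * fiberPower 1 := by
  change monomial (liftExponent ((1 : ℤ) • (basisFrame b).exponent 1) 1) = _
  rw [one_smul, monomial_liftExponent, coordProd]

theorem inftyChart_w : (inftyChart b hσ).w = fiberPower (-1) := by
  change monomial (liftExponent ((0 : ℤ) • (basisFrame b).exponent 1) (-1)) = _
  rw [zero_smul, fiberPower]

/-- The equation `x₁ x₂ x₃ (t² - s)`. -/
def zeroEquation (f : Laurent (⊤ : AddSubgroup (Fin 3 → ℤ))) : Laurent evenLattice :=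
  liftLaurent (coordProd b) * (fiberPower 2 - liftLaurent f)

variable {g : MvPolynomial (Fin 3) ℂ}

/-- The substitution of `g` for the last variable. -/
def substLast (g : MvPolynomial (Fin 3) ℂ) : MvPolynomial (Fin 4) ℂ →ₐ[ℂ] MvPolynomial (Fin 3) ℂ :=
  MvPolynomial.aeval (Fin.snoc (α := fun _ => MvPolynomial (Fin 3) ℂ) MvPolynomial.X g)

theorem substLast_X_castSucc (j : Fin 3) :
    substLast g (MvPolynomial.X j.castSucc) = MvPolynomial.X j := by
  rw [substLast, MvPolynomial.aeval_X, Fin.snoc_castSucc (α := fun _ => MvPolynomial (Fin 3) ℂ)]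

theorem substLast_X_last : substLast g (MvPolynomial.X (Fin.last 3)) = g := by
  rw [substLast, MvPolynomial.aeval_X, Fin.snoc_last (α := fun _ => MvPolynomial (Fin 3) ℂ)]

theorem substLast_rename (p : MvPolynomial (Fin 3) ℂ) :
    substLast g (MvPolynomial.rename Fin.castSucc p) = p := by
  have h : (substLast g).comp (MvPolynomial.rename Fin.castSucc) = AlgHom.id ℂ _ :=
    MvPolynomial.algHom_ext fun j => by
      rw [AlgHom.comp_apply, MvPolynomial.rename_X, substLast_X_castSucc, AlgHom.id_apply]
  exact congrArg (fun φ => φ p) h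

/-- Modulo `x₄ - g` every polynomial is congruent to the result of substituting `g` for `x₄`. -/
theorem dvd_of_substLast_eq_zero {a : MvPolynomial (Fin 4) ℂ} (ha : substLast g a = 0) :
    MvPolynomial.X (Fin.last 3) - MvPolynomial.rename Fin.castSucc g ∣ a := by
  let I : Ideal (MvPolynomial (Fin 4) ℂ) :=
    Ideal.span {MvPolynomial.X (Fin.last 3) - MvPolynomial.rename Fin.castSucc g}
  have h : (Ideal.Quotient.mkₐ ℂ I).comp ((MvPolynomial.rename Fin.castSucc).comp (substLast g)) =
      Ideal.Quotient.mkₐ ℂ I := by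
    refine MvPolynomial.algHom_ext fun j => ?_
    refine Fin.lastCases ?_ (fun j => ?_) j
    · rw [AlgHom.comp_apply, AlgHom.comp_apply, substLast_X_last]
      refine ((Ideal.Quotient.mk_eq_mk_iff_sub_mem (I := I) _ _).mpr ?_).symm
      exact Ideal.mem_span_singleton_self _
    · rw [AlgHom.comp_apply, AlgHom.comp_apply, substLast_X_castSucc, MvPolynomial.rename_X]
  have h1 := congrArg (fun φ => φ a) h
  rw [AlgHom.comp_apply, AlgHom.comp_apply, ha, map_zero, map_zero] at h1
  exact Ideal.mem_span_singleton.mp (Ideal.Quotient.eq_zero_iff_mem.mp h1.symm)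

theorem aeval_zeroChart_rename (p : MvPolynomial (Fin 3) ℂ) :
    MvPolynomial.aeval (zeroChart b hσ).x (MvPolynomial.rename Fin.castSucc p) =
      liftLaurent (MvPolynomial.aeval (basisFrame b).x p) := by
  have h : (MvPolynomial.aeval (zeroChart b hσ).x).comp (MvPolynomial.rename Fin.castSucc) =
      liftLaurent.comp (MvPolynomial.aeval (basisFrame b).x) :=
    MvPolynomial.algHom_ext fun j => by
      rw [AlgHom.comp_apply, MvPolynomial.rename_X, MvPolynomial.aeval_X, AlgHom.comp_apply,
        MvPolynomial.aeval_X, zeroChart_x_castSucc]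
  exact congrArg (fun φ => φ p) h

theorem aeval_zeroChart_equation
    (hg : coordProd b * f = MvPolynomial.aeval (basisFrame b).x g) :
    MvPolynomial.aeval (zeroChart b hσ).x
      (MvPolynomial.X (Fin.last 3) - MvPolynomial.rename Fin.castSucc g) = zeroEquation b f := by
  rw [map_sub, MvPolynomial.aeval_X, zeroChart_x_last, aeval_zeroChart_rename, ← hg, map_mul,
    zeroEquation, mul_sub]

include hσ in
theorem zeroEquation_mem (hf : f ∈ cutoff ⊤ (σ : Set (Fin 3 → ℤ)) (-1)) :
    zeroEquation b f ∈ coneAlgebra evenLattice (liftCone σ 1 : Set (Fin 4 → ℤ)) := by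
  obtain ⟨g, hg⟩ := exists_equation b (hσ ▸ hf)
  rw [← aeval_zeroChart_equation b hσ hg]
  exact (zeroChart b hσ).aeval_mem _

variable (hf : f ∈ cutoff ⊤ (σ : Set (Fin 3 → ℤ)) (-1))
  (hsnc : IsSNC (zeroIdeal (σ : Set (Fin 3 → ℤ)) 2 f))
  (hg : coordProd b * f = MvPolynomial.aeval (basisFrame b).x g)

/-- Both sides are algebra homomorphisms, so the variables suffice; the essential one is `x₄ =
x₁x₂x₃t²`, which goes to `x₁x₂x₃f = g`. -/
theorem chartHom_poly (a : MvPolynomial (Fin 4) ℂ) : chartHom hf ((zeroChart b hσ).poly a) =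
    (coverChart b hσ hf hsnc hg).poly (substLast g a) := by
  have h : (chartHom hf).comp (zeroChart b hσ).poly =
      (coverChart b hσ hf hsnc hg).poly.comp (substLast g) := by
    refine MvPolynomial.algHom_ext fun j => Subtype.ext ?_
    rw [AlgHom.comp_apply, AlgHom.comp_apply, coe_chartHom, DoubleChart.coe_poly,
      DoubleChart.coe_poly, MvPolynomial.aeval_X]
    refine Fin.lastCases ?_ (fun j => ?_) j
    · rw [zeroChart_x_last, substLast_X_last,
        substitution_mul f (liftLaurent_mem_verticalRay _)
          (fiberPower_mem_verticalRay (by norm_num)),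
        substitution_liftLaurent, substitution_fiberPower_two, ← map_mul, hg]
      exact (MvPolynomial.aeval_algebraMap_apply _ _ _).symm
    · rw [zeroChart_x_castSucc, substLast_X_castSucc, substitution_liftLaurent,
        MvPolynomial.aeval_X]
      rfl
  exact congrArg (fun φ => φ a) h

theorem substitution_fiberPower_one (f : Laurent (⊤ : AddSubgroup (Fin 3 → ℤ))) :
    substitution f (fiberPower 1) = ⟨0, 1⟩ := by
  have h := characterImage_odd f 0 0
  rw [Nat.cast_zero, mul_zero, zero_add, monomial_zero, pow_zero, mul_one] at h
  rw [fiberPower, substitution_monomial, h]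

theorem chartHom_root : chartHom hf (zeroChart b hσ).root =
    (coverChart b hσ hf hsnc hg).root := by
  refine Subtype.ext ?_
  change substitution f (zeroChart b hσ).w = ⟨0, coordProd b⟩
  rw [zeroChart_w, substitution_mul f (liftLaurent_mem_verticalRay _)
    (fiberPower_mem_verticalRay (by norm_num))]
  rw [substitution_fiberPower_one, substitution_liftLaurent]
  have h := algebraMap_add_mul_root (f := f) 0 (coordProd b) 1
  rwa [map_zero, zero_add, mul_one] at h

include hσ hsnc in
-- With respect to the bases `1, w` of both charts the map sends `w` to `w` and acts on coefficients
-- by `substLast`, which has the section `rename Fin.castSucc`.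
theorem chartHom_surjective : Function.Surjective (chartHom hf) := by
  obtain ⟨g, hg⟩ := exists_equation b (hσ ▸ hf)
  intro z
  obtain ⟨p, q, rfl⟩ := (coverChart b hσ hf hsnc hg).exists_eq z
  refine ⟨(zeroChart b hσ).poly (MvPolynomial.rename Fin.castSucc p) +
    (zeroChart b hσ).poly (MvPolynomial.rename Fin.castSucc q) * (zeroChart b hσ).root, ?_⟩
  rw [map_add, map_mul, chartHom_poly b hσ hf hsnc hg, chartHom_poly b hσ hf hsnc hg,
    chartHom_root b hσ hf hsnc hg, substLast_rename, substLast_rename]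

include hσ hsnc in
-- In the bases `1, w` an element of the kernel has both coefficients in the kernel of `substLast`,
-- and these are multiples of `x₄ - g`.
theorem ker_chartHom : RingHom.ker (chartHom hf) =
    Ideal.span {⟨zeroEquation b f, zeroEquation_mem b hσ hf⟩} := by
  obtain ⟨g, hg⟩ := exists_equation b (hσ ▸ hf)
  have heq : (⟨zeroEquation b f, zeroEquation_mem b hσ hf⟩ :
      coneAlgebra evenLattice (liftCone σ 1 : Set (Fin 4 → ℤ))) = (zeroChart b hσ).poly
        (MvPolynomial.X (Fin.last 3) - MvPolynomial.rename Fin.castSucc g) :=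
    Subtype.ext (aeval_zeroChart_equation b hσ hg).symm
  rw [heq]
  apply le_antisymm
  · intro z hz
    obtain ⟨p, q, rfl⟩ := (zeroChart b hσ).exists_eq z
    rw [RingHom.mem_ker, map_add, map_mul, chartHom_poly b hσ hf hsnc hg,
      chartHom_poly b hσ hf hsnc hg, chartHom_root b hσ hf hsnc hg] at hz
    obtain ⟨h1, h2⟩ := (coverChart b hσ hf hsnc hg).eq_zero hz
    obtain ⟨p, rfl⟩ := dvd_of_substLast_eq_zero h1
    obtain ⟨q, rfl⟩ := dvd_of_substLast_eq_zero h2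
    refine Ideal.mem_span_singleton.mpr
      ⟨(zeroChart b hσ).poly p + (zeroChart b hσ).poly q * (zeroChart b hσ).root, ?_⟩
    rw [map_mul, map_mul]
    ring
  · refine (Ideal.span_singleton_le_iff_mem _).mpr ?_
    rw [RingHom.mem_ker, chartHom_poly b hσ hf hsnc hg, map_sub, substLast_X_last,
      substLast_rename, sub_self, map_zero]

end Chart

/-! ### The charts of maximal cones cover -/

section Cover

variable {S : ConeComplex 3} (hS : IsSmoothMPCPFan S) (s : anticanonicalSections S)

include hS in
-- Near infinity `(1 - st⁻²) + gx₄ = 1`. So a point where the equation vanishes has `x₄ ≠ 0`; it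
-- lies in the chart of the common face of `σ₀` and `σ_∞`, hence in the chart near zero. Together
-- with `inftyEquation_mem_of_embedding` this confines the cover to the charts near zero.
theorem exists_chart_eq (x : (toricCharts (bundleFan S) evenLattice).scheme) :
    ∃ σ : S.cones, σ.1.card = 3 ∧
      ((∃ p, (toricCharts (bundleFan S) evenLattice).ι (zeroCone S σ) p = x) ∨
        ∃ p, (toricCharts (bundleFan S) evenLattice).ι (inftyCone S σ) p = x ∧
          (⟨inftyEquation s.1, inftyEquation_mem (section_mem S s σ)⟩ :
            (toricCharts (bundleFan S) evenLattice).A (inftyCone S σ)) ∉ pointIdeal p) := by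
  classical
  obtain ⟨j, p, hp⟩ := (toricCharts (bundleFan S) evenLattice).exists_ι_eq x
  have hx : x ∈ ((toricCharts (bundleFan S) evenLattice).ι j).opensRange := ⟨p, hp⟩
  obtain ⟨τ, hτ, ε, hε, hle⟩ := j.2
  obtain ⟨σ, hσ, hτσ, hcard⟩ := exists_maximal_cone hS hτ
  refine ⟨⟨σ, hσ⟩, hcard, ?_⟩
  rcases hε with rfl | rfl
  · left
    exact (toricCharts (bundleFan S) evenLattice).opensRange_le (k := zeroCone S ⟨σ, hσ⟩)
      (hle.trans (liftCone_mono hτσ 1)) hx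
  · obtain ⟨p, rfl⟩ := (toricCharts (bundleFan S) evenLattice).opensRange_le
      (k := inftyCone S ⟨σ, hσ⟩) (hle.trans (liftCone_mono hτσ (-1))) hx
    by_cases hE : (⟨inftyEquation s.1, inftyEquation_mem (section_mem S s ⟨σ, hσ⟩)⟩ :
        (toricCharts (bundleFan S) evenLattice).A (inftyCone S ⟨σ, hσ⟩)) ∈ pointIdeal p
    · left
      obtain ⟨b, hb⟩ := exists_basis hS hσ hcard
      -- The exponent of `x₄ = (x₁x₂x₃t²)⁻¹`; it vanishes on the lifted generators and is 1 on the
      -- vertical one, so it cuts out the face without the vertical generator.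
      let m : dualLattice evenLattice := liftFrameExponent b (-1) (Fin.last 3)
      let k : (bundleFan S).cones := ⟨σ.image fun η => ![η 0, η 1, η 2, -1], σ, hσ, 1, Or.inl rfl,
        Finset.subset_insert _ _⟩
      have hk : k ≤ inftyCone S ⟨σ, hσ⟩ := Finset.subset_insert _ _
      have hk' : k ≤ zeroCone S ⟨σ, hσ⟩ := Finset.subset_insert _ _
      have hpair : ∀ j, pairing m.1 (liftVectors b (-1) j) = if Fin.last 3 = j then 1 else 0 :=
        (liftFrame b (-1) rfl).pairing_w (Fin.last 3)
      have hlast : pairing m.1 ![0, 0, 0, -1] = 1 := by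
        have h := hpair (Fin.last 3)
        rwa [if_pos rfl, show liftVectors b (-1) (Fin.last 3) = ![0, 0, 0, -1] from
          Fin.snoc_last (α := fun _ => Fin 4 → ℤ) _ _] at h
      have hcast : ∀ η ∈ σ, pairing m.1 ![η 0, η 1, η 2, -1] = 0 := by
        intro η hη
        have h1 : η ∈ Set.range b := hb ▸ Finset.mem_coe.mpr hη
        obtain ⟨j, rfl⟩ := h1
        have h := hpair j.castSucc
        rwa [if_neg (Fin.castSucc_lt_last j).ne', show liftVectors b (-1) j.castSucc =
          ![b j 0, b j 1, b j 2, -1] from Fin.snoc_castSucc (α := fun _ => Fin 4 → ℤ) _ _ _] at h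
      have h0 : ∀ v ∈ (inftyCone S ⟨σ, hσ⟩).1, v ∈ k.1 → pairing m.1 v = 0 := by
        intro v _ hv
        obtain ⟨η, hη, rfl⟩ := Finset.mem_image.mp hv
        exact hcast η hη
      have h1 : ∀ v ∈ (inftyCone S ⟨σ, hσ⟩).1, v ∉ k.1 → 0 < pairing m.1 v := by
        intro v hv hv'
        rcases mem_liftCone.mp hv with rfl | ⟨η, hη, rfl⟩
        · rw [hlast]
          exact one_pos
        · exact absurd (Finset.mem_image_of_mem (fun η => ![η 0, η 1, η 2, -1]) hη) hv'
      refine (toricCharts (bundleFan S) evenLattice).opensRange_le hk'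
        (toricCharts_mem_opensRange hk m h0 h1 p fun hr => ?_)
      have hfσ := section_mem S s ⟨σ, hσ⟩
      have hz : liftLaurent (coordProd b * s.1) ∈
          (toricCharts (bundleFan S) evenLattice).A (inftyCone S ⟨σ, hσ⟩) := by
        intro m hm v hv
        obtain ⟨a, ha, rfl⟩ := exists_of_mem_support_liftLaurent hm
        rcases mem_liftCone.mp hv with rfl | ⟨η, hη, rfl⟩
        · rw [pairing_liftExponent_vertical]
          norm_num
        · rw [pairing_liftExponent]
          have h2 := cutoff_mul (k := 1) (l := -1) (V := (σ : Set (Fin 3 → ℤ)))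
            (hb ▸ coordProd_mem b) hfσ a ha η hη
          push_cast at h2 ⊢
          linarith
      -- The identity `(1 - st⁻²) + (x₁x₂x₃s)(x₁x₂x₃t²)⁻¹ = 1`.
      have hone : (⟨inftyEquation s.1, inftyEquation_mem hfσ⟩ :
          (toricCharts (bundleFan S) evenLattice).A (inftyCone S ⟨σ, hσ⟩)) +
          ⟨_, hz⟩ * ⟨monomial m, monomial_mem h0 h1⟩ = 1 := by
        refine Subtype.ext ?_
        change inftyEquation s.1 + liftLaurent (coordProd b * s.1) * monomial m = 1
        have hm : monomial m = liftLaurent (coordProdInv b) * fiberPower (-2) :=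
          inftyChart_x_last b hb
        rw [hm, inftyEquation, map_mul]
        linear_combination (liftLaurent s.1 * fiberPower (-2)) * liftLaurent_coordProd_mul_inv b
      have htop : (1 : (toricCharts (bundleFan S) evenLattice).A (inftyCone S ⟨σ, hσ⟩)) ∈
          pointIdeal p := by
        rw [← hone]
        exact Ideal.add_mem _ hE (Ideal.mul_mem_left _ _ hr)
      have hprime : (pointIdeal p).IsPrime := inferInstance
      exact hprime.ne_top ((Ideal.eq_top_iff_one _).mpr htop)
    · exact Or.inr ⟨p, rfl, hE⟩

end Cover

/-! ### Ideals of closed subschemes on charts -/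

section IdealStalk

variable {A B : Type} [CommRing A] [CommRing B] {X Y : Scheme.{0}} (i : Y ⟶ X)

theorem exists_open_disjoint (j : Spec (.of A) ⟶ X) [IsOpenImmersion j] (a : A)
    (h : ∀ y p, i y = j p → a ∈ pointIdeal p) (p : Spec (.of A)) (hp : a ∉ pointIdeal p) :
    ∃ U : X.Opens, j p ∈ U ∧ ∀ y, i y ∉ U := by
  refine ⟨⟨j '' (PrimeSpectrum.basicOpen a : Set (PrimeSpectrum A)),
    j.isOpenEmbedding.isOpenMap _ (PrimeSpectrum.basicOpen a).isOpen⟩, ⟨p, hp, rfl⟩, ?_⟩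
  rintro y ⟨q, hq, hqy⟩
  exact hq (h y q hqy.symm)

theorem idealStalk_eq_span_of_notMem (j : Spec (.of A) ⟶ X) [IsOpenImmersion j] (a : A)
    (h : ∀ y p, i y = j p → a ∈ pointIdeal p) (p : Spec (.of A)) (hp : a ∉ pointIdeal p) :
    idealStalk i (j p) = Ideal.span {chartGerm j (j p) (mem_opensRange_self j p) a} := by
  obtain ⟨U, hU, hd⟩ := exists_open_disjoint i j a h p hp
  rw [idealStalk_eq_top i _ U hU hd, eq_comm, Ideal.span_singleton_eq_top]
  exact (isUnit_chartGerm_iff j p a).mpr hp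

/-- At a point of the image the ideal is the kernel of the stalk map; clearing denominators reduces
this to the kernel of `φ`. At any other point of the chart `a` is a unit and the ideal is
everything. -/
theorem idealStalk_eq_span_of_chart [IsIntegral Y] {j : Spec (.of A) ⟶ X} [IsOpenImmersion j]
    {j' : Spec (.of B) ⟶ Y} [IsOpenImmersion j'] {φ : A →+* B}
    (e : j' ≫ i = Spec.map (CommRingCat.ofHom φ) ≫ j) (hφ : Function.Surjective φ) {a : A}
    (hker : RingHom.ker φ = Ideal.span {a})
    (hpre : ∀ y, i y ∈ j.opensRange → y ∈ j'.opensRange) (p : Spec (.of A)) :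
    idealStalk i (j p) = Ideal.span {chartGerm j (j p) (mem_opensRange_self j p) a} := by
  have hφa : φ a = 0 := by
    have : a ∈ RingHom.ker φ := hker ▸ Ideal.mem_span_singleton_self a
    exact this
  have hij : ∀ q, i (j' q) = j (Spec.map (CommRingCat.ofHom φ) q) := fun q => by
    rw [← Scheme.Hom.comp_apply, e, Scheme.Hom.comp_apply]
  by_cases hp : a ∈ pointIdeal p
  · have hrange : (show PrimeSpectrum A from p) ∈ Set.range (PrimeSpectrum.comap φ) := by
      rw [range_comap_of_surjective B φ hφ, hker, PrimeSpectrum.zeroLocus_span,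
        PrimeSpectrum.mem_zeroLocus, Set.singleton_subset_iff]
      exact hp
    obtain ⟨q, hq⟩ := hrange
    let q' : Spec (.of B) := q
    have hp' : p = Spec.map (CommRingCat.ofHom φ) q' := hq.symm
    -- The stalk depends on the point, so the equality `j p = i (j' q')` is applied through a
    -- variable point.
    have hx : ∀ (x : X) (hx : x ∈ j.opensRange), x = i (j' q') →
        idealStalk i x = Ideal.span {chartGerm j x hx a} := by
      rintro _ hx rfl
      rw [idealStalk_eq_ker]
      have hst : ∀ c : A, i.stalkMap (j' q') (chartGerm j (i (j' q')) hx c) =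
          chartGerm j' (j' q') (mem_opensRange_self j' q') (φ c) :=
        stalkMap_chartGerm e (j' q') (mem_opensRange_self j' q') hx
      have hfrac : ∀ (x : X) (hx : x ∈ j.opensRange) (z : X.presheaf.stalk x), ∃ c d : A,
          IsUnit (chartGerm j x hx d) ∧ z * chartGerm j x hx d = chartGerm j x hx c := by
        rintro _ ⟨p, rfl⟩ z
        obtain ⟨c, d, hd, h⟩ := exists_chartGerm_mul_eq j p z
        exact ⟨c, d, (isUnit_chartGerm_iff j p d).mpr hd, h⟩
      apply le_antisymm
      · intro z hz
        obtain ⟨c, d, hd, hzd⟩ := hfrac _ hx z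
        have hz' : i.stalkMap (j' q') z = 0 := hz
        have h1 := congrArg (i.stalkMap (j' q')) hzd
        rw [map_mul, hz', zero_mul, hst] at h1
        have h2 : φ c = 0 := chartGerm_injective j' (j' q') (mem_opensRange_self j' q')
          (h1.symm.trans (map_zero _).symm)
        have h3 : c ∈ Ideal.span {a} := hker ▸ h2
        obtain ⟨c', rfl⟩ := Ideal.mem_span_singleton.mp h3
        refine (Ideal.unit_mul_mem_iff_mem _ hd).mp ?_
        rw [mul_comm, hzd, map_mul]
        exact Ideal.mul_mem_right _ _ (Ideal.mem_span_singleton_self _)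
      · refine (Ideal.span_singleton_le_iff_mem _).mpr ?_
        change i.stalkMap (j' q') (chartGerm j (i (j' q')) hx a) = 0
        rw [hst, hφa, map_zero]
    exact hx _ _ (by rw [hij, hp'])
  · refine idealStalk_eq_span_of_notMem i j a (fun y p' hy => ?_) p hp
    obtain ⟨q, rfl⟩ := hpre y ⟨p', hy.symm⟩
    rw [hij] at hy
    rw [← j.isOpenEmbedding.injective hy, pointIdeal_map, Ideal.mem_comap, hφa]
    exact Ideal.zero_mem _

end IdealStalk

/-! ### The two varieties are integral -/

theorem ChartSystem.exists_loc_of_eq_top {J : Type} [PartialOrder J] {R : Type} [CommRing R]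
    [Algebra ℂ R] (C : ChartSystem J R) {i k : J} (h : i ≤ k) (hA : C.A i = ⊤) :
    ∃ u ∈ C.A k, (∃ v, u * v = 1) ∧ ∀ a, ∃ N : ℕ, a * u ^ N ∈ C.A k := by
  obtain ⟨u, hu, ⟨v, _, huv⟩, hs⟩ := C.loc h
  exact ⟨u, hu, ⟨v, huv⟩, fun a => hs a (hA ▸ trivial)⟩

section Main

variable {S : ConeComplex 3} (hS : IsSmoothMPCPFan S)

include hS in
theorem exists_maximal : ∃ σ : S.cones, σ.1.card = 3 := by
  obtain ⟨σ, hσ, _⟩ := hS.complete 0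
  obtain ⟨τ, hτ, _, hc⟩ := exists_maximal_cone hS hσ
  exact ⟨⟨τ, hτ⟩, hc⟩

/-- The trivial cone. -/
def originCone : S.cones :=
  ⟨∅, S.down_closed (exists_maximal hS).choose.2 (Finset.empty_subset _)⟩

theorem originCone_le (σ : S.cones) : originCone hS ≤ σ := Finset.empty_subset σ.1

/-- The trivial cone of the fan of the bundle. -/
def originLift : (bundleFan S).cones :=
  ⟨∅, (originCone hS).1, (originCone hS).2, 1, Or.inl rfl, Finset.empty_subset _⟩

theorem originLift_le (σ : (bundleFan S).cones) : originLift hS ≤ σ := Finset.empty_subset σ.1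

theorem coverCharts_originCone (s : anticanonicalSections S) :
    (coverCharts S s).A (originCone hS) = ⊤ := by
  refine top_unique fun z _ => ⟨fun m _ v hv => ?_, fun m _ v hv => ?_⟩ <;>
  exact absurd hv (Finset.notMem_empty v)

theorem toricCharts_originLift :
    (toricCharts (bundleFan S) evenLattice).A (originLift hS) = ⊤ :=
  top_unique fun _ _ _ _ v hv => absurd hv (Finset.notMem_empty v)

include hS in
theorem isDomain_laurent : IsDomain (Laurent evenLattice) := by
  obtain ⟨σ, hc⟩ := exists_maximal hS
  obtain ⟨b, hb⟩ := exists_basis hS σ.2 hc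
  exact (zeroChart b hb).isDomain_of_loc ((toricCharts (bundleFan S) evenLattice).exists_loc_of_eq_top
    (originLift_le hS (zeroCone S σ)) (toricCharts_originLift hS))

variable {s : anticanonicalSections S} (hs : IsAdmissible S s)

include hS hs in
theorem isDomain_quadratic :
    IsDomain (QuadraticAlgebra (Laurent (⊤ : AddSubgroup (Fin 3 → ℤ))) s.1 0) := by
  obtain ⟨σ, hc⟩ := exists_maximal hS
  obtain ⟨b, hb⟩ := exists_basis hS σ.2 hc
  obtain ⟨g, hg⟩ := exists_equation b (hb ▸ section_mem S s σ)
  exact (coverChart b hb (section_mem S s σ) (hs σ.1 σ.2).2 hg).isDomain_of_loc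
    ((coverCharts S s).exists_loc_of_eq_top (originCone_le hS σ) (coverCharts_originCone hS s))

include hS hs in
theorem isIntegral_cover : IsIntegral (coverCharts S s).scheme := by
  have := isDomain_quadratic hS hs
  exact (coverCharts S s).isIntegral (originCone hS) (originCone_le hS)

include hS in
theorem isIntegral_bundle : IsIntegral (toricCharts (bundleFan S) evenLattice).scheme := by
  have := isDomain_laurent hS
  exact (toricCharts (bundleFan S) evenLattice).isIntegral (originLift hS) (originLift_le hS)

include hS in
theorem exists_maximal_chart (y : (coverCharts S s).scheme) :
    ∃ σ : S.cones, σ.1.card = 3 ∧ ∃ p, (coverCharts S s).ι σ p = y := by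
  obtain ⟨τ, p, hp⟩ := (coverCharts S s).exists_ι_eq y
  obtain ⟨σ, hσ, hle, hc⟩ := exists_maximal_cone hS τ.2
  exact ⟨⟨σ, hσ⟩, hc, (coverCharts S s).opensRange_le (k := ⟨σ, hσ⟩) hle ⟨p, hp⟩⟩

include hS hs in
theorem isIntegrallyClosed_stalk_cover (y : (coverCharts S s).scheme) :
    IsIntegrallyClosed ((coverCharts S s).scheme.presheaf.stalk y) := by
  obtain ⟨σ, hc, p, rfl⟩ := exists_maximal_chart hS y
  obtain ⟨b, hb⟩ := exists_basis hS σ.2 hc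
  obtain ⟨g, hg⟩ := exists_equation b (hb ▸ section_mem S s σ)
  have h1 : IsDomain ((coverCharts S s).A σ) :=
    (coverChart b hb (section_mem S s σ) (hs σ.1 σ.2).2 hg).isDomain
  have h2 : IsIntegrallyClosed ((coverCharts S s).A σ) :=
    (coverChart b hb (section_mem S s σ) (hs σ.1 σ.2).2 hg).isIntegrallyClosed
  exact isIntegrallyClosed_stalk ((coverCharts S s).ι σ) p

include hS hs in
theorem isClosedImmersion_embedding : IsClosedImmersion (embedding S s) := by
  have := isDomain_quadratic hS hs
  refine isClosedImmersion_of_charts _ fun x => ?_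
  obtain ⟨σ, hc, ⟨p, rfl⟩ | ⟨p, rfl, hp⟩⟩ := exists_chart_eq hS s x
  · right
    obtain ⟨b, hb⟩ := exists_basis hS σ.2 hc
    exact ⟨_, _, _, _, (toricCharts (bundleFan S) evenLattice).ι (zeroCone S σ),
      (coverCharts S s).ι σ, inferInstance, inferInstance, embeddingHom S s σ,
      chartHom_surjective b hb (section_mem S s σ) (hs σ.1 σ.2).2, mem_opensRange_self _ p,
      ι_embedding S s σ, mem_opensRange_of_embedding S s σ⟩
  · left
    exact exists_open_disjoint _ _ _
      (fun y q hy => inftyEquation_mem_of_embedding S s σ q y hy) p hp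

include hS hs in
theorem idealStalk_zeroCone {σ : S.cones} {b : Module.Basis (Fin 3) ℤ (Fin 3 → ℤ)}
    (hb : (σ.1 : Set (Fin 3 → ℤ)) = Set.range b)
    (p : Spec (.of ((toricCharts (bundleFan S) evenLattice).A (zeroCone S σ)))) :
    idealStalk (embedding S s) ((toricCharts (bundleFan S) evenLattice).ι (zeroCone S σ) p) =
      Ideal.span {chartGerm ((toricCharts (bundleFan S) evenLattice).ι (zeroCone S σ)) _
        (mem_opensRange_self _ p)
        ⟨zeroEquation b s.1, zeroEquation_mem b hb (section_mem S s σ)⟩} := by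
  have := isIntegral_cover hS hs
  exact idealStalk_eq_span_of_chart (embedding S s) (ι_embedding S s σ)
    (chartHom_surjective b hb (section_mem S s σ) (hs σ.1 σ.2).2)
    (ker_chartHom b hb (section_mem S s σ) (hs σ.1 σ.2).2)
    (mem_opensRange_of_embedding S s σ) p

include hS hs in
theorem idealStalk_inftyCone {σ : S.cones}
    (p : Spec (.of ((toricCharts (bundleFan S) evenLattice).A (inftyCone S σ))))
    (hp : (⟨inftyEquation s.1, inftyEquation_mem (section_mem S s σ)⟩ :
      (toricCharts (bundleFan S) evenLattice).A (inftyCone S σ)) ∉ pointIdeal p) :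
    idealStalk (embedding S s) ((toricCharts (bundleFan S) evenLattice).ι (inftyCone S σ) p) =
      Ideal.span {chartGerm ((toricCharts (bundleFan S) evenLattice).ι (inftyCone S σ)) _
        (mem_opensRange_self _ p)
        ⟨inftyEquation s.1, inftyEquation_mem (section_mem S s σ)⟩} := by
  have := isDomain_quadratic hS hs
  exact idealStalk_eq_span_of_notMem _ _ _
    (fun y q hy => inftyEquation_mem_of_embedding S s σ q y hy) p hp

/-- The term `t²` cannot cancel against `f`, which has degree 0 in `t`. -/
theorem fiberPower_two_sub_ne_zero (f : Laurent (⊤ : AddSubgroup (Fin 3 → ℤ))) :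
    fiberPower 2 - liftLaurent f ≠ 0 := by
  intro h
  have h1 := congrArg (fun g : Laurent evenLattice => g.coeff (liftExponent 0 2))
    (sub_eq_zero.mp h)
  have h2 : (fiberPower 2).coeff (liftExponent 0 2) = 1 := by simp [fiberPower, monomial]
  have h3 : (liftLaurent f).coeff (liftExponent 0 2) = 0 := by
    by_contra h0
    obtain ⟨a, _, ha⟩ := exists_of_mem_support_liftLaurent (Finsupp.mem_support_iff.mpr h0)
    exact absurd (liftExponent_injective ha).2 (by decide)
  exact one_ne_zero (h2.symm.trans (h1.trans h3))

theorem inftyEquation_ne_zero (f : Laurent (⊤ : AddSubgroup (Fin 3 → ℤ))) :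
    inftyEquation f ≠ 0 := fun h => fiberPower_two_sub_ne_zero f (by
  rw [← fiberPower_mul_inftyEquation, h, mul_zero])

theorem zeroEquation_ne_zero (b : Module.Basis (Fin 3) ℤ (Fin 3 → ℤ))
    (f : Laurent (⊤ : AddSubgroup (Fin 3 → ℤ))) : zeroEquation b f ≠ 0 := fun h =>
  fiberPower_two_sub_ne_zero f (by
    rw [zeroEquation] at h
    linear_combination (liftLaurent (coordProdInv b)) * h -
      (fiberPower 2 - liftLaurent f) * liftLaurent_coordProd_mul_inv b)

include hS hs in
theorem exists_local_equation (x : (toricCharts (bundleFan S) evenLattice).scheme) :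
    ∃ g : (toricCharts (bundleFan S) evenLattice).scheme.presheaf.stalk x, g ≠ 0 ∧
      idealStalk (embedding S s) x = Ideal.span {g} := by
  have := isIntegral_bundle hS
  obtain ⟨σ, hc, ⟨p, rfl⟩ | ⟨p, rfl, hp⟩⟩ := exists_chart_eq hS s x
  · obtain ⟨b, hb⟩ := exists_basis hS σ.2 hc
    refine ⟨_, fun h0 => ?_, idealStalk_zeroCone hS hs hb p⟩
    have h1 := chartGerm_injective _ _ _ (h0.trans (map_zero _).symm)
    exact zeroEquation_ne_zero b s.1 (congrArg Subtype.val h1)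
  · refine ⟨_, fun h0 => ?_, idealStalk_inftyCone hS hs p hp⟩
    have h1 := chartGerm_injective _ _ _ (h0.trans (map_zero _).symm)
    exact inftyEquation_ne_zero s.1 (congrArg Subtype.val h1)

end Main

/-! ### Logarithmic forms -/

section Dlog

theorem smul_mem_span_smul {K M : Type} [Field K] [AddCommGroup M] [Module K M] (O : Subring K)
    {m m' : M} (h : m ∈ Submodule.span O {m'}) (c : K) : c • m ∈ Submodule.span O {c • m'} := by
  obtain ⟨o, rfl⟩ := Submodule.mem_span_singleton.mp h
  refine Submodule.mem_span_singleton.mpr ⟨o, ?_⟩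
  change (o : K) • c • m' = c • (o : K) • m'
  rw [smul_comm]

variable {K : Type} [Field K] {n : ℕ} {Λ : AddSubgroup (Fin n → ℤ)}

theorem map_monomial_ne_zero (ρ : Laurent Λ →+* K) (m : dualLattice Λ) : ρ (monomial m) ≠ 0 := by
  intro h
  have h1 := congrArg ρ (monomial_mul_neg m)
  rw [map_mul, h, zero_mul, map_one] at h1
  exact zero_ne_one h1

variable [Algebra ℂ K]

/-- The logarithmic differentials of the characters. -/
def dlog (ρ : Laurent Λ →+* K) : dualLattice Λ →+ Ω[K⁄ℂ] :=
  AddMonoidHom.mk' (fun m => (ρ (monomial m))⁻¹ • KaehlerDifferential.D ℂ K (ρ (monomial m)))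
    fun m m' => by
      have h := map_monomial_ne_zero ρ m
      have h' := map_monomial_ne_zero ρ m'
      rw [← monomial_mul, map_mul, Derivation.leibniz, smul_add, smul_smul, smul_smul, mul_inv,
        add_comm]
      congr 2 <;> field_simp

theorem D_map_monomial (ρ : Laurent Λ →+* K) (m : dualLattice Λ) :
    KaehlerDifferential.D ℂ K (ρ (monomial m)) = ρ (monomial m) • dlog ρ m := by
  change _ = ρ (monomial m) •
    ((ρ (monomial m))⁻¹ • KaehlerDifferential.D ℂ K (ρ (monomial m)))
  rw [smul_smul, mul_inv_cancel₀ (map_monomial_ne_zero ρ m), one_smul]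

theorem two_mul_pairing_int (hΛ : ∀ u, u + u ∈ Λ) (m : dualLattice Λ) (u : Fin n → ℤ) :
    ∃ k : ℤ, pairing (m + m).1 u = k := by
  obtain ⟨k, hk⟩ := m.2 (u + u) (hΛ u)
  refine ⟨k, ?_⟩
  rw [← hk]
  simp [pairing, mul_add, add_mul, Finset.sum_add_distrib]

variable {v v' : Fin n → Fin n → ℤ}

theorem DualFrame.pairing_sum_zsmul (F : DualFrame Λ v) (a : Fin n → ℤ) (j : Fin n) :
    pairing (∑ i, a i • F.w i : dualLattice Λ).1 (v j) = a j := by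
  have h : ∀ s : Finset (Fin n), pairing (∑ i ∈ s, a i • F.w i : dualLattice Λ).1 (v j) =
      ∑ i ∈ s, (a i : ℚ) * pairing (F.w i).1 (v j) := by
    classical
    intro s
    induction s using Finset.induction_on with
    | empty => simp [pairing]
    | insert i s hi ih =>
      rw [Finset.sum_insert hi, Finset.sum_insert hi, ← ih, AddSubgroup.coe_add, pairing_add,
        AddSubgroup.coe_zsmul, pairing_zsmul]
  rw [h]
  simp [F.pairing_w]

/-- The frame may span only a sublattice of the dual lattice. By `hΛ` this sublattice contains `m +
m`, so half-integral coefficients suffice. -/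
theorem dlog_mem_span (hΛ : ∀ u, u + u ∈ Λ) (F : DualFrame Λ v) (ρ : Laurent Λ →+* K)
    (O : Subring K) (h2 : (2 : K)⁻¹ ∈ O) (m : dualLattice Λ) :
    dlog ρ m ∈ Submodule.span O (Set.range fun j => dlog ρ (F.w j)) := by
  have h20 : (2 : K) ≠ 0 := by
    have h := (map_ne_zero (algebraMap ℂ K)).mpr (two_ne_zero (α := ℂ))
    rwa [map_ofNat] at h
  choose k hk using fun j => two_mul_pairing_int hΛ m (v j)
  have hm : m + m = ∑ i, k i • F.w i := F.ext_pairing fun j => by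
    rw [hk, F.pairing_sum_zsmul]
  have h1 : dlog ρ m = (⟨2⁻¹, h2⟩ : O) • ∑ i, k i • dlog ρ (F.w i) := by
    rw [← algebraMap_smul K (⟨2⁻¹, h2⟩ : O)]
    change _ = (2 : K)⁻¹ • _
    simp only [← map_zsmul, ← map_sum]
    rw [← hm, map_add, ← two_smul K, smul_smul, inv_mul_cancel₀ h20, one_smul]
  rw [h1]
  exact Submodule.smul_mem _ _ (Submodule.sum_mem _ fun i _ =>
    zsmul_mem (Submodule.subset_span (Set.mem_range_self i)) _)

/-- The wedge of the logarithmic differentials of a frame. -/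
def dlogForm (F : DualFrame Λ v) (ρ : Laurent Λ →+* K) : ⋀[K]^n Ω[K⁄ℂ] :=
  exteriorPower.ιMulti K n fun j => dlog ρ (F.w j)

/-- The logarithmic differentials of either frame are `O`-combinations of those of the other, so one
logarithmic form can be used on all charts. -/
theorem span_dlogForm_eq (hΛ : ∀ u, u + u ∈ Λ) (F : DualFrame Λ v) (F' : DualFrame Λ v')
    (ρ : Laurent Λ →+* K) (O : Subring K) (h2 : (2 : K)⁻¹ ∈ O) (c : K) :
    Submodule.span O {c • dlogForm F ρ} = Submodule.span O {c • dlogForm F' ρ} := by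
  apply le_antisymm <;> rw [Submodule.span_singleton_le_iff_mem] <;>
  refine smul_mem_span_smul O (ιMulti_mem_span O _ _ fun j => ?_) c
  · exact dlog_mem_span hΛ F' ρ O h2 _
  · exact dlog_mem_span hΛ F ρ O h2 _

/-- `dx = x dlog x` in each factor, and the wedge is multilinear. -/
theorem ιMulti_D_eq (F : DualFrame Λ v) (ρ : Laurent Λ →+* K) :
    (exteriorPower.ιMulti K n fun j => KaehlerDifferential.D ℂ K (ρ (F.x j))) =
      ρ (∏ j, F.x j) • dlogForm F ρ := by
  have h : (fun j => KaehlerDifferential.D ℂ K (ρ (F.x j))) =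
      fun j => ρ (F.x j) • dlog ρ (F.w j) := funext fun j => D_map_monomial ρ (F.w j)
  rw [h, map_prod]
  exact (exteriorPower.ιMulti K n (M := Ω[K⁄ℂ])).toMultilinearMap.map_smul_univ _ _

end Dlog

/-! ### Forms on charts -/

namespace ChartSystem

variable {J : Type} [PartialOrder J] {R : Type} [CommRing R] [Algebra ℂ R] (C : ChartSystem J R)
  [IsDomain R] [IsIntegral C.scheme] {b : J} (hb : ∀ j, b ≤ j) (hA : C.A b = ⊤)
  (f : C.scheme ⟶ Spec (.of ℂ))
  (hf : C.ι b ≫ f = Spec.map (CommRingCat.ofHom (algebraMap ℂ (C.A b)))) {j : J} {n : ℕ}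
  (E : DoubleChart (C.A j) n)

include hf in
theorem isScalarTower : letI : Algebra ℂ C.scheme.functionField := (constants f).toAlgebra
    letI : Algebra R C.scheme.functionField := (C.toFunctionField hA).toAlgebra
    IsScalarTower ℂ R C.scheme.functionField := by
  let : Algebra ℂ C.scheme.functionField := (constants f).toAlgebra
  let : Algebra R C.scheme.functionField := (C.toFunctionField hA).toAlgebra
  exact IsScalarTower.of_algebraMap_eq fun c => C.constants_eq hA f hf c

include hb hf in
theorem formLattice_localRing (p : Spec (.of (C.A j))) (hp : Order.coheight (C.ι j p) = 1) :
    letI : Algebra ℂ C.scheme.functionField := (constants f).toAlgebra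
    formLattice C.scheme.functionField n (localRing (C.ι j p)) =
      Submodule.span (localRing (C.ι j p)) {(C.toFunctionField hA E.w)⁻¹ •
        exteriorPower.ιMulti C.scheme.functionField n fun i =>
          KaehlerDifferential.D ℂ C.scheme.functionField (C.toFunctionField hA (E.x i))} := by
  let : Algebra ℂ C.scheme.functionField := (constants f).toAlgebra
  let : Algebra R C.scheme.functionField := (C.toFunctionField hA).toAlgebra
  have : IsScalarTower ℂ R C.scheme.functionField := C.isScalarTower hA f hf
  exact E.formLattice_eq (C.toFunctionField_injective hA) (pointIdeal p)
    (C.eq_of_coheight_eq_one hp) _ (C.mem_localRing_iff hb hA j p)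

include hb hf in
theorem ιMulti_D_toFunctionField_ne_zero :
    letI : Algebra ℂ C.scheme.functionField := (constants f).toAlgebra
    (exteriorPower.ιMulti C.scheme.functionField n fun i =>
      KaehlerDifferential.D ℂ C.scheme.functionField (C.toFunctionField hA (E.x i))) ≠ 0 := by
  let : Algebra ℂ C.scheme.functionField := (constants f).toAlgebra
  let : Algebra R C.scheme.functionField := (C.toFunctionField hA).toAlgebra
  have : IsScalarTower ℂ R C.scheme.functionField := C.isScalarTower hA f hf
  exact E.ιMulti_D_ne_zero (C.toFunctionField_injective hA) (C.exists_mul_eq hb hA j)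

include hb hA in
theorem two_inv_mem_localRing (x : C.scheme) : (2 : C.scheme.functionField)⁻¹ ∈ localRing x := by
  obtain ⟨j, p, rfl⟩ := C.exists_ι_eq x
  rw [C.mem_localRing_iff hb hA]
  have h1 : (algebraMap ℂ R 2⁻¹) * 2 = 1 := by
    rw [← map_ofNat (algebraMap ℂ R) 2, ← map_mul, inv_mul_cancel₀ two_ne_zero, map_one]
  have h2 : C.toFunctionField hA (algebraMap ℂ R 2⁻¹) = 2⁻¹ := by
    refine eq_inv_of_mul_eq_one_left ?_
    rw [← map_ofNat (C.toFunctionField hA) 2, ← map_mul, h1, map_one]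
  refine ⟨algebraMap ℂ _ 2⁻¹, 1, fun h => ?_, ?_⟩
  · have hprime : (pointIdeal p).IsPrime := inferInstance
    exact hprime.ne_top ((Ideal.eq_top_iff_one _).mpr h)
  · rw [← h2]
    rw [OneMemClass.coe_one, map_one, mul_one]
    rfl

end ChartSystem

theorem span_idealStalk_smul {X Y : Scheme.{0}} [IsIntegral X] (i : Y ⟶ X) (x : X) {M : Type}
    [AddCommGroup M] [Module X.functionField M] (ω : M) {g : X.presheaf.stalk x}
    (hg : idealStalk i x = Ideal.span {g}) :
    Submodule.span (localRing x) {w : M | ∃ a ∈ idealStalk i x,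
      w = algebraMap _ X.functionField a • ω} =
    Submodule.span (localRing x) {algebraMap _ X.functionField g • ω} := by
  apply le_antisymm
  · refine Submodule.span_le.mpr ?_
    rintro _ ⟨a, ha, rfl⟩
    rw [hg] at ha
    obtain ⟨c, rfl⟩ := Ideal.mem_span_singleton.mp ha
    refine Submodule.mem_span_singleton.mpr ⟨⟨algebraMap _ _ c, c, rfl⟩, ?_⟩
    change algebraMap _ X.functionField c • algebraMap _ X.functionField g • ω = _
    rw [smul_smul, ← map_mul, mul_comm]
  · rw [Submodule.span_singleton_le_iff_mem]
    exact Submodule.subset_span ⟨g, hg ▸ Ideal.mem_span_singleton_self g, rfl⟩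

/-! ### The canonical classes -/

theorem evenLattice_add_self (u : Fin 4 → ℤ) : u + u ∈ evenLattice := ⟨u 3, rfl⟩

theorem coordProd_eq_prod (b : Module.Basis (Fin 3) ℤ (Fin 3 → ℤ)) :
    ∏ j, (basisFrame b).x j = coordProd b := by
  rw [coordProd_eq, map_prod]
  simp

/-- A chart whose coordinates are the characters `x_i` of a frame, where `(∏ x_i) d = w e a` for
the square root `w` and given functions `d`, `e`, `a`. -/
structure IsCharacterChart {R : Type} [CommRing R] [Algebra ℂ R] {A : Subalgebra ℂ R} {n : ℕ}
    (E : DoubleChart A n) {Λ : AddSubgroup (Fin n → ℤ)} {v : Fin n → Fin n → ℤ}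
    (F : DualFrame Λ v) (ψ : Laurent Λ →+* R) (a d e : R) : Prop where
  x_eq : ∀ i, E.x i = ψ (F.x i)
  prod_mul : ψ (∏ i, F.x i) * d = E.w * e * a

namespace ChartSystem

variable {J : Type} [PartialOrder J] {R : Type} [CommRing R] [Algebra ℂ R] (C : ChartSystem J R)
  [IsDomain R] [IsIntegral C.scheme] {b : J} (hb : ∀ j, b ≤ j) (hA : C.A b = ⊤)
  (f : C.scheme ⟶ Spec (.of ℂ))
  (hf : C.ι b ≫ f = Spec.map (CommRingCat.ofHom (algebraMap ℂ (C.A b)))) {j j₀ : J} {n : ℕ}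
  {E : DoubleChart (C.A j) n} {E₀ : DoubleChart (C.A j₀) n} {Λ : AddSubgroup (Fin n → ℤ)}
  {v v₀ : Fin n → Fin n → ℤ} {F : DualFrame Λ v} {F₀ : DualFrame Λ v₀} {ψ : Laurent Λ →+* R}
  {a d e e₀ : R}

include hb hf in
theorem dlogForm_ne_zero (h : IsCharacterChart E F ψ a d e) :
    letI : Algebra ℂ C.scheme.functionField := (constants f).toAlgebra
    dlogForm F ((C.toFunctionField hA).comp ψ) ≠ 0 := by
  let : Algebra ℂ C.scheme.functionField := (constants f).toAlgebra
  intro h0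
  refine C.ιMulti_D_toFunctionField_ne_zero hb hA f hf E ?_
  have h1 := ιMulti_D_eq F ((C.toFunctionField hA).comp ψ)
  rw [h0, smul_zero] at h1
  simp only [h.x_eq]
  exact h1

include hb hf in
/-- The forms on a chart in terms of a fixed logarithmic form. -/
theorem formLattice_eq_span_dlogForm (hΛ : ∀ u, u + u ∈ Λ) (hd : d ≠ 0)
    (h : IsCharacterChart E F ψ a d e) (F₀ : DualFrame Λ v₀) (p : Spec (.of (C.A j)))
    (hp : Order.coheight (C.ι j p) = 1) :
    letI : Algebra ℂ C.scheme.functionField := (constants f).toAlgebra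
    formLattice C.scheme.functionField n (localRing (C.ι j p)) =
      Submodule.span (localRing (C.ι j p)) {C.toFunctionField hA e •
        ((C.toFunctionField hA a * (C.toFunctionField hA d)⁻¹) •
          dlogForm F₀ ((C.toFunctionField hA).comp ψ))} := by
  let : Algebra ℂ C.scheme.functionField := (constants f).toAlgebra
  have hτ := C.toFunctionField_injective hA
  let : Algebra R C.scheme.functionField := (C.toFunctionField hA).toAlgebra
  have hw : C.toFunctionField hA E.w ≠ 0 := E.algebraMap_w_ne_zero (K := C.scheme.functionField) hτ
  have hd' : C.toFunctionField hA d ≠ 0 := fun h0 => hd (hτ (h0.trans (map_zero _).symm))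
  refine (C.formLattice_localRing hb hA f hf E p hp).trans ?_
  have h1 := ιMulti_D_eq F ((C.toFunctionField hA).comp ψ)
  have h2 : (exteriorPower.ιMulti C.scheme.functionField n fun i =>
      KaehlerDifferential.D ℂ C.scheme.functionField (C.toFunctionField hA (E.x i))) =
      C.toFunctionField hA (ψ (∏ i, F.x i)) • dlogForm F ((C.toFunctionField hA).comp ψ) := by
    simp only [h.x_eq]
    exact h1
  -- The generator `dx₁ ∧ ⋯ ∧ dxₙ / w` has coefficient `(∏ xᵢ) / w = ea / d` relative to the
  -- logarithmic form.
  have h3 : (C.toFunctionField hA E.w)⁻¹ * C.toFunctionField hA (ψ (∏ i, F.x i)) =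
      C.toFunctionField hA e * (C.toFunctionField hA a * (C.toFunctionField hA d)⁻¹) := by
    have h4 := congrArg (C.toFunctionField hA) h.prod_mul
    rw [map_mul, map_mul, map_mul] at h4
    field_simp
    linear_combination h4
  rw [h2, smul_smul, h3, smul_smul]
  exact span_dlogForm_eq hΛ F F₀ _ _ (C.two_inv_mem_localRing hb hA _) _

include hb hA hf in
-- The global form is `a / d` times a logarithmic form; the function `e` measures its deviation from
-- a local generator, and here `e = 1` on the charts covering the scheme.
theorem hasTrivialCanonical (hΛ : ∀ u, u + u ∈ Λ) (ha : a ≠ 0) (hd : d ≠ 0)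
    (h₀ : IsCharacterChart E₀ F₀ ψ a d e₀)
    (hcov : ∀ x : C.scheme, ∃ (j : J) (p : Spec (.of (C.A j))) (E : DoubleChart (C.A j) n)
      (v : Fin n → Fin n → ℤ) (F : DualFrame Λ v), C.ι j p = x ∧ IsCharacterChart E F ψ a d 1) :
    HasTrivialCanonical n f := by
  let : Algebra ℂ C.scheme.functionField := (constants f).toAlgebra
  have hτ := C.toFunctionField_injective hA
  refine ⟨(C.toFunctionField hA a * (C.toFunctionField hA d)⁻¹) •
    dlogForm F₀ ((C.toFunctionField hA).comp ψ), smul_ne_zero (mul_ne_zero ?_ (inv_ne_zero ?_))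
      (C.dlogForm_ne_zero hb hA f hf h₀), fun x hx => ?_⟩
  · exact fun h0 => ha (hτ (h0.trans (map_zero _).symm))
  · exact fun h0 => hd (hτ (h0.trans (map_zero _).symm))
  · obtain ⟨j, p, E, v, F, rfl, h⟩ := hcov x
    refine (C.formLattice_eq_span_dlogForm hb hA f hf hΛ hd h F₀ p hx).trans ?_
    rw [map_one, one_smul]

include hb hA hf in
-- Here the deviation `e` is the local equation of `Y`: local generators are `e` times the global
-- form `(a / d) dlog`, so that form has divisor `-Y`.
theorem isAnticanonical {Y : Scheme.{0}} (i : Y ⟶ C.scheme) (hΛ : ∀ u, u + u ∈ Λ) (ha : a ≠ 0)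
    (hd : d ≠ 0) (h₀ : IsCharacterChart E₀ F₀ ψ a d e₀)
    (hcov : ∀ x : C.scheme, ∃ (j : J) (p : Spec (.of (C.A j))) (E : DoubleChart (C.A j) n)
      (v : Fin n → Fin n → ℤ) (F : DualFrame Λ v) (e : C.A j), C.ι j p = x ∧
        IsCharacterChart E F ψ a d e ∧ idealStalk i (C.ι j p) =
          Ideal.span {chartGerm (C.ι j) (C.ι j p) (mem_opensRange_self _ p) e}) :
    IsAnticanonical n f i := by
  let : Algebra ℂ C.scheme.functionField := (constants f).toAlgebra
  have hτ := C.toFunctionField_injective hA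
  refine ⟨(C.toFunctionField hA a * (C.toFunctionField hA d)⁻¹) •
    dlogForm F₀ ((C.toFunctionField hA).comp ψ), smul_ne_zero (mul_ne_zero ?_ (inv_ne_zero ?_))
      (C.dlogForm_ne_zero hb hA f hf h₀), fun x hx => ?_⟩
  · exact fun h0 => ha (hτ (h0.trans (map_zero _).symm))
  · exact fun h0 => hd (hτ (h0.trans (map_zero _).symm))
  · obtain ⟨j, p, E, v, F, e, rfl, h, hI⟩ := hcov x
    refine (C.formLattice_eq_span_dlogForm hb hA f hf hΛ hd h F₀ p hx).trans ?_
    refine Eq.trans ?_ (span_idealStalk_smul _ _ _ hI).symm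
    rw [C.algebraMap_chartGerm hb hA]

end ChartSystem

/-- Since `w = x₁x₂x₃y`, the form is `y⁻¹` times the logarithmic form on every chart. -/
theorem isCharacterChart_coverChart (b : Module.Basis (Fin 3) ℤ (Fin 3 → ℤ)) {V : Set (Fin 3 → ℤ)}
    (hV : V = Set.range b) {f : Laurent (⊤ : AddSubgroup (Fin 3 → ℤ))} (hf : f ∈ cutoff ⊤ V (-1))
    (hsnc : IsSNC (zeroIdeal V 2 f)) {g : MvPolynomial (Fin 3) ℂ}
    (hg : coordProd b * f = MvPolynomial.aeval (basisFrame b).x g) :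
    IsCharacterChart (coverChart b hV hf hsnc hg) (basisFrame b) (algebraMap _ _) 1 ⟨0, 1⟩ 1 where
  x_eq _ := rfl
  prod_mul := by
    rw [coordProd_eq_prod, mul_one, mul_one]
    have h := algebraMap_add_mul_root (f := f) 0 (coordProd b) 1
    rw [map_zero, zero_add, mul_one] at h
    exact h

/-- On the bundle the product of the four coordinates is `w²`, so one factor `w` cancels from the
required relation. -/
theorem isCharacterChart_liftChart (b : Module.Basis (Fin 3) ℤ (Fin 3 → ℤ))
    {σ : Finset (Fin 3 → ℤ)} (hσ : (σ : Set (Fin 3 → ℤ)) = Set.range b) {ε : ℤ} (c : ℤ)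
    (hε : ε * ε = 1) (hc : 2 * c = 1 + ε) {a d e : Laurent evenLattice}
    (h : (liftChart b hσ c hε hc).w * d = e * a) :
    IsCharacterChart (liftChart b hσ c hε hc) (liftFrame b ε hε) (RingHom.id _) a d e where
  x_eq _ := rfl
  prod_mul := by
    have hw : ∏ j, (liftFrame b ε hε).x j =
        (liftChart b hσ c hε hc).w * (liftChart b hσ c hε hc).w := by
      rw [(liftChart b hσ c hε hc).mul_self]
      change _ = MvPolynomial.aeval (liftFrame b ε hε).x (∏ j, MvPolynomial.X j)
      rw [map_prod]
      simp
    rw [RingHom.id_apply, hw, mul_assoc, h, mul_assoc]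

/-- Here `w = x₁x₂x₃t`, and the relation is `x₁x₂x₃t · (t² - f) = x₁x₂x₃(t² - f) · t`. -/
theorem isCharacterChart_zeroChart (b : Module.Basis (Fin 3) ℤ (Fin 3 → ℤ))
    {σ : Finset (Fin 3 → ℤ)} (hσ : (σ : Set (Fin 3 → ℤ)) = Set.range b)
    (f : Laurent (⊤ : AddSubgroup (Fin 3 → ℤ))) :
    IsCharacterChart (zeroChart b hσ) (liftFrame b 1 rfl) (RingHom.id _) (fiberPower 1)
      (fiberPower 2 - liftLaurent f) (zeroEquation b f) := by
  refine isCharacterChart_liftChart b hσ 1 rfl rfl ?_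
  change (zeroChart b hσ).w * _ = _
  rw [zeroChart_w, zeroEquation]
  ring

/-- Here `w = t⁻¹`, and the relation is `t⁻¹(t² - f) = (1 - ft⁻²)t`; the constants `t` and `t² - f`
are the same as near zero, so the form is global. -/
theorem isCharacterChart_inftyChart (b : Module.Basis (Fin 3) ℤ (Fin 3 → ℤ))
    {σ : Finset (Fin 3 → ℤ)} (hσ : (σ : Set (Fin 3 → ℤ)) = Set.range b)
    (f : Laurent (⊤ : AddSubgroup (Fin 3 → ℤ))) :
    IsCharacterChart (inftyChart b hσ) (liftFrame b (-1) rfl) (RingHom.id _) (fiberPower 1)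
      (fiberPower 2 - liftLaurent f) (inftyEquation f) := by
  refine isCharacterChart_liftChart b hσ 0 rfl rfl ?_
  change (inftyChart b hσ).w * _ = _
  rw [inftyChart_w, ← fiberPower_mul_inftyEquation, ← mul_assoc, fiberPower_add, mul_comm]
  rfl

/-! ### The canonical class of the cover and the divisor class of its image -/

section Main

variable {S : ConeComplex 3} (hS : IsSmoothMPCPFan S) {s : anticanonicalSections S}
  (hs : IsAdmissible S s)

include hS hs in
theorem hasTrivialCanonical_cover [IsIntegral (coverCharts S s).scheme]
    (f : (coverCharts S s).scheme ⟶ Spec (.of ℂ))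
    (hf : (coverCharts S s).ι (originCone hS) ≫ f =
      Spec.map (CommRingCat.ofHom (algebraMap ℂ ((coverCharts S s).A (originCone hS))))) :
    HasTrivialCanonical 3 f := by
  have := isDomain_quadratic hS hs
  have hroot : (⟨0, 1⟩ : QuadraticAlgebra (Laurent (⊤ : AddSubgroup (Fin 3 → ℤ))) s.1 0) ≠ 0 :=
    fun h0 => one_ne_zero (congrArg QuadraticAlgebra.im h0)
  obtain ⟨σ, hc⟩ := exists_maximal hS
  obtain ⟨b, hb⟩ := exists_basis hS σ.2 hc
  obtain ⟨g, hg⟩ := exists_equation b (hb ▸ section_mem S s σ)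
  refine (coverCharts S s).hasTrivialCanonical (j₀ := σ) (Λ := ⊤) (originCone_le hS)
    (coverCharts_originCone hS s) f hf (fun _ => trivial) one_ne_zero hroot
    (isCharacterChart_coverChart b hb (section_mem S s σ) (hs σ.1 σ.2).2 hg) fun x => ?_
  obtain ⟨σ, hc, p, rfl⟩ := exists_maximal_chart hS x
  obtain ⟨b, hb⟩ := exists_basis hS σ.2 hc
  obtain ⟨g, hg⟩ := exists_equation b (hb ▸ section_mem S s σ)
  exact ⟨σ, p, coverChart b hb (section_mem S s σ) (hs σ.1 σ.2).2 hg, b, basisFrame b, rfl,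
    isCharacterChart_coverChart b hb (section_mem S s σ) (hs σ.1 σ.2).2 hg⟩

include hS hs in
theorem isAnticanonical_embedding [IsIntegral (toricCharts (bundleFan S) evenLattice).scheme] :
    IsAnticanonical 4 (toricCharts (bundleFan S) evenLattice).structureMap (embedding S s) := by
  have := isDomain_laurent hS
  have hone : fiberPower 1 ≠ 0 := fun h0 => by
    have h1 := fiberPower_add 1 (-1)
    rw [h0, zero_mul, add_neg_cancel, fiberPower_zero] at h1
    exact zero_ne_one h1
  obtain ⟨σ, hc⟩ := exists_maximal hS
  obtain ⟨b, hb⟩ := exists_basis hS σ.2 hc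
  refine (toricCharts (bundleFan S) evenLattice).isAnticanonical (j₀ := zeroCone S σ)
    (originLift_le hS) (toricCharts_originLift hS) _
    ((toricCharts (bundleFan S) evenLattice).ι_structureMap (originLift hS)) (embedding S s)
    evenLattice_add_self hone (fiberPower_two_sub_ne_zero s.1)
    (isCharacterChart_zeroChart b hb s.1) fun x => ?_
  obtain ⟨σ, hc, ⟨p, rfl⟩ | ⟨p, rfl, hp⟩⟩ := exists_chart_eq hS s x
  · obtain ⟨b, hb⟩ := exists_basis hS σ.2 hc
    exact ⟨zeroCone S σ, p, zeroChart b hb, _, liftFrame b 1 rfl, _, rfl,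
      isCharacterChart_zeroChart b hb s.1, idealStalk_zeroCone hS hs hb p⟩
  · obtain ⟨b, hb⟩ := exists_basis hS σ.2 hc
    exact ⟨inftyCone S σ, p, inftyChart b hb, _, liftFrame b (-1) rfl, _, rfl,
      isCharacterChart_inftyChart b hb s.1, idealStalk_inftyCone hS hs p hp⟩

end Main

end ToricDoubleCover

end

theorem mainTheorem8 (S : ToricDoubleCover.ConeComplex 3)
    (hS : ToricDoubleCover.IsSmoothMPCPFan S)
    (s : ToricDoubleCover.anticanonicalSections S)
    (hs : ToricDoubleCover.IsAdmissible S s) :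
    ∃ i : ToricDoubleCover.doubleCover S s ⟶
        ToricDoubleCover.toricVariety (ToricDoubleCover.bundleFan S) ToricDoubleCover.evenLattice,
      i ≫ ToricDoubleCover.toricVariety.toSpec (ToricDoubleCover.bundleFan S)
          ToricDoubleCover.evenLattice = ToricDoubleCover.doubleCover.toSpec S s ∧
      ToricDoubleCover.IsCalabiYauHypersurface 3
        (ToricDoubleCover.toricVariety.toSpec (ToricDoubleCover.bundleFan S)
          ToricDoubleCover.evenLattice) i := by
  have hX := ToricDoubleCover.isIntegral_bundle hS
  have hY := ToricDoubleCover.isIntegral_cover hS hs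
  exact ⟨ToricDoubleCover.embedding S s, ToricDoubleCover.embedding_structureMap S s,
    ToricDoubleCover.isClosedImmersion_embedding hS hs, hX, hY,
    ToricDoubleCover.exists_local_equation hS hs,
    ToricDoubleCover.isAnticanonical_embedding hS hs,
    ToricDoubleCover.isIntegrallyClosed_stalk_cover hS hs,
    ToricDoubleCover.hasTrivialCanonical_cover hS hs _
      (ToricDoubleCover.ι_embedding_structureMap S s _)⟩
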